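/- Let $\mathbf u=(u_1,u_2,v_1,v_2,w_1,w_2)\in\mathbb C^6$, let $s_i$ ($1\le i\le 5$) interchange the entries of $\mathbf u$ in places $i$ and $i+1$, and put $r_1=s_2s_1s_2$, $r_3=s_4s_3s_4$, $p_3=s_2s_3s_2$, $p_5=s_4s_5s_4$; these interchange respectively $u_1\leftrightarrow v_1$, $v_1\leftrightarrow w_1$, $u_2\leftrightarrow v_2$, $v_2\leftrightarrow w_2$. Let $\mathcal S_1,\dots,\mathcal S_5$ be the following operators in three variables $z_1,z_2,z_3$, where $\mathcal S_i(\mathbf u)$ means $\mathcal S_i(a)$ with $a$ the difference of the $i$-th and the $(i+1)$-st entry of $\mathbf u$. The operators $\mathcal S_1,\mathcal S_3,\mathcal S_5$ are obtained from $W(a)$ by $z\to z_1,z_2,z_3$, and $\mathcal S_2$ is the operator of multiplication given below, from which $\mathcal S_4$ is obtained by $(z_1,z_2)\to(z_2,z_3)$. (o) No deformation: $$W(a)=z^{-a}\,\frac{\Gamma(z\partial+1)}{\Gamma(z\partial+1-a)},\qquad \mathcal S_2(a)=(z_2-z_1)^a=z_2^a\Bigl(1-\frac{z_1}{z_2}\Bigr)^a,$$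 the latter expanded in powers of $z_1/z_2$. Operators are formal series in powers of $z_1/z_2$ and $z_2/z_3$, up to a monomial with complex exponents, with coefficients that are functions of $z_1\partial_1,z_2\partial_2,z_3\partial_3$. (q) Quantum deformation, $q=e^h$ with $\operatorname{Re}h<0$, $q^c=e^{ch}$, $(x;q^2)=\prod_{k\ge0}(1-xq^{2k})$: $$W(a)=q^{a^2/2}z^{-a}\,\frac{(q^{2-2a+2z\partial};q^2)}{(q^{2+2z\partial};q^2)}\,q^{-az\partial},\qquad \mathcal S_2(a)=z_1^a\,\frac{(\frac{z_2}{z_1}q^{1-a};q^2)}{(\frac{z_2}{z_1}q^{1+a};q^2)},$$ where the first quotient is expanded as a power series in $q^{2z\partial}$. Operators are formal power series in $q^{2z_j\partial_j}$, up to a dilatation with complex exponents, with coefficients that are functions of $\log z_1,\log z_2,\log z_3$. (e) Elliptic deformation, $\operatorname{Im}\tau>0$, $\operatorname{Im}\eta>0$. Put $\theta_1(z|\tau)=\sum_{n\in\mathbb Z}e^{\pi i(n+\frac12)^2\tau}e^{2\pi i(n+\frac12)(z+\frac12)}$, $[x]=\theta_1(2\eta x|\tau)$, $[x]_k=[x][x+1]\cdots[x+k-1]$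 (so $[x]_0=1$), $[k]!=[1][2]\cdots[k]$, $\Gamma(z|\tau,\tau')=\prod_{n,m\ge0}\frac{1-e^{2\pi i(\tau(n+1)+\tau'(m+1)-z)}}{1-e^{2\pi i(\tau n+\tau' m+z)}}$ and $\gamma(z)=\Gamma(\eta z|\tau,2\eta)$, and assume $[k]\ne0$ for all integers $k\ge1$. Then $$W(a)=\frac{e^{2\pi ia\eta z+\pi i\eta a^2}\gamma(2z)}{\gamma(2z+2a)}\sum_{k=0}^\infty\frac{[-z-a+2k]\,[-z-a]_k\,[-a]_k}{[-z-a]\,[-z+1]_k\,[k]!}\,e^{(a-2k)\partial},$$ $$\mathcal S_2(a)=e^{-2\pi ia\eta z_1}\,\frac{\gamma(z_1+z_2+1+a)}{\gamma(z_1+z_2+1-a)}\,\frac{\gamma(z_1-z_2+1+a)}{\gamma(z_1-z_2+1-a)}.$$ Operators are formal power series in $e^{-2\partial_j}$, up to a shift by a complex vector, with coefficients that are functions of $z_1,z_2,z_3$. In all cases operators are multiplied as operators, and two operators are equal when their series coincide, coefficient functions being compared at generic points (almost everywhere). Define $$\check{\mathcal R}^{(1)}_{12}(\mathbf u)=\mathcal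 S_2(s_1s_2\mathbf u)\mathcal S_1(s_2\mathbf u)\mathcal S_2(\mathbf u),\qquad \check{\mathcal R}^{(1)}_{23}(\mathbf u)=\mathcal S_4(s_3s_4\mathbf u)\mathcal S_3(s_4\mathbf u)\mathcal S_4(\mathbf u),$$ $$\check{\mathcal R}^{(2)}_{12}(\mathbf u)=\mathcal S_2(s_3s_2\mathbf u)\mathcal S_3(s_2\mathbf u)\mathcal S_2(\mathbf u),\qquad \check{\mathcal R}^{(2)}_{23}(\mathbf u)=\mathcal S_4(s_5s_4\mathbf u)\mathcal S_5(s_4\mathbf u)\mathcal S_4(\mathbf u).$$ Then in each of the three cases, for every $\mathbf u\in\mathbb C^6$, $$\check{\mathcal R}^{(2)}_{12}(r_1\mathbf u)\check{\mathcal R}^{(1)}_{12}(\mathbf u)=\check{\mathcal R}^{(1)}_{12}(p_3\mathbf u)\check{\mathcal R}^{(2)}_{12}(\mathbf u),\qquad \check{\mathcal R}^{(2)}_{23}(r_3\mathbf u)\check{\mathcal R}^{(1)}_{23}(\mathbf u)=\check{\mathcal R}^{(1)}_{23}(p_5\mathbf u)\check{\mathcal R}^{(2)}_{23}(\mathbf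 u),$$ $$\check{\mathcal R}^{(2)}_{23}(r_1\mathbf u)\check{\mathcal R}^{(1)}_{12}(\mathbf u)=\check{\mathcal R}^{(1)}_{12}(p_5\mathbf u)\check{\mathcal R}^{(2)}_{23}(\mathbf u),\qquad \check{\mathcal R}^{(2)}_{12}(r_3\mathbf u)\check{\mathcal R}^{(1)}_{23}(\mathbf u)=\check{\mathcal R}^{(1)}_{23}(p_3\mathbf u)\check{\mathcal R}^{(2)}_{12}(\mathbf u),$$ $$\check{\mathcal R}^{(1)}_{23}(r_1r_3\mathbf u)\check{\mathcal R}^{(1)}_{12}(r_3\mathbf u)\check{\mathcal R}^{(1)}_{23}(\mathbf u)=\check{\mathcal R}^{(1)}_{12}(r_3r_1\mathbf u)\check{\mathcal R}^{(1)}_{23}(r_1\mathbf u)\check{\mathcal R}^{(1)}_{12}(\mathbf u),$$ $$\check{\mathcal R}^{(2)}_{23}(p_3p_5\mathbf u)\check{\mathcal R}^{(2)}_{12}(p_5\mathbf u)\check{\mathcal R}^{(2)}_{23}(\mathbf u)=\check{\mathcal R}^{(2)}_{12}(p_5p_3\mathbf u)\check{\mathcal R}^{(2)}_{23}(p_3\mathbf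 u)\check{\mathcal R}^{(2)}_{12}(\mathbf u).$$ These are the commutation relations and the triple relations of $\mathfrak S_3\times\mathfrak S_3$. -/

import Mathlib

open MeasureTheory

noncomputable section

namespace ParamPerm

/-! ### Formal series of shift operators

The operators are formal series `∑ₙ cₙ(x) T^(v + ∑ⱼ nⱼ Mⱼ)`, with `n` running over multi-indices
in `ℕ^σ`, where `T^w` is the translation `x ↦ x + w` of the three variables, so that
`T^w f(x) = f(x + w) T^w`, and where the coefficients are functions of `x ∈ ℂ³`. -/

/-- The space of the three variables. -/
abbrev X : Type := Fin 3 → ℂ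

/-- Coefficient functions on `ℂ³`, two functions being identified when they agree off a
Lebesgue null set. In particular a function that is only defined off its polar divisor
determines an element, and two meromorphic functions are identified only if they are equal. -/
abbrev Coef : Type := Filter.Germ (ae (volume : Measure X)) ℂ

theorem tendsto_add_ae (w : X) :
    Filter.Tendsto (fun x : X => x + w) (ae volume) (ae volume) :=
  (measurePreserving_add_right volume w).quasiMeasurePreserving.tendsto_ae

/-- The translate `x ↦ f (x + w)` of a coefficient function. -/
def Coef.shift (w : X) (f : Coef) : Coef :=
  f.compTendsto (fun x : X => x + w) (tendsto_add_ae w)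

/-- The formal series `∑ₙ coeff n · T^(lead + ∑ⱼ nⱼ Mⱼ)`. -/
@[ext]
structure ShiftSeries {σ : Type} (M : σ → X) where
  lead : X
  coeff : (σ →₀ ℕ) → Coef

namespace ShiftSeries

variable {σ : Type} {M : σ → X}

/-- The shift `lead + ∑ⱼ nⱼ Mⱼ` of the term with multi-index `n`. -/
def exponent (A : ShiftSeries M) (n : σ →₀ ℕ) : X :=
  A.lead + n.sum fun j k => (k : ℂ) • M j

/-- Composition of operators: `(c T^v) (d T^w) = c · d(· + v) T^(v + w)`. -/
instance [DecidableEq σ] : Mul (ShiftSeries M) where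
  mul A B :=
    { lead := A.lead + B.lead
      coeff := fun n =>
        ∑ p ∈ Finset.HasAntidiagonal.antidiagonal n, A.coeff p.1 * (B.coeff p.2).shift (A.exponent p.1) }

/-- The series `∑ₖ cₖ(x) T^(v + k Mⱼ)` in one direction `j`. -/
def power [DecidableEq σ] (v : X) (j : σ) (c : ℕ → X → ℂ) : ShiftSeries M where
  lead := v
  coeff n := if n = Finsupp.single j (n j) then ((c (n j) : X → ℂ) : Coef) else 0

/-- The operator of multiplication by the function `f`. -/
def ofFun [DecidableEq σ] (f : X → ℂ) : ShiftSeries M where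
  lead := 0
  coeff n := if n = 0 then (f : Coef) else 0

/-- The translation `T^v`. -/
def translation [DecidableEq σ] (v : X) : ShiftSeries M where
  lead := v
  coeff n := if n = 0 then 1 else 0

end ShiftSeries

/-- The Taylor coefficient of order `k` of `F` at `0`. -/
def taylorCoeff (F : ℂ → ℂ) (k : ℕ) : ℂ := iteratedDeriv k F 0 / (k.factorial : ℂ)

/-! ### No deformation

Operators `∑ z^α f(z₁∂₁, z₂∂₂, z₃∂₃)`. The coefficients are functions of the eigenvalues
`x = (x₁, x₂, x₃)` of the Euler operators `zᵢ∂ᵢ`, on which `z^α` acts as a translation by `-α`,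
because `z^α f(z∂) = f(z∂ - α) z^α`. The directions of the series are
multiplication by `z₁/z₂` and by `z₂/z₃`. -/

namespace Undeformed

/-- The directions of `z₁/z₂` and `z₂/z₃`. -/
def dir (i : Fin 2) : X := -(Pi.single i.castSucc 1 - Pi.single i.succ 1)

/-- The monomial `z^α`. -/
def monomial (α : X) : ShiftSeries dir := ShiftSeries.translation (-α)

/-- `W(a) = z⁻ᵃ Γ(z∂ + 1) / Γ(z∂ + 1 - a)` in the variable `z = zⱼ`. -/
def W (j : Fin 3) (a : ℂ) : ShiftSeries dir :=
  monomial (Pi.single j (-a)) *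
    ShiftSeries.ofFun fun x => Complex.Gamma (x j + 1) / Complex.Gamma (x j + 1 - a)

/-- `(z_{i+1} - z_i)^a = z_{i+1}^a (1 - z_i/z_{i+1})^a`, expanded in powers of `z_i/z_{i+1}`. -/
def V (i : Fin 2) (a : ℂ) : ShiftSeries dir :=
  ShiftSeries.power (-(Pi.single i.succ a)) i fun k _ => taylorCoeff (fun s => (1 - s) ^ a) k

/-- The operators `S₁, …, S₅`. -/
def S : Fin 5 → ℂ → ShiftSeries dir := ![W 0, V 0, W 1, V 1, W 2]

end Undeformed

/-! ### Quantum deformation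

Here `q = e^h`, `q^c = e^(c h)`. The coefficients are functions of the logarithmic
coordinates `x`, `zⱼ = e^(xⱼ)`, `zⱼ^c = e^(c xⱼ)`, in which `q^(c zⱼ∂ⱼ)` is the translation
of `xⱼ` by `c h`. The series are power series in the dilatations `q^(2 zⱼ∂ⱼ)`. -/

namespace Quantum

/-- `q^c`. -/
def qpow (h c : ℂ) : ℂ := Complex.exp (c * h)

/-- `(y; q²) = ∏_{k ≥ 0} (1 - y q^(2k))`. -/
def poch (h y : ℂ) : ℂ := ∏' k : ℕ, (1 - y * qpow h (2 * k))

/-- The directions of `q^(2 zⱼ∂ⱼ)`, `j = 1, 2, 3`. -/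
def dir (h : ℂ) (j : Fin 3) : X := Pi.single j (2 * h)

/-- `W(a) = q^(a²/2) z⁻ᵃ (q^(2-2a+2z∂); q²) / (q^(2+2z∂); q²) q^(-a z∂)` in the variable
`z = zⱼ`, where the quotient is expanded as a power series in `s = q^(2z∂)`. -/
def W (h : ℂ) (j : Fin 3) (a : ℂ) : ShiftSeries (dir h) :=
  ShiftSeries.power (Pi.single j (-a * h)) j fun k x =>
    qpow h (a ^ 2 / 2) * Complex.exp (-a * x j) *
      taylorCoeff (fun s => poch h (qpow h (2 - 2 * a) * s) / poch h (qpow h 2 * s)) k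

/-- Multiplication by `z_i^a (z_{i+1}/z_i q^(1-a); q²) / (z_{i+1}/z_i q^(1+a); q²)`. -/
def V (h : ℂ) (i : Fin 2) (a : ℂ) : ShiftSeries (dir h) :=
  ShiftSeries.ofFun fun x =>
    Complex.exp (a * x i.castSucc) *
      (poch h (Complex.exp (x i.succ - x i.castSucc) * qpow h (1 - a)) /
        poch h (Complex.exp (x i.succ - x i.castSucc) * qpow h (1 + a)))

/-- The operators `S₁, …, S₅`. -/
def S (h : ℂ) : Fin 5 → ℂ → ShiftSeries (dir h) := ![W h 0, V h 0, W h 1, V h 1, W h 2]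

end Quantum

/-! ### Elliptic deformation

The coefficients are functions of `x = (z₁, z₂, z₃)` and `e^(c ∂ⱼ)` is the translation of `zⱼ`
by `c`. The series are power series in `e^(-2 ∂ⱼ)`. -/

namespace Elliptic

/-- The theta function `θ₁(z | τ)`. -/
def theta1 (z τ : ℂ) : ℂ :=
  ∑' n : ℤ, Complex.exp (Real.pi * Complex.I * ((n : ℂ) + 1 / 2) ^ 2 * τ) *
    Complex.exp (2 * Real.pi * Complex.I * ((n : ℂ) + 1 / 2) * (z + 1 / 2))

/-- The elliptic number `[c] = θ₁(2ηc | τ)`. -/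
def num (η τ c : ℂ) : ℂ := theta1 (2 * η * c) τ

/-- `[c]_k = [c] [c + 1] ⋯ [c + k - 1]`. -/
def poch (η τ c : ℂ) (k : ℕ) : ℂ := ∏ r ∈ Finset.range k, num η τ (c + r)

/-- `[k]! = [1] [2] ⋯ [k]`. -/
def fact (η τ : ℂ) (k : ℕ) : ℂ := ∏ r ∈ Finset.range k, num η τ ((r : ℂ) + 1)

/-- The elliptic gamma function `Γ(z | τ, τ')`. -/
def ellGamma (z τ τ' : ℂ) : ℂ :=
  ∏' p : ℕ × ℕ,
    (1 - Complex.exp (2 * Real.pi * Complex.I * (τ * (p.1 + 1) + τ' * (p.2 + 1) - z))) /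
      (1 - Complex.exp (2 * Real.pi * Complex.I * (τ * p.1 + τ' * p.2 + z)))

/-- `γ(z) = Γ(ηz | τ, 2η)`. -/
def gam (η τ z : ℂ) : ℂ := ellGamma (η * z) τ (2 * η)

/-- The directions of `e^(-2 ∂ⱼ)`, `j = 1, 2, 3`. -/
def dir (j : Fin 3) : X := Pi.single j (-2)

/-- In the variable `z = zⱼ`,
`W(a) = e^(2πiaηz + πiηa²) γ(2z)/γ(2z + 2a)
  ∑ₖ [-z-a+2k] [-z-a]_k [-a]_k / ([-z-a] [-z+1]_k [k]!) e^((a - 2k) ∂)`. -/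
def W (η τ : ℂ) (j : Fin 3) (a : ℂ) : ShiftSeries dir :=
  ShiftSeries.power (Pi.single j a) j fun k x =>
    Complex.exp (2 * Real.pi * Complex.I * a * η * x j + Real.pi * Complex.I * η * a ^ 2) *
      (gam η τ (2 * x j) / gam η τ (2 * x j + 2 * a)) *
      (num η τ (-x j - a + 2 * k) * poch η τ (-x j - a) k * poch η τ (-a) k /
        (num η τ (-x j - a) * poch η τ (-x j + 1) k * fact η τ k))

/-- Multiplication by `e^(-2πiηa z_i) γ(z_i + z_{i+1} + 1 + a) / γ(z_i + z_{i+1} + 1 - a) ·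
γ(z_i - z_{i+1} + 1 + a) / γ(z_i - z_{i+1} + 1 - a)`. -/
def V (η τ : ℂ) (i : Fin 2) (a : ℂ) : ShiftSeries dir :=
  ShiftSeries.ofFun fun x =>
    Complex.exp (-(2 * Real.pi * Complex.I * a * η * x i.castSucc)) *
      (gam η τ (x i.castSucc + x i.succ + 1 + a) / gam η τ (x i.castSucc + x i.succ + 1 - a)) *
      (gam η τ (x i.castSucc - x i.succ + 1 + a) / gam η τ (x i.castSucc - x i.succ + 1 - a))

/-- The operators `S₁, …, S₅`. -/
def S (η τ : ℂ) : Fin 5 → ℂ → ShiftSeries dir :=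
  ![W η τ 0, V η τ 0, W η τ 1, V η τ 1, W η τ 2]

end Elliptic

/-! ### The factor operators

A parameter set is `u = (u₁, u₂, v₁, v₂, w₁, w₂)`. The index `i : Fin 5` stands for the
subscript `i + 1`. -/

/-- The elementary transposition of the entries in the places `i` and `i + 1`. -/
def s (i : Fin 5) (u : Fin 6 → ℂ) : Fin 6 → ℂ := u ∘ Equiv.swap i.castSucc i.succ

/-- `r₁ = s₂s₁s₂`, interchanging `u₁` and `v₁`. -/
def r₁ (u : Fin 6 → ℂ) : Fin 6 → ℂ := s 1 (s 0 (s 1 u))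

/-- `r₃ = s₄s₃s₄`, interchanging `v₁` and `w₁`. -/
def r₃ (u : Fin 6 → ℂ) : Fin 6 → ℂ := s 3 (s 2 (s 3 u))

/-- `p₃ = s₂s₃s₂`, interchanging `u₂` and `v₂`. -/
def p₃ (u : Fin 6 → ℂ) : Fin 6 → ℂ := s 1 (s 2 (s 1 u))

/-- `p₅ = s₄s₅s₄`, interchanging `v₂` and `w₂`. -/
def p₅ (u : Fin 6 → ℂ) : Fin 6 → ℂ := s 3 (s 4 (s 3 u))

section Factors

variable {A : Type} [Mul A] (S : Fin 5 → ℂ → A)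

/-- `Sᵢ(u) = Sᵢ(uᵢ - uᵢ₊₁)`: the operator depends on the difference of the two entries of the
parameter set that it interchanges. -/
def elem (i : Fin 5) (u : Fin 6 → ℂ) : A := S i (u i.castSucc - u i.succ)

/-- `Ř⁽¹⁾₁₂(u) = S₂(s₁s₂u) S₁(s₂u) S₂(u)`. -/
def R1_12 (u : Fin 6 → ℂ) : A := elem S 1 (s 0 (s 1 u)) * elem S 0 (s 1 u) * elem S 1 u

/-- `Ř⁽¹⁾₂₃(u) = S₄(s₃s₄u) S₃(s₄u) S₄(u)`. -/
def R1_23 (u : Fin 6 → ℂ) : A := elem S 3 (s 2 (s 3 u)) * elem S 2 (s 3 u) * elem S 3 u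

/-- `Ř⁽²⁾₁₂(u) = S₂(s₃s₂u) S₃(s₂u) S₂(u)`. -/
def R2_12 (u : Fin 6 → ℂ) : A := elem S 1 (s 2 (s 1 u)) * elem S 2 (s 1 u) * elem S 1 u

/-- `Ř⁽²⁾₂₃(u) = S₄(s₅s₄u) S₅(s₄u) S₄(u)`. -/
def R2_23 (u : Fin 6 → ℂ) : A := elem S 3 (s 4 (s 3 u)) * elem S 4 (s 3 u) * elem S 3 u

/-- The four commutation relations and the two triple relations of the factor operators. -/
def FactorRelations : Prop :=
  ∀ u : Fin 6 → ℂ,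
    R2_12 S (r₁ u) * R1_12 S u = R1_12 S (p₃ u) * R2_12 S u ∧
    R2_23 S (r₃ u) * R1_23 S u = R1_23 S (p₅ u) * R2_23 S u ∧
    R2_23 S (r₁ u) * R1_12 S u = R1_12 S (p₅ u) * R2_23 S u ∧
    R2_12 S (r₃ u) * R1_23 S u = R1_23 S (p₃ u) * R2_12 S u ∧
    R1_23 S (r₁ (r₃ u)) * R1_12 S (r₃ u) * R1_23 S u =
      R1_12 S (r₃ (r₁ u)) * R1_23 S (r₁ u) * R1_12 S u ∧
    R2_23 S (p₃ (p₅ u)) * R2_12 S (p₅ u) * R2_23 S u =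
      R2_12 S (p₅ (p₃ u)) * R2_23 S (p₃ u) * R2_12 S u

end Factors

end ParamPerm

end

/-! The six identities are relations in the symmetric group on six letters. Suppose the elementary
operators satisfy `S i (-a) * S i a = 1`, commute at distance at least two, and obey the braid
relation with parameters `b, a + b, a` on one side and `a, a + b, b` on the other. Then letting the
i-th transposition act on pairs (parameter set, operator) gives an action of the Coxeter group. In
it the words `r₁, r₃` and `p₃, p₅` are transpositions of odd and of even places, generating two
commuting copies of the symmetric group on three letters. Reading the operator component at `(u, 1)`
gives the statement (`factorRelations_of_coxeter`).

Distant operators commute because the shifts of one do not move the variables on which the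
coefficients of the other depend. The inversion relation need only be checked for the one-term
operators. At parameter zero all operators are the identity, so the braid relation with `b = -a`
carries inversion over to the series (`factorRelations_of_local`).

In each case one of the two neighbours in a braid relation is a series in one direction and the
other is a single term (`V` and `W` without deformation, `W` and `V` otherwise). Comparing
coefficients turns the relation into one finite summation for every order `n` (`braid_of_ae`).
Everything is expressed through a pair `σ, G` with `G (z + 1) = σ z * G z`. For `σ x = x` with
Euler's gamma function, and for `σ x = 1 - q^(2x)` with the reciprocal of `(q^(2x); q²)`, one has `σ
(x + y) = σ x + e x * σ y`, and the summation is that of Saalschütz (`saalschutz_sum`). In the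
elliptic case `σ` is an odd theta function obeying the three-term relation, and the summation is
that of Frenkel and Turaev (`frenkelTuraev_sum`). Both follow by induction on `n` from contiguity.

The elliptic case needs two further facts: the three-term relation (`num_three_term`), and Jacobi's
triple product (`triple_product`), which locates the zeros of theta and matches it with the
functional equation of the elliptic gamma function. The summations hold away from poles. Poles occur
where a nonconstant affine function of the variables takes one of countably many values, hence on a
null set, which the coefficient germs do not see. -/

noncomputable section

namespace ParamPerm

/-! ### Summation formulas -/

section Summation

variable (σ : ℂ → ℂ)

/-- The shifted factorial `σ(c) σ(c + 1) ⋯ σ(c + k - 1)`. -/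
def rising (c : ℂ) (k : ℕ) : ℂ := ∏ r ∈ Finset.range k, σ (c + r)

/-- The factorial `σ(1) σ(2) ⋯ σ(k)`. -/
def factorialOf (k : ℕ) : ℂ := ∏ r ∈ Finset.range k, σ ((r : ℂ) + 1)

@[simp] theorem rising_zero (c : ℂ) : rising σ c 0 = 1 := by simp [rising]

@[simp] theorem factorialOf_zero : factorialOf σ 0 = 1 := by simp [factorialOf]

theorem rising_succ (c : ℂ) (k : ℕ) : rising σ c (k + 1) = rising σ c k * σ (c + k) :=
  Finset.prod_range_succ _ _

theorem factorialOf_succ (k : ℕ) :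
    factorialOf σ (k + 1) = factorialOf σ k * σ ((k : ℂ) + 1) :=
  Finset.prod_range_succ _ _

theorem rising_succ' (c : ℂ) (k : ℕ) : rising σ c (k + 1) = σ c * rising σ (c + 1) k := by
  rw [rising, Finset.prod_range_succ', mul_comm, rising]
  simp only [Nat.cast_zero, add_zero, Nat.cast_add, Nat.cast_one]
  congr 1
  exact Finset.prod_congr rfl fun i _ => by ring_nf

theorem factorialOf_ne_zero (hσ : ∀ k : ℕ, 0 < k → σ k ≠ 0) (k : ℕ) : factorialOf σ k ≠ 0 := by
  refine Finset.prod_ne_zero_iff.2 fun r _ => ?_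
  exact_mod_cast hσ (r + 1) r.succ_pos

/-- This and its mirror image drive the inductions on `n`: a summand killed at one end of the
antidiagonal reduces a sum of level `n + 1` to one of level `n`. -/
theorem sum_antidiagonal_succ_of_right_zero {f : ℕ → ℕ → ℂ} {n : ℕ} (h : f (n + 1) 0 = 0) :
    ∑ p ∈ Finset.HasAntidiagonal.antidiagonal (n + 1), f p.1 p.2 =
      ∑ p ∈ Finset.HasAntidiagonal.antidiagonal n, f p.1 (p.2 + 1) := by
  rw [Finset.Nat.sum_antidiagonal_succ' (f := fun p => f p.1 p.2)]
  simp [h]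

theorem sum_antidiagonal_succ_of_left_zero {f : ℕ → ℕ → ℂ} {n : ℕ} (h : f 0 (n + 1) = 0) :
    ∑ p ∈ Finset.HasAntidiagonal.antidiagonal (n + 1), f p.1 p.2 =
      ∑ p ∈ Finset.HasAntidiagonal.antidiagonal n, f (p.1 + 1) p.2 := by
  rw [Finset.Nat.sum_antidiagonal_succ (f := fun p => f p.1 p.2)]
  simp [h]

/-- The summand of the Frenkel-Turaev sum. -/
def turaevTerm (A B C D E : ℂ) (k l : ℕ) : ℂ :=
  (-1) ^ l * σ (A + 2 * k) * rising σ A k * rising σ (A + 2 * k + l + 1) l /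
      (factorialOf σ k * factorialOf σ l) *
    (rising σ B k * rising σ (A + 1 - B + k) l) * (rising σ C k * rising σ (A + 1 - C + k) l) *
    (rising σ D k * rising σ (A + 1 - D + k) l) * (rising σ E k * rising σ (A + 1 - E + k) l)

variable {σ}

/-- Contiguity in `l`: the extra factors are absorbed by lowering `C`, since `σ (C - 1) * rising σ C
k` and `rising σ (C - 1) k * σ (C - 1 + k)` are the same product. -/
theorem turaevTerm_succ_right (hσ : ∀ k : ℕ, 0 < k → σ k ≠ 0) (A B C D E : ℂ) (k l : ℕ) :
    turaevTerm σ A B C D E k (l + 1) *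
        (σ (C - 1) * σ ((l : ℂ) + 1) * σ (A + 2 * k + l + 1)) =
      -(σ (A + 1 - B + (k + l)) * σ (A + 1 - D + (k + l)) * σ (A + 1 - E + (k + l)) *
        σ (A + 2 * (k + l) + 1) * σ (A + 2 * (k + l) + 2)) * turaevTerm σ A B (C - 1) D E k l *
        (σ (C - 1 + k) * σ (A + 1 - C + k)) := by
  have h1 : σ (C - 1) * rising σ C k = rising σ (C - 1) k * σ (C - 1 + k) := by
    rw [← rising_succ, rising_succ', sub_add_cancel]
  have h2 : σ (A + 2 * k + l + 1) * rising σ (A + 2 * k + (l + 1 : ℕ) + 1) (l + 1) =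
      rising σ (A + 2 * k + l + 1) l * σ (A + 2 * (k + l) + 1) *
        σ (A + 2 * (k + l) + 2) := by
    rw [show (A + 2 * k + (l + 1 : ℕ) + 1 : ℂ) = A + 2 * k + l + 1 + 1 by push_cast; ring,
      ← rising_succ', rising_succ, rising_succ]
    push_cast
    ring_nf
  have h3 : rising σ (A + 1 - C + k) (l + 1) =
      σ (A + 1 - C + k) * rising σ (A + 1 - (C - 1) + k) l := by
    rw [rising_succ']
    ring_nf
  have hl : σ ((l : ℂ) + 1) ≠ 0 := by exact_mod_cast hσ (l + 1) l.succ_pos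
  have h4 : σ ((l : ℂ) + 1) / (factorialOf σ k * factorialOf σ (l + 1)) =
      1 / (factorialOf σ k * factorialOf σ l) := by
    rw [factorialOf_succ, div_eq_div_iff]
    · ring
    all_goals simp [factorialOf_ne_zero σ hσ, hl]
  simp only [turaevTerm, h3, rising_succ σ (A + 1 - B + k),
    rising_succ σ (A + 1 - D + k), rising_succ σ (A + 1 - E + k), pow_succ, add_assoc _ (k : ℂ) l]
  calc _ = (σ ((l : ℂ) + 1) / (factorialOf σ k * factorialOf σ (l + 1))) *
        (σ (A + 2 * k + l + 1) * rising σ (A + 2 * k + (l + 1 : ℕ) + 1) (l + 1)) *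
        (σ (C - 1) * rising σ C k) * (-(-1) ^ l * σ (A + 2 * k) * rising σ A k *
        (rising σ B k * (rising σ (A + 1 - B + k) l * σ (A + 1 - B + (k + l)))) *
        (σ (A + 1 - C + k) * rising σ (A + 1 - (C - 1) + k) l) *
        (rising σ D k * (rising σ (A + 1 - D + k) l * σ (A + 1 - D + (k + l)))) *
        (rising σ E k * (rising σ (A + 1 - E + k) l * σ (A + 1 - E + (k + l))))) := by ring
    _ = _ := by
      rw [h1, h2, h4]
      ring

/-- Contiguity in `k`: taking the first factor out of the shifted factorials raises `B, D, E` by one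
and `A` by two. Only `C` stays, which keeps the balancing condition at level `n`. -/
theorem turaevTerm_succ_left (hσ : ∀ k : ℕ, 0 < k → σ k ≠ 0) (A B C D E : ℂ) (k l : ℕ) :
    turaevTerm σ A B C D E (k + 1) l *
        (σ (A + 2 - C + (k + l)) * σ ((k : ℂ) + 1) * σ (A + k + 1)) =
      σ B * σ D * σ E * σ A * σ (A + 1) *
        turaevTerm σ (A + 2) (B + 1) C (D + 1) (E + 1) k l *
        (σ (C + k) * σ (A + 2 - C + k)) := by
  have h1 : rising σ A (k + 1) * σ (A + k + 1) = σ A * σ (A + 1) * rising σ (A + 2) k := by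
    rw [show σ (A + k + 1) = σ (A + (k + 1 : ℕ)) by push_cast; ring_nf, ← rising_succ,
      rising_succ', rising_succ', show A + 1 + 1 = A + 2 by ring, mul_assoc]
  have h2 : rising σ (A + 1 - C + (k + 1 : ℕ)) l * σ (A + 2 - C + (k + l)) =
      σ (A + 2 - C + k) * rising σ (A + 2 + 1 - C + k) l := by
    rw [show σ (A + 2 - C + (k + l)) = σ (A + 1 - C + (k + 1 : ℕ) + l) by push_cast; ring_nf,
      ← rising_succ, rising_succ']
    push_cast
    ring_nf
  have hk : σ ((k : ℂ) + 1) ≠ 0 := by exact_mod_cast hσ (k + 1) k.succ_pos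
  have h4 : σ ((k : ℂ) + 1) / (factorialOf σ (k + 1) * factorialOf σ l) =
      1 / (factorialOf σ k * factorialOf σ l) := by
    rw [factorialOf_succ, div_eq_div_iff]
    · ring
    all_goals simp [factorialOf_ne_zero σ hσ, hk]
  have hshift : ∀ j : ℂ, A + 1 - j + (k + 1 : ℕ) = A + 2 + 1 - (j + 1) + k := fun j => by
    push_cast; ring
  simp only [turaevTerm]
  rw [hshift B, hshift D, hshift E, rising_succ' σ B, rising_succ' σ D, rising_succ' σ E,
    rising_succ σ C,
    show A + 2 * ((k + 1 : ℕ) : ℂ) = A + 2 + 2 * k by push_cast; ring]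
  calc _ = (σ ((k : ℂ) + 1) / (factorialOf σ (k + 1) * factorialOf σ l)) *
        (rising σ A (k + 1) * σ (A + k + 1)) *
        (rising σ (A + 1 - C + (k + 1 : ℕ)) l * σ (A + 2 - C + (k + l))) *
        ((-1) ^ l * σ (A + 2 + 2 * k) * rising σ (A + 2 + 2 * k + l + 1) l *
        (σ B * rising σ (B + 1) k * rising σ (A + 2 + 1 - (B + 1) + k) l) *
        (rising σ C k * σ (C + k)) *
        (σ D * rising σ (D + 1) k * rising σ (A + 2 + 1 - (D + 1) + k) l) *
        (σ E * rising σ (E + 1) k * rising σ (A + 2 + 1 - (E + 1) + k) l)) := by ring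
    _ = _ := by
      rw [h1, h2, h4]
      ring

/-- The Frenkel-Turaev summation formula, for an odd function that satisfies the three-term
relation. -/
theorem frenkelTuraev_sum (hodd : ∀ x, σ (-x) = -σ x)
    (h3 : ∀ x y z w, σ (x + y) * σ (x - y) * (σ (z + w) * σ (z - w)) -
      σ (x + z) * σ (x - z) * (σ (y + w) * σ (y - w)) +
      σ (x + w) * σ (x - w) * (σ (y + z) * σ (y - z)) = 0)
    (hσ : ∀ k : ℕ, 0 < k → σ k ≠ 0) (n : ℕ) : ∀ A B C D E : ℂ,
    2 * A + 1 + n = B + C + D + E → (∀ i : ℤ, σ (A + i) ≠ 0) → (∀ i : ℤ, σ (C + i) ≠ 0) →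
    (∀ i : ℤ, σ (A - C + i) ≠ 0) →
    ∑ p ∈ Finset.HasAntidiagonal.antidiagonal n, turaevTerm σ A B C D E p.1 p.2 =
      rising σ A (2 * n + 1) / factorialOf σ n * rising σ (A + 1 - B - C) n *
        rising σ (A + 1 - B - D) n * rising σ (A + 1 - C - D) n := by
  induction n with
  | zero =>
    intro A B C D E _ _ _ _
    simp [turaevTerm, rising_succ]
  | succ n ih =>
    intro A B C D E hE hA hC hAC
    push_cast at hE
    have hn : σ ((n : ℂ) + 1) ≠ 0 := by exact_mod_cast hσ (n + 1) n.succ_pos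
    have hAn : σ (A + n + 1) ≠ 0 := by simpa [add_assoc] using hA (n + 1)
    -- The three-term relation splits a constant into a multiple of `σ l` and a multiple of `σ k`.
    -- Each part vanishes at one end of the antidiagonal.
    have e1 : ∀ k l : ℕ, k + l = n + 1 →
        σ (n + 1) * σ (A + n + 1) * (σ (C - 1 + k) * σ (A + 1 - C + k)) =
          σ (C - 1) * σ (A + 1 - C) * (σ l * σ (A + n + 1 + k)) +
          σ (C + n) * σ (A + 2 - C + n) * (σ k * σ (A + k)) := by
      intro k l hkl
      have hl : (l : ℂ) = n + 1 - k := by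
        rw [eq_sub_iff_add_eq']; exact_mod_cast hkl
      have := h3 (A / 2 + k) (C - 1 - A / 2) (A / 2 + n + 1) (A / 2)
      rw [hl]
      rw [show (A / 2 + k + (C - 1 - A / 2) : ℂ) = C - 1 + k by ring,
        show (A / 2 + k - (C - 1 - A / 2) : ℂ) = A + 1 - C + k by ring,
        show (A / 2 + n + 1 + A / 2 : ℂ) = A + n + 1 by ring,
        show (A / 2 + n + 1 - A / 2 : ℂ) = n + 1 by ring,
        show (A / 2 + k + (A / 2 + n + 1) : ℂ) = A + n + 1 + k by ring,
        show (A / 2 + k - (A / 2 + n + 1) : ℂ) = -(n + 1 - k) by ring,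
        show (C - 1 - A / 2 + A / 2 : ℂ) = C - 1 by ring,
        show (C - 1 - A / 2 - A / 2 : ℂ) = -(A + 1 - C) by ring,
        show (A / 2 + k + A / 2 : ℂ) = A + k by ring,
        show (A / 2 + k - A / 2 : ℂ) = k by ring,
        show (C - 1 - A / 2 + (A / 2 + n + 1) : ℂ) = C + n by ring,
        show (C - 1 - A / 2 - (A / 2 + n + 1) : ℂ) = -(A + 2 - C + n) by ring,
        hodd, hodd, hodd] at this
      linear_combination this
    -- A second instance of the three-term relation adds up the two closed forms supplied by the
    -- induction hypothesis. The balancing condition identifies one of its arguments as `E`.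
    have e2 := h3 (A + 1 + n - (B + D) / 2) (A + 1 - C - (B + D) / 2) ((B + D) / 2)
      ((B - D) / 2)
    obtain rfl : E = 2 * A + 1 + (n + 1) - B - C - D := by linear_combination -hE
    rw [show (A + 1 + n - (B + D) / 2 + (A + 1 - C - (B + D) / 2) : ℂ) =
          2 * A + 1 + (n + 1) - B - C - D by ring,
      show (A + 1 + n - (B + D) / 2 - (A + 1 - C - (B + D) / 2) : ℂ) = C + n by ring,
      show ((B + D) / 2 + (B - D) / 2 : ℂ) = B by ring,
      show ((B + D) / 2 - (B - D) / 2 : ℂ) = D by ring,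
      show (A + 1 + n - (B + D) / 2 + (B + D) / 2 : ℂ) = A + n + 1 by ring,
      show (A + 1 + n - (B + D) / 2 - (B + D) / 2 : ℂ) = A + 1 - B - D + n by ring,
      show (A + 1 - C - (B + D) / 2 + (B - D) / 2 : ℂ) = A + 1 - C - D by ring,
      show (A + 1 - C - (B + D) / 2 - (B - D) / 2 : ℂ) = A + 1 - B - C by ring,
      show (A + 1 + n - (B + D) / 2 + (B - D) / 2 : ℂ) = A + 1 - D + n by ring,
      show (A + 1 + n - (B + D) / 2 - (B - D) / 2 : ℂ) = A + 1 - B + n by ring,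
      show (A + 1 - C - (B + D) / 2 + (B + D) / 2 : ℂ) = A + 1 - C by ring,
      show (A + 1 - C - (B + D) / 2 - (B + D) / 2 : ℂ) =
          -(A + 1 - (2 * A + 1 + (n + 1) - B - C - D) + n) by ring, hodd] at e2
    set E : ℂ := 2 * A + 1 + (n + 1) - B - C - D with hEdef
    have ih1 := ih A B (C - 1) D E (by linear_combination hE) hA
      (fun i => by simpa [sub_eq_add_neg, add_assoc] using hC (-1 + i))
      (fun i => by convert hAC (1 + i) using 2; push_cast; ring)
    have ih2 := ih (A + 2) (B + 1) C (D + 1) (E + 1) (by linear_combination hE)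
      (fun i => by simpa [add_assoc] using hA (2 + i)) hC
      (fun i => by convert hAC (2 + i) using 2; push_cast; ring)
    have hC1 : ∀ k : ℕ, σ (C - 1 + k) ≠ 0 := fun k => by
      convert hC (-1 + k) using 2; push_cast; ring
    have hC0 : σ (C - 1) ≠ 0 := by simpa using hC1 0
    have hAC1 : ∀ k : ℕ, σ (A + 1 - C + k) ≠ 0 := fun k => by
      convert hAC (1 + k) using 2; push_cast; ring
    have hfac := factorialOf_ne_zero σ hσ
    have hs : ∀ k : ℕ, σ ((k : ℂ) + 1) ≠ 0 := fun k => by exact_mod_cast hσ (k + 1) k.succ_pos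
    have hAk : ∀ k : ℕ, σ (A + k) ≠ 0 := fun k => by exact_mod_cast hA k
    have key : σ (n + 1) * σ (A + n + 1) *
        ∑ p ∈ Finset.HasAntidiagonal.antidiagonal (n + 1), turaevTerm σ A B C D E p.1 p.2 =
        -(σ (A + 1 - C) * σ (A + 1 - B + n) * σ (A + 1 - D + n) * σ (A + 1 - E + n) *
            σ (A + 2 * n + 1) * σ (A + 2 * n + 2)) *
          ∑ p ∈ Finset.HasAntidiagonal.antidiagonal n, turaevTerm σ A B (C - 1) D E p.1 p.2 +
        σ (C + n) * σ B * σ D * σ E * σ A * σ (A + 1) *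
          ∑ p ∈ Finset.HasAntidiagonal.antidiagonal n,
            turaevTerm σ (A + 2) (B + 1) C (D + 1) (E + 1) p.1 p.2 := by
      have hz : σ 0 = 0 := by
        have := hodd 0
        rw [neg_zero] at this
        exact self_eq_neg.1 this
      let f : ℕ → ℕ → ℂ := fun k l => turaevTerm σ A B C D E k l /
        (σ (C - 1 + k) * σ (A + 1 - C + k)) *
          (σ (C - 1) * σ (A + 1 - C) * (σ l * σ (A + n + 1 + k)))
      let g : ℕ → ℕ → ℂ := fun k l => turaevTerm σ A B C D E k l /
        (σ (C - 1 + k) * σ (A + 1 - C + k)) *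
          (σ (C + n) * σ (A + 2 - C + n) * (σ k * σ (A + k)))
      have hsum : σ (n + 1) * σ (A + n + 1) *
          ∑ p ∈ Finset.HasAntidiagonal.antidiagonal (n + 1), turaevTerm σ A B C D E p.1 p.2 =
          ∑ p ∈ Finset.HasAntidiagonal.antidiagonal (n + 1), f p.1 p.2 +
          ∑ p ∈ Finset.HasAntidiagonal.antidiagonal (n + 1), g p.1 p.2 := by
        rw [← Finset.sum_add_distrib, Finset.mul_sum]
        refine Finset.sum_congr rfl fun p hp => ?_
        simp only [f, g]
        rw [← mul_add, ← e1 p.1 p.2 (Finset.HasAntidiagonal.mem_antidiagonal.1 hp)]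
        field_simp [hC1 p.1, hAC1 p.1]
      rw [hsum, sum_antidiagonal_succ_of_right_zero (f := f) (by simp [f, hz]),
        sum_antidiagonal_succ_of_left_zero (f := g) (by simp [g, hz]), Finset.mul_sum,
        Finset.mul_sum]
      congr 1
      · refine Finset.sum_congr rfl fun p hp => ?_
        obtain ⟨k, l⟩ := p
        obtain rfl : k + l = n := Finset.HasAntidiagonal.mem_antidiagonal.1 hp
        simp only [f]
        rw [div_mul_eq_mul_div, div_eq_iff (mul_ne_zero (hC1 k) (hAC1 k))]
        push_cast
        rw [show (A + (k + l) + 1 + k : ℂ) = A + 2 * k + l + 1 by ring]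
        linear_combination σ (A + 1 - C) * turaevTerm_succ_right hσ A B C D E k l
      · refine Finset.sum_congr rfl fun p hp => ?_
        obtain ⟨k, l⟩ := p
        obtain rfl : k + l = n := Finset.HasAntidiagonal.mem_antidiagonal.1 hp
        simp only [g]
        rw [div_mul_eq_mul_div, div_eq_iff (mul_ne_zero (hC1 _) (hAC1 _))]
        push_cast
        rw [show (C - 1 + (k + 1) : ℂ) = C + k by ring, ← add_assoc A (k : ℂ) 1,
          show (A + 1 - C + (k + 1) : ℂ) = A + 2 - C + k by ring]
        linear_combination σ (C + (k + l)) * turaevTerm_succ_left hσ A B C D E k l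
    rw [ih1, ih2] at key
    refine mul_left_cancel₀ (mul_ne_zero hn hAn) (key.trans ?_)
    have hr : ∀ x y : ℂ, y = x + n → rising σ x (n + 1) = rising σ x n * σ y := by
      rintro x y rfl
      exact rising_succ σ x n
    have hr' : ∀ x y : ℂ, y = x + 1 → rising σ x (n + 1) = σ x * rising σ y n := by
      rintro x y rfl
      exact rising_succ' σ x n
    rw [hr' (A + 1 - B - C) (A + 1 - B - (C - 1)) (by ring), hr (A + 1 - B - D) _ rfl,
      hr' (A + 1 - C - D) (A + 1 - (C - 1) - D) (by ring),
      show A + 2 + 1 - (B + 1) - C = A + 1 - B - (C - 1) by ring,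
      show A + 2 + 1 - (B + 1) - (D + 1) = A + 1 - B - D by ring,
      show A + 2 + 1 - C - (D + 1) = A + 1 - (C - 1) - D by ring]
    have r1 : rising σ A (2 * (n + 1) + 1) = rising σ A (2 * n + 1) * σ (A + 2 * n + 1) *
        σ (A + 2 * n + 2) := by
      rw [show 2 * (n + 1) + 1 = 2 * n + 1 + 1 + 1 by ring, rising_succ, rising_succ]
      push_cast
      ring_nf
    have r2 : σ A * σ (A + 1) * rising σ (A + 2) (2 * n + 1) =
        rising σ A (2 * n + 1) * σ (A + 2 * n + 1) * σ (A + 2 * n + 2) := by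
      rw [← r1, show 2 * (n + 1) + 1 = 2 * n + 1 + 1 + 1 by ring, rising_succ' σ A, rising_succ' σ (A + 1),
        show A + 1 + 1 = A + 2 by ring, mul_assoc]
    have hf : σ (n + 1) * (rising σ A (2 * (n + 1) + 1) / factorialOf σ (n + 1)) =
        rising σ A (2 * n + 1) / factorialOf σ n * σ (A + 2 * n + 1) * σ (A + 2 * n + 2) := by
      rw [r1, factorialOf_succ, mul_div_assoc', div_mul_eq_mul_div, div_mul_eq_mul_div,
        div_eq_div_iff (mul_ne_zero (hfac n) hn) (hfac n)]
      ring
    have hf2 : σ A * σ (A + 1) * (rising σ (A + 2) (2 * n + 1) / factorialOf σ n) =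
        rising σ A (2 * n + 1) / factorialOf σ n * σ (A + 2 * n + 1) * σ (A + 2 * n + 2) := by
      rw [mul_div_assoc', r2]
      ring
    generalize rising σ A (2 * n + 1) / factorialOf σ n = X at *
    linear_combination (rising σ (A + 1 - B - (C - 1)) n * rising σ (A + 1 - B - D) n *
      rising σ (A + 1 - (C - 1) - D) n) * (σ (C + n) * σ B * σ D * σ E * hf2 -
        σ (A + n + 1) * σ (A + 1 - B - C) * σ (A + 1 - B - D + n) * σ (A + 1 - C - D) * hf +
        X * σ (A + 2 * n + 1) * σ (A + 2 * n + 2) * e2)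

/-- The Saalschütz summation formula for a function `σ` with `σ (x + y) = σ x + e x * σ y`. -/
theorem saalschutz_sum {e : ℂ → ℂ} (he0 : e 0 = 1)
    (he : ∀ x y, e (x + y) = e x * e y) (hadd : ∀ x y, σ (x + y) = σ x + e x * σ y) (hσ : ∀ k : ℕ, 0 < k → σ k ≠ 0)
    (n : ℕ) : ∀ a b c d : ℂ, d = c - a - b →
    ∑ p ∈ Finset.HasAntidiagonal.antidiagonal n,
        rising σ a p.1 * rising σ b p.1 * rising σ (c + p.1) p.2 * rising σ d p.2 * e d ^ p.1 /
          (factorialOf σ p.1 * factorialOf σ p.2) =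
      rising σ (c - a) n * rising σ (c - b) n / factorialOf σ n := by
  -- This degenerate three-term relation is used twice: to split the summand, and to add up the two
  -- closed forms.
  have hquad : ∀ u a b, σ (u + b) * σ (u + a) = σ (u + a + b) * σ u + e u * (σ a * σ b) := by
    intro u a b
    have h := hadd u a
    rw [add_comm u a, hadd a u] at h
    rw [hadd (u + a) b, he, hadd u b, hadd u a]
    linear_combination (-e u * σ b) * h
  have hfac := factorialOf_ne_zero σ hσ
  have hs : ∀ k : ℕ, σ ((k : ℂ) + 1) ≠ 0 := fun k => by exact_mod_cast hσ (k + 1) k.succ_pos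
  have hfs : ∀ k : ℕ, σ ((k : ℂ) + 1) / factorialOf σ (k + 1) = 1 / factorialOf σ k := by
    intro k
    rw [factorialOf_succ, div_eq_div_iff (mul_ne_zero (hfac k) (hs k)) (hfac k)]
    ring
  have hepow : ∀ k : ℕ, e (k : ℂ) = e 1 ^ k := by
    intro k
    induction k with
    | zero => simp [he0]
    | succ k ih => rw [Nat.cast_succ, he, ih, pow_succ]
  induction n with
  | zero =>
    rintro a b c d -
    simp
  | succ n ih =>
    intro a b c d hd
    let t : ℂ → ℂ → ℂ → ℂ → ℕ → ℕ → ℂ := fun a b c d k l =>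
      rising σ a k * rising σ b k * rising σ (c + k) l * rising σ d l * e d ^ k /
          (factorialOf σ k * factorialOf σ l)
    -- The value 0 at `l = 0` in `f`, and at `k = 0` in `g`, makes the boundary terms vanish by
    -- definition when the sums are reindexed.
    let f : ℕ → ℕ → ℂ := fun k l =>
      Nat.casesOn l 0 fun l => σ (c + n) * σ (d + n) * t a b c d k l
    let g : ℕ → ℕ → ℂ := fun k l =>
      Nat.casesOn k 0 fun k => e (d + n) * σ a * σ b * t (a + 1) (b + 1) (c + 1) (d - 1) k l
    have hsplit : ∀ k l : ℕ, k + l = n + 1 → σ ((n : ℂ) + 1) * t a b c d k l = f k l + g k l := by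
      have hg : ∀ k l : ℕ, k + l = n → σ ((k : ℂ) + 1) * (e l * rising σ (d - 1) l *
          (rising σ a (k + 1) * rising σ b (k + 1) * rising σ (c + (k + 1 : ℕ)) l *
            e d ^ (k + 1)) / (factorialOf σ (k + 1) * factorialOf σ l)) = g (k + 1) l := by
        rintro k l rfl
        have h1 : e l * e d ^ (k + 1) = e (d + (k + l : ℕ)) * e (d - 1) ^ k := by
          rw [← sub_add_cancel d 1, he (d - 1) 1, add_sub_cancel_right, he (d - 1 + 1), he (d - 1) 1,
            Nat.cast_add, he k l, hepow k, hepow l]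
          ring
        simp only [g, t]
        rw [show c + (k + 1 : ℕ) = c + 1 + k by push_cast; ring, rising_succ' σ a,
          rising_succ' σ b]
        calc _ = (σ ((k : ℂ) + 1) / factorialOf σ (k + 1)) * (e l * e d ^ (k + 1)) *
              (rising σ (d - 1) l * (σ a * rising σ (a + 1) k * (σ b * rising σ (b + 1) k) *
              rising σ (c + 1 + k) l) / factorialOf σ l) := by ring
          _ = _ := by rw [hfs, h1]; ring
      have hf : ∀ k l : ℕ, k + l = n → σ ((l : ℂ) + 1) * (rising σ d l * σ (d + n) *
          (rising σ a k * rising σ b k * rising σ (c + k) (l + 1) * e d ^ k) /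
            (factorialOf σ k * factorialOf σ (l + 1))) = f k (l + 1) := by
        rintro k l rfl
        simp only [f, t]
        rw [rising_succ σ (c + k), show c + k + l = c + (k + l : ℕ) by push_cast; ring]
        calc _ = (σ ((l : ℂ) + 1) / factorialOf σ (l + 1)) * (rising σ d l *
              σ (d + (k + l : ℕ)) * (rising σ a k * rising σ b k *
                (rising σ (c + k) l * σ (c + (k + l : ℕ))) * e d ^ k) / factorialOf σ k) := by
              ring
          _ = _ := by rw [hfs]; ring
      intro k l hkl
      rcases k with _ | k
      · obtain rfl : l = n + 1 := by omega
        rw [← hf 0 n (by omega), show g 0 (n + 1) = 0 from rfl, add_zero]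
        simp only [t, rising_succ σ d]
        ring
      · have hkl' : k + l = n := by omega
        rw [← hg k l hkl']
        rcases l with _ | l
        · obtain rfl : k = n := by omega
          rw [show f (k + 1) 0 = 0 from rfl, zero_add]
          simp only [t, rising_zero, Nat.cast_zero, he0]
          ring
        · rw [← hf (k + 1) l (by omega)]
          -- Only the factors containing `d` see the split. The remaining factors are common to the
          -- original term and to both contiguous ones.
          have h2 : σ ((n : ℂ) + 1) * rising σ d (l + 1) =
              σ ((l : ℂ) + 1) * rising σ d l * σ (d + n) +
                e (l + 1 : ℕ) * σ ((k : ℂ) + 1) * rising σ (d - 1) (l + 1) := by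
            rw [rising_succ, rising_succ' σ (d - 1), sub_add_cancel]
            have := hquad (l + 1) (k + 1) (d - 1)
            rw [← hkl']
            push_cast
            rw [show (k + (l + 1) + 1 : ℂ) = l + 1 + (k + 1) by ring,
              show (d + l : ℂ) = l + 1 + (d - 1) by ring,
              show (d + (k + (l + 1)) : ℂ) = l + 1 + (k + 1) + (d - 1) by ring]
            linear_combination rising σ d l * this
          simp only [t]
          calc _ = (σ ((n : ℂ) + 1) * rising σ d (l + 1)) * (rising σ a (k + 1) *
                rising σ b (k + 1) * rising σ (c + (k + 1 : ℕ)) (l + 1) * e d ^ (k + 1) /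
                (factorialOf σ (k + 1) * factorialOf σ (l + 1))) := by ring
            _ = _ := by rw [h2]; ring
    refine mul_left_cancel₀ (hs n) ?_
    rw [Finset.mul_sum, Finset.sum_congr rfl fun p hp =>
        hsplit p.1 p.2 (Finset.HasAntidiagonal.mem_antidiagonal.1 hp), Finset.sum_add_distrib,
      sum_antidiagonal_succ_of_right_zero (f := f) rfl,
      sum_antidiagonal_succ_of_left_zero (f := g) rfl]
    simp only [f, g]
    rw [← Finset.mul_sum, ← Finset.mul_sum, ih a b c d hd,
      ih (a + 1) (b + 1) (c + 1) (d - 1) (by rw [hd]; ring)]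
    rw [show c + 1 - (a + 1) = c - a by ring, show c + 1 - (b + 1) = c - b by ring]
    have h3 := hquad (d + n) a b
    rw [show d + n + a + b = c + n by rw [hd]; ring, show d + n + b = c - a + n by rw [hd]; ring,
      show d + n + a = c - b + n by rw [hd]; ring] at h3
    calc _ = rising σ (c - a) n * rising σ (c - b) n / factorialOf σ n *
          (σ (c + n) * σ (d + n) + e (d + n) * (σ a * σ b)) := by ring
      _ = (σ ((n : ℂ) + 1) / factorialOf σ (n + 1)) * (rising σ (c - a) n * rising σ (c - b) n *
          (σ (c - a + n) * σ (c - b + n))) := by rw [← h3, hfs]; ring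
      _ = _ := by rw [rising_succ, rising_succ]; ring

end Summation

/-! ### The monoid of series of shift operators -/

namespace Coef

@[simp] theorem shift_coe (w : X) (f : X → ℂ) :
    Coef.shift w (f : Coef) = ((fun x => f (x + w) : X → ℂ) : Coef) := rfl

@[simp] theorem shift_add (w : X) (f g : Coef) :
    Coef.shift w (f + g) = Coef.shift w f + Coef.shift w g := by
  induction f using Filter.Germ.inductionOn
  induction g using Filter.Germ.inductionOn
  rfl

@[simp] theorem shift_mul (w : X) (f g : Coef) :
    Coef.shift w (f * g) = Coef.shift w f * Coef.shift w g := by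
  induction f using Filter.Germ.inductionOn
  induction g using Filter.Germ.inductionOn
  rfl

@[simp] theorem shift_zero (w : X) : Coef.shift w 0 = 0 := rfl

@[simp] theorem shift_one (w : X) : Coef.shift w 1 = 1 := rfl

theorem zero_shift (f : Coef) : Coef.shift 0 f = f := by
  induction f using Filter.Germ.inductionOn
  simp

theorem shift_shift (v w : X) (f : Coef) :
    Coef.shift v (Coef.shift w f) = Coef.shift (v + w) f := by
  induction f using Filter.Germ.inductionOn
  simp [add_assoc]

/-- Translation as a ring homomorphism. -/
def shiftHom (w : X) : Coef →+* Coef where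
  toFun := Coef.shift w
  map_one' := shift_one w
  map_mul' := shift_mul w
  map_zero' := shift_zero w
  map_add' := shift_add w

theorem shift_sum {ι : Type} (w : X) (t : Finset ι) (f : ι → Coef) :
    Coef.shift w (∑ i ∈ t, f i) = ∑ i ∈ t, Coef.shift w (f i) :=
  map_sum (shiftHom w) f t

end Coef

namespace ShiftSeries

variable {σ : Type} {M : σ → X}

theorem exponent_zero (A : ShiftSeries M) : A.exponent 0 = A.lead := by
  simp [exponent]

theorem exponent_single (A : ShiftSeries M) (j : σ) (k : ℕ) :
    A.exponent (Finsupp.single j k) = A.lead + (k : ℂ) • M j := by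
  simp [exponent]

variable [DecidableEq σ]

theorem mul_lead (A B : ShiftSeries M) : (A * B).lead = A.lead + B.lead := rfl

theorem mul_coeff (A B : ShiftSeries M) (n : σ →₀ ℕ) :
    (A * B).coeff n = ∑ p ∈ Finset.HasAntidiagonal.antidiagonal n,
      A.coeff p.1 * (B.coeff p.2).shift (A.exponent p.1) := rfl

/-- Exponents are additive in the multi-index, so iterated translations of coefficients compose.
This is the point on which associativity rests. -/
theorem mul_exponent (A B : ShiftSeries M) (n m : σ →₀ ℕ) :
    (A * B).exponent (n + m) = A.exponent n + B.exponent m := by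
  simp only [exponent, mul_lead]
  rw [Finsupp.sum_add_index' (by simp) (by intros; simp [add_smul])]
  abel

theorem mul_assoc' (A B C : ShiftSeries M) : A * B * C = A * (B * C) := by
  ext1
  · simp only [mul_lead, add_assoc]
  · ext1 n
    simp only [mul_coeff, Coef.shift_sum, Finset.sum_mul, Finset.mul_sum, Coef.shift_mul,
      Coef.shift_shift]
    rw [Finset.sum_sigma', Finset.sum_sigma']
    refine Finset.sum_nbij' (fun ⟨⟨_, j⟩, ⟨k, l⟩⟩ => ⟨(k, l + j), (l, j)⟩)
      (fun ⟨⟨i, _⟩, ⟨k, l⟩⟩ => ⟨(i + k, l), (i, k)⟩) ?_ ?_ ?_ ?_ ?_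
    · rintro ⟨⟨i, j⟩, ⟨k, l⟩⟩ h
      simp only [Finset.mem_sigma, Finset.HasAntidiagonal.mem_antidiagonal] at h ⊢
      obtain ⟨rfl, rfl⟩ := h
      simp [add_assoc]
    · rintro ⟨⟨i, j⟩, ⟨k, l⟩⟩ h
      simp only [Finset.mem_sigma, Finset.HasAntidiagonal.mem_antidiagonal] at h ⊢
      obtain ⟨rfl, rfl⟩ := h
      simp [add_assoc]
    · rintro ⟨⟨i, j⟩, ⟨k, l⟩⟩ h
      simp only [Finset.mem_sigma, Finset.HasAntidiagonal.mem_antidiagonal] at h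
      obtain ⟨rfl, rfl⟩ := h
      rfl
    · rintro ⟨⟨i, j⟩, ⟨k, l⟩⟩ h
      simp only [Finset.mem_sigma, Finset.HasAntidiagonal.mem_antidiagonal] at h
      obtain ⟨rfl, rfl⟩ := h
      rfl
    · rintro ⟨⟨i, j⟩, ⟨k, l⟩⟩ h
      simp only [Finset.mem_sigma, Finset.HasAntidiagonal.mem_antidiagonal] at h
      obtain ⟨rfl, rfl⟩ := h
      simp only [mul_exponent, mul_assoc]

/-- The operator `f T^v`. -/
def mono (v : X) (f : Coef) : ShiftSeries M where
  lead := v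
  coeff n := if n = 0 then f else 0

/-- The series `∑ₖ cₖ T^(v + k Mⱼ)` in one direction `j`. -/
def powerSeries (v : X) (j : σ) (c : ℕ → Coef) : ShiftSeries M where
  lead := v
  coeff n := if n = Finsupp.single j (n j) then c (n j) else 0

theorem power_eq (v : X) (j : σ) (c : ℕ → X → ℂ) :
    (power v j c : ShiftSeries M) = powerSeries v j fun k => (c k : Coef) := rfl

theorem ofFun_eq (f : X → ℂ) : (ofFun f : ShiftSeries M) = mono 0 (f : Coef) := rfl

theorem translation_eq (v : X) : (translation v : ShiftSeries M) = mono v 1 := rfl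

theorem mono_mul_coeff (v : X) (f : Coef) (A : ShiftSeries M) (n : σ →₀ ℕ) :
    (mono v f * A).coeff n = f * (A.coeff n).shift v := by
  rw [mul_coeff, Finset.sum_eq_single (0, n)]
  · rw [exponent_zero]
    simp [mono]
  · rintro ⟨p, q⟩ h hne
    rw [Finset.HasAntidiagonal.mem_antidiagonal] at h
    have : p ≠ 0 := by
      rintro rfl
      simp_all
    simp [mono, this]
  · intro h
    simp at h

theorem mul_mono_coeff (v : X) (f : Coef) (A : ShiftSeries M) (n : σ →₀ ℕ) :
    (A * mono v f).coeff n = A.coeff n * f.shift (A.exponent n) := by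
  rw [mul_coeff, Finset.sum_eq_single (n, 0)]
  · simp [mono]
  · rintro ⟨p, q⟩ h hne
    rw [Finset.HasAntidiagonal.mem_antidiagonal] at h
    have : q ≠ 0 := by
      rintro rfl
      simp_all
    simp [mono, this]
  · intro h
    simp at h

instance : Monoid (ShiftSeries M) where
  one := mono 0 1
  mul_assoc := mul_assoc'
  one_mul A := by
    ext1
    · exact zero_add _
    · ext1 n
      exact (mono_mul_coeff 0 1 A n).trans (by rw [one_mul, Coef.zero_shift])
  mul_one A := by
    ext1
    · exact add_zero _
    · ext1 n
      exact (mul_mono_coeff 0 1 A n).trans (by simp)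

theorem one_eq : (1 : ShiftSeries M) = mono 0 1 := rfl

theorem mono_mul_mono (v w : X) (f g : Coef) :
    (mono v f * mono w g : ShiftSeries M) = mono (v + w) (f * g.shift v) := by
  ext1
  · rfl
  · ext1 n
    rw [mono_mul_coeff]
    by_cases h : n = 0 <;> simp [mono, h]

theorem mono_mul_powerSeries (v w : X) (f : Coef) (j : σ) (c : ℕ → Coef) :
    (mono v f * powerSeries w j c : ShiftSeries M) =
      powerSeries (v + w) j fun k => f * (c k).shift v := by
  ext1
  · rfl
  · ext1 n
    rw [mono_mul_coeff]
    by_cases h : n = Finsupp.single j (n j)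
    · simp only [powerSeries, if_pos h]
    · simp only [powerSeries, if_neg h, Coef.shift_zero, mul_zero]

theorem powerSeries_mul_mono (v w : X) (f : Coef) (j : σ) (c : ℕ → Coef) :
    (powerSeries v j c * mono w f : ShiftSeries M) =
      powerSeries (v + w) j fun k => c k * f.shift (v + (k : ℂ) • M j) := by
  ext1
  · rfl
  · ext1 n
    rw [mul_mono_coeff]
    by_cases h : n = Finsupp.single j (n j)
    · simp only [powerSeries, if_pos h]
      nth_rw 2 [h]
      rw [exponent_single]
    · simp only [powerSeries, if_neg h, zero_mul]

theorem powerSeries_mul_powerSeries (v w : X) (j : σ) (c d : ℕ → Coef) :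
    (powerSeries v j c * powerSeries w j d : ShiftSeries M) =
      powerSeries (v + w) j fun n => ∑ p ∈ Finset.HasAntidiagonal.antidiagonal n,
        c p.1 * (d p.2).shift (v + (p.1 : ℂ) • M j) := by
  ext1
  · rfl
  · ext1 n
    rw [mul_coeff]
    by_cases h : n = Finsupp.single j (n j)
    · generalize n j = m at h
      subst h
      rw [Finsupp.antidiagonal_single, Finset.sum_map]
      simp [powerSeries, exponent_single]
    · simp only [powerSeries, if_neg h]
      refine Finset.sum_eq_zero ?_
      rintro ⟨p, q⟩ hpq
      rw [Finset.HasAntidiagonal.mem_antidiagonal] at hpq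
      subst hpq
      by_cases hp : p = Finsupp.single j (p j)
      · by_cases hq : q = Finsupp.single j (q j)
        · refine absurd ?_ h
          rw [Finsupp.add_apply, Finsupp.single_add, ← hp, ← hq]
        · simp [if_neg hq]
      · simp [if_neg hp]

/-- The braid relation between series in one direction and one-term operators, reduced to
identities between coefficient functions. -/
theorem braid_of_ae {j : σ} {P Q : ℂ → ShiftSeries M} {v w : ℂ → X} {c : ℂ → ℕ → X → ℂ}
    {f : ℂ → X → ℂ} (hP : ∀ a, P a = powerSeries (v a) j fun k => (c a k : Coef))
    (hQ : ∀ a, Q a = mono (w a) (f a : Coef)) (hv : ∀ a b, v (a + b) = v a + v b)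
    (hw : ∀ a b, w (a + b) = w a + w b) (a b : ℂ)
    (h : ∀ n : ℕ, ∀ᵐ x : X, ∑ p ∈ Finset.HasAntidiagonal.antidiagonal n,
      c b p.1 x * f (a + b) (x + (v b + (p.1 : ℂ) • M j)) *
        c a p.2 (x + (v b + w (a + b) + (p.1 : ℂ) • M j)) =
      f a x * c (a + b) n (x + w a) * f b (x + (w a + v (a + b) + (n : ℂ) • M j))) :
    P b * Q (a + b) * P a = Q a * P (a + b) * Q b := by
  rw [hP, hP, hP, hQ, hQ, hQ, powerSeries_mul_mono, powerSeries_mul_powerSeries,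
    mono_mul_powerSeries, powerSeries_mul_mono]
  congr 1
  · rw [hv, hw]
    abel
  · ext1 n
    have hsum : ∀ (t : Finset (ℕ × ℕ)) (F : ℕ × ℕ → X → ℂ),
        ∑ p ∈ t, (F p : Coef) = ((fun x => ∑ p ∈ t, F p x : X → ℂ) : Coef) := by
      intro t F
      rw [← Finset.sum_fn]
      exact (map_sum (Filter.Germ.coeRingHom (ae (volume : Measure X))) F t).symm
    have h1 := hsum (Finset.HasAntidiagonal.antidiagonal n) fun p x =>
      c b p.1 x * f (a + b) (x + (v b + (p.1 : ℂ) • M j)) *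
        c a p.2 (x + (v b + w (a + b) + (p.1 : ℂ) • M j))
    exact h1.trans (Filter.Germ.coe_eq.2 (h n))

/-- Two series commute when the coefficients of each are invariant under the shifts that occur in
the other. -/
theorem commute_of_invariant {A B : ShiftSeries M}
    (hA : ∀ n m, A.coeff n ≠ 0 → (B.coeff m).shift (A.exponent n) = B.coeff m)
    (hB : ∀ n m, B.coeff n ≠ 0 → (A.coeff m).shift (B.exponent n) = A.coeff m) :
    A * B = B * A := by
  ext1
  · exact add_comm _ _
  · ext1 n
    rw [mul_coeff, mul_coeff, Finsupp.sum_antidiagonal_swap n fun p q =>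
      B.coeff p * (A.coeff q).shift (B.exponent p)]
    refine Finset.sum_congr rfl fun p _ => ?_
    by_cases h1 : A.coeff p.1 = 0
    · simp [h1]
    by_cases h2 : B.coeff p.2 = 0
    · simp [h2]
    rw [hA _ _ h1, hB _ _ h2, mul_comm]

end ShiftSeries

/-! ### The factor operators in a monoid -/

theorem s_s_self (i : Fin 5) (u : Fin 6 → ℂ) : s i (s i u) = u := by
  funext k
  simp [s]

section CoxeterRelations

variable {A : Type} (S : Fin 5 → ℂ → A)

theorem elem_s_self (i : Fin 5) (u : Fin 6 → ℂ) :
    elem S i (s i u) = S i (-(u i.castSucc - u i.succ)) := by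
  simp [elem, s]

variable [Monoid A]

/-- The action of the elementary transposition `i` on pairs of a parameter set and an operator. -/
def act (i : Fin 5) (p : (Fin 6 → ℂ) × A) : (Fin 6 → ℂ) × A :=
  (s i p.1, elem S i p.1 * p.2)

variable {S}

theorem act_act_self (hinv : ∀ i a, S i (-a) * S i a = 1) (i : Fin 5) (p : (Fin 6 → ℂ) × A) :
    act S i (act S i p) = p := by
  refine Prod.ext (s_s_self i p.1) ?_
  change elem S i (s i p.1) * (elem S i p.1 * p.2) = p.2
  rw [elem_s_self, elem, ← mul_assoc, hinv, one_mul]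

/-- A transposition at distance at least two leaves alone both entries whose difference the other
operator uses. -/
theorem act_comm (hcomm : ∀ i j : Fin 5, (i : ℕ) + 2 ≤ j → ∀ a b, S i a * S j b = S j b * S i a)
    (i j : Fin 5) (hij : (i : ℕ) + 2 ≤ j) (p : (Fin 6 → ℂ) × A) :
    act S i (act S j p) = act S j (act S i p) := by
  have hs : ∀ i j : Fin 5, (i : ℕ) + 2 ≤ j → ∀ k : Fin 6,
      Equiv.swap j.castSucc j.succ (Equiv.swap i.castSucc i.succ k) =
        Equiv.swap i.castSucc i.succ (Equiv.swap j.castSucc j.succ k) := by decide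
  have hf : ∀ i j : Fin 5, (i : ℕ) + 2 ≤ j →
      Equiv.swap i.castSucc i.succ j.castSucc = j.castSucc ∧
      Equiv.swap i.castSucc i.succ j.succ = j.succ ∧
      Equiv.swap j.castSucc j.succ i.castSucc = i.castSucc ∧
      Equiv.swap j.castSucc j.succ i.succ = i.succ := by decide
  obtain ⟨h1, h2, h3, h4⟩ := hf i j hij
  refine Prod.ext (funext fun k => congrArg p.1 (hs i j hij k)) ?_
  change elem S i (s j p.1) * (elem S j p.1 * p.2) = elem S j (s i p.1) * (elem S i p.1 * p.2)
  simp only [elem, s, Function.comp_apply, h1, h2, h3, h4]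
  rw [← mul_assoc, hcomm i j hij, mul_assoc]

/-- With `a` and `b` the two consecutive differences of three neighbouring entries, one word meets
the differences `a, a + b, b` in turn and the other meets `b, a + b, a`. -/
theorem act_braid (hbraid : ∀ (i : Fin 4) a b,
      S i.castSucc b * S i.succ (a + b) * S i.castSucc a =
        S i.succ a * S i.castSucc (a + b) * S i.succ b) (i : Fin 4)
    (p : (Fin 6 → ℂ) × A) :
    act S i.castSucc (act S i.succ (act S i.castSucc p)) =
      act S i.succ (act S i.castSucc (act S i.succ p)) := by
  have hs : ∀ (i : Fin 4) (k : Fin 6),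
      Equiv.swap i.castSucc.castSucc i.castSucc.succ (Equiv.swap i.succ.castSucc i.succ.succ
        (Equiv.swap i.castSucc.castSucc i.castSucc.succ k)) =
      Equiv.swap i.succ.castSucc i.succ.succ (Equiv.swap i.castSucc.castSucc i.castSucc.succ
        (Equiv.swap i.succ.castSucc i.succ.succ k)) := by decide
  have hf : ∀ i : Fin 4,
      Equiv.swap i.castSucc.castSucc i.castSucc.succ i.succ.castSucc = i.castSucc.castSucc ∧
      Equiv.swap i.castSucc.castSucc i.castSucc.succ i.succ.succ = i.succ.succ ∧
      Equiv.swap i.castSucc.castSucc i.castSucc.succ i.castSucc.castSucc = i.succ.castSucc ∧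
      Equiv.swap i.succ.castSucc i.succ.succ i.castSucc.castSucc = i.castSucc.castSucc ∧
      Equiv.swap i.succ.castSucc i.succ.succ i.castSucc.succ = i.succ.succ ∧
      Equiv.swap i.succ.castSucc i.succ.succ i.succ.succ = i.succ.castSucc := by decide
  have he : ∀ i : Fin 4, i.castSucc.succ = i.succ.castSucc := by decide
  obtain ⟨h1, h2, h3, h5, h6, h8⟩ := hf i
  refine Prod.ext (funext fun k => congrArg p.1 (hs i k)) ?_
  change elem S i.castSucc (s i.succ (s i.castSucc p.1)) *
      (elem S i.succ (s i.castSucc p.1) * (elem S i.castSucc p.1 * p.2)) =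
    elem S i.succ (s i.castSucc (s i.succ p.1)) *
      (elem S i.castSucc (s i.succ p.1) * (elem S i.succ p.1 * p.2))
  simp only [elem, s, Function.comp_apply, h1, h2, h3, h5, h6, h8]
  rw [he]
  simp only [← mul_assoc]
  congr 1
  have := hbraid i (p.1 i.castSucc.castSucc - p.1 i.succ.castSucc)
    (p.1 i.succ.castSucc - p.1 i.succ.succ)
  rwa [sub_add_sub_cancel] at this

/-- The relations of the factor operators follow from the Coxeter relations of the elementary
operators. -/
theorem factorRelations_of_coxeter (hinv : ∀ i a, S i (-a) * S i a = 1)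
    (hcomm : ∀ i j : Fin 5, (i : ℕ) + 2 ≤ j → ∀ a b, S i a * S j b = S j b * S i a)
    (hbraid : ∀ (i : Fin 4) a b,
      S i.castSucc b * S i.succ (a + b) * S i.castSucc a =
        S i.succ a * S i.castSucc (a + b) * S i.succ b) : FactorRelations S := by
  have q1 := act_act_self hinv 1
  have q2 := act_act_self hinv 2
  have q3 := act_act_self hinv 3
  have c02 := act_comm hcomm 0 2 (by decide)
  have c03 := act_comm hcomm 0 3 (by decide)
  have c04 := act_comm hcomm 0 4 (by decide)
  have c13 := act_comm hcomm 1 3 (by decide)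
  have c14 := act_comm hcomm 1 4 (by decide)
  have c24 := act_comm hcomm 2 4 (by decide)
  have b01 : ∀ p, act S 0 (act S 1 (act S 0 p)) =
      act S 1 (act S 0 (act S 1 p)) := act_braid hbraid 0
  have b12 : ∀ p, act S 1 (act S 2 (act S 1 p)) =
      act S 2 (act S 1 (act S 2 p)) := act_braid hbraid 1
  have b23 : ∀ p, act S 2 (act S 3 (act S 2 p)) =
      act S 3 (act S 2 (act S 3 p)) := act_braid hbraid 2
  have b34 : ∀ p, act S 3 (act S 4 (act S 3 p)) =
      act S 4 (act S 3 (act S 4 p)) := act_braid hbraid 3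
  set x0 := act S 0 with hx0
  set x1 := act S 1 with hx1
  set x2 := act S 2 with hx2
  set x3 := act S 3 with hx3
  set x4 := act S 4 with hx4
  -- The six relations are those of the transpositions of places (1 3), (3 5), (2 4), (4 6): odd
  -- ones commute with even ones, and the two in each pair satisfy the braid relation. They are
  -- derived by Coxeter moves alone, so they hold for the action on operators as well.
  have e1 : ∀ p, x1 (x2 (x1 (x1 (x0 (x1 p))))) =
      x1 (x0 (x1 (x1 (x2 (x1 p))))) := by
    intro p
    rw [q1, q1, c02]
  have e2 : ∀ p, x3 (x4 (x3 (x3 (x2 (x3 p))))) =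
      x3 (x2 (x3 (x3 (x4 (x3 p))))) := by
    intro p
    rw [q3, q3, c24]
  have e3 : ∀ p, x3 (x4 (x3 (x1 (x0 (x1 p))))) =
      x1 (x0 (x1 (x3 (x4 (x3 p))))) := by
    intro p
    simp only [c13, c03, c14, c04]
  have e4 : ∀ p, x1 (x2 (x1 (x3 (x2 (x3 p))))) =
      x3 (x2 (x3 (x1 (x2 (x1 p))))) := by
    intro p
    rw [b12, ← b23, q2, b12, ← b23, q2, c13]
  have e5 : ∀ p, x3 (x2 (x3 (x1 (x0 (x1 (x3 (x2 (x3 p)))))))) =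
      x1 (x0 (x1 (x3 (x2 (x3 (x1 (x0 (x1 p)))))))) := by
    intro p
    symm
    calc
      x1 (x0 (x1 (x3 (x2 (x3 (x1 (x0 (x1 p)))))))) = x3 (x1 (x0 (x1 (x2 (x1 (x0 (x1 (x3 p)))))))) := by simp only [c13, c03]
      _ = x3 (x1 (x0 (x2 (x1 (x2 (x0 (x1 (x3 p)))))))) := by rw [b12]
      _ = x3 (x1 (x2 (x0 (x1 (x0 (x2 (x1 (x3 p)))))))) := by simp only [c02]
      _ = x3 (x1 (x2 (x1 (x0 (x1 (x2 (x1 (x3 p)))))))) := by rw [b01]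
      _ = x3 (x2 (x1 (x2 (x0 (x2 (x1 (x2 (x3 p)))))))) := by rw [b12, b12]
      _ = x3 (x2 (x1 (x0 (x1 (x2 (x3 p)))))) := by simp only [c02, q2]
      _ = x3 (x2 (x3 (x1 (x0 (x1 (x3 (x2 (x3 p)))))))) := by simp only [c13, c03, q3]
  have e6 : ∀ p, x3 (x4 (x3 (x1 (x2 (x1 (x3 (x4 (x3 p)))))))) =
      x1 (x2 (x1 (x3 (x4 (x3 (x1 (x2 (x1 p)))))))) := by
    intro p
    calc
      x3 (x4 (x3 (x1 (x2 (x1 (x3 (x4 (x3 p)))))))) = x1 (x3 (x4 (x3 (x2 (x3 (x4 (x3 (x1 p)))))))) := by simp only [c13, c14]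
      _ = x1 (x3 (x4 (x2 (x3 (x2 (x4 (x3 (x1 p)))))))) := by rw [← b23]
      _ = x1 (x3 (x2 (x4 (x3 (x4 (x2 (x3 (x1 p)))))))) := by simp only [c24]
      _ = x1 (x3 (x2 (x3 (x4 (x3 (x2 (x3 (x1 p)))))))) := by rw [← b34]
      _ = x1 (x2 (x3 (x2 (x4 (x2 (x3 (x2 (x1 p)))))))) := by rw [← b23, ← b23]
      _ = x1 (x2 (x3 (x4 (x3 (x2 (x1 p)))))) := by simp only [c24, q2]
      _ = x1 (x2 (x1 (x3 (x4 (x3 (x1 (x2 (x1 p)))))))) := by simp only [c13, c14, q1]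
  intro u
  -- Starting from the identity operator, the second component accumulates exactly the product of
  -- elementary operators in the word.
  have ev : ∀ {p q : (Fin 6 → ℂ) × A}, p = q → p.2 = q.2 := fun h => by rw [h]
  refine ⟨?_, ?_, ?_, ?_, ?_, ?_⟩
  · simpa only [hx0, hx1, hx2, hx3, hx4, act, R1_12, R1_23, R2_12, R2_23, r₁, r₃, p₃, p₅, mul_assoc,
      mul_one] using ev (e1 (u, 1))
  · simpa only [hx0, hx1, hx2, hx3, hx4, act, R1_12, R1_23, R2_12, R2_23, r₁, r₃, p₃, p₅, mul_assoc,
      mul_one] using ev (e2 (u, 1))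
  · simpa only [hx0, hx1, hx2, hx3, hx4, act, R1_12, R1_23, R2_12, R2_23, r₁, r₃, p₃, p₅, mul_assoc,
      mul_one] using ev (e3 (u, 1))
  · simpa only [hx0, hx1, hx2, hx3, hx4, act, R1_12, R1_23, R2_12, R2_23, r₁, r₃, p₃, p₅, mul_assoc,
      mul_one] using ev (e4 (u, 1))
  · simpa only [hx0, hx1, hx2, hx3, hx4, act, R1_12, R1_23, R2_12, R2_23, r₁, r₃, p₃, p₅, mul_assoc,
      mul_one] using ev (e5 (u, 1))
  · simpa only [hx0, hx1, hx2, hx3, hx4, act, R1_12, R1_23, R2_12, R2_23, r₁, r₃, p₃, p₅, mul_assoc,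
      mul_one] using ev (e6 (u, 1))

end CoxeterRelations

/-! ### Sums of ratios of gamma functions -/

section GammaSums

variable {σ G : ℂ → ℂ}

/-- The function `G` satisfies `G (z + 1) = σ z * G z` on `c + ℤ`, without zeros of `σ` or `G`. -/
def IsGammaAt (σ G : ℂ → ℂ) (c : ℂ) : Prop :=
  ∀ i : ℤ, G (c + i + 1) = σ (c + i) * G (c + i) ∧ G (c + i) ≠ 0 ∧ σ (c + i) ≠ 0

theorem IsGammaAt.ne_zero {c : ℂ} (h : IsGammaAt σ G c) (d : ℂ) (m : ℤ) (hd : d = c + m) :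
    G d ≠ 0 := hd ▸ (h m).2.1

theorem IsGammaAt.shift {c : ℂ} (h : IsGammaAt σ G c) {d f : ℂ} (m : ℤ) (k : ℕ)
    (hd : d = c + m) (hf : f = d + k) : G f = rising σ d k * G d := by
  subst hf
  induction k with
  | zero => simp
  | succ k ih =>
    have := (h (m + k)).1
    rw [rising_succ, mul_right_comm, ← ih, hd]
    push_cast at this ⊢
    rw [← add_assoc] at this
    rw [← add_assoc, this, mul_comm]

theorem rising_reflect (hodd : ∀ x, σ (-x) = -σ x) (c d : ℂ) (k : ℕ) (hd : d = 1 - c - k) :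
    rising σ c k = (-1) ^ k * rising σ d k := by
  subst hd
  have hc : (-1 : ℂ) ^ k = ∏ _i ∈ Finset.range k, (-1 : ℂ) := by simp
  rw [rising, ← Finset.prod_range_reflect, rising, hc, ← Finset.prod_mul_distrib]
  refine Finset.prod_congr rfl fun j hj => ?_
  rw [neg_one_mul, ← hodd]
  congr 1
  have hj : j + 1 ≤ k := Finset.mem_range.1 hj
  rw [Nat.sub_sub, add_comm 1 j, Nat.cast_sub hj]
  push_cast
  ring

/-- The braid identity when the series lowers the argument of `G`. With `n` fixed, the gamma ratio
is a product of two shifted factorials times a factor independent of the summation index; what is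
left is the Saalschütz sum with the two indices exchanged. -/
theorem gammaSum_down {e : ℂ → ℂ} (he0 : e 0 = 1) (he : ∀ x y, e (x + y) = e x * e y)
    (hadd : ∀ x y, σ (x + y) = σ x + e x * σ y) (hσ : ∀ k : ℕ, 0 < k → σ k ≠ 0) {y a b : ℂ}
    (h1 : IsGammaAt σ G y) (h2 : IsGammaAt σ G (y + a + b)) (h3 : IsGammaAt σ G (y + a)) (n : ℕ) :
    ∑ p ∈ Finset.HasAntidiagonal.antidiagonal n,
      e b ^ p.1 * (rising σ (-b) p.1 / factorialOf σ p.1) *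
        (rising σ (-a) p.2 / factorialOf σ p.2) * (G (y - p.1 + a + b) / G (y - p.1)) =
      e b ^ n * (rising σ (-(a + b)) n / factorialOf σ n) * (G (y + a) / G y) *
        (G (y + a + b - n) / G (y + a - n)) := by
  have hs := saalschutz_sum he0 he hadd hσ n (-a) (y + a + b - n) (y - n) (-b) (by ring)
  rw [← Finset.Nat.sum_antidiagonal_swap] at hs
  rw [show y - n - -a = y + a - n by ring, show y - n - (y + a + b - n) = -(a + b) by ring] at hs
  have hy := h1.ne_zero y 0 (by simp)
  have hya := h3.ne_zero (y + a - n) (-n) (by push_cast; ring)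
  rw [h3.shift (d := y + a - n) (f := y + a) (-n) n (by push_cast; ring) (by ring)]
  have heb : e b * e (-b) = 1 := by rw [← he, add_neg_cancel, he0]
  calc _ = ∑ p ∈ Finset.HasAntidiagonal.antidiagonal n,
        (rising σ (-a) p.2 * rising σ (y + a + b - n) p.2 * rising σ (y - n + p.2) p.1 *
          rising σ (-b) p.1 * e (-b) ^ p.2 / (factorialOf σ p.2 * factorialOf σ p.1)) *
          (e b ^ n * (G (y + a + b - n) / G y)) := by
        refine Finset.sum_congr rfl fun p hp => ?_
        obtain ⟨k, l⟩ := p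
        obtain rfl : k + l = n := Finset.HasAntidiagonal.mem_antidiagonal.1 hp
        have hk := h1.ne_zero (y - k) (-k) (by push_cast; ring)
        have e1 := h2.shift (d := y + a + b - (k + l : ℕ)) (f := y - k + a + b) (-(k + l : ℕ)) l
          (by push_cast; ring) (by push_cast; ring)
        have e2 := h1.shift (d := y - k) (f := y) (-k) k (by push_cast; ring) (by ring)
        have e3 : G (y - k + a + b) / G (y - k) = rising σ (y + a + b - (k + l : ℕ)) l *
            rising σ (y - k) k * (G (y + a + b - (k + l : ℕ)) / G y) := by
          rw [mul_div_assoc', div_eq_div_iff hk hy, e1, e2]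
          ring
        have e4 : e (-b) ^ l * e b ^ (k + l) = e b ^ k := by
          rw [pow_add, mul_left_comm, ← mul_pow, mul_comm (e (-b)), heb, one_pow, mul_one]
        simp only [e3]
        rw [← e4, show y - (k + l : ℕ) + l = y - k by push_cast; ring]
        ring
    _ = _ := by
        rw [← Finset.sum_mul]
        refine (congrArg (· * _) hs).trans ?_
        field_simp

/-- The companion for a series that raises the argument of `G`. The Saalschütz sum now appears
without exchanging the indices, and the weight is `e (-a)` instead of `e b`. -/
theorem gammaSum_up {e : ℂ → ℂ} (he0 : e 0 = 1) (he : ∀ x y, e (x + y) = e x * e y)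
    (hadd : ∀ x y, σ (x + y) = σ x + e x * σ y) (hσ : ∀ k : ℕ, 0 < k → σ k ≠ 0) {y a b : ℂ}
    (h1 : IsGammaAt σ G y) (h2 : IsGammaAt σ G (y + a)) (h3 : IsGammaAt σ G (y - b)) (n : ℕ) :
    ∑ p ∈ Finset.HasAntidiagonal.antidiagonal n,
      e (-a) ^ p.1 * (rising σ (-b) p.1 / factorialOf σ p.1) *
        (rising σ (-a) p.2 / factorialOf σ p.2) * (G (y + a + p.1) / G (y - b + p.1)) =
      (rising σ (-(a + b)) n / factorialOf σ n) * (G (y + a) / G y) *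
        (G (y + n) / G (y - b + n)) := by
  have hs := saalschutz_sum he0 he hadd hσ n (-b) (y + a) (y - b) (-a) (by ring)
  have hy := h1.ne_zero y 0 (by simp)
  have hn := h3.ne_zero (y - b + n) n (by simp)
  rw [h1.shift (d := y) (f := y + n) 0 n (by simp) rfl]
  rw [show y - b - -b = y by ring, show y - b - (y + a) = -(a + b) by ring] at hs
  calc _ = ∑ p ∈ Finset.HasAntidiagonal.antidiagonal n,
        (rising σ (-b) p.1 * rising σ (y + a) p.1 * rising σ (y - b + p.1) p.2 *
          rising σ (-a) p.2 * e (-a) ^ p.1 / (factorialOf σ p.1 * factorialOf σ p.2)) *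
          (G (y + a) / G (y - b + n)) := by
        refine Finset.sum_congr rfl fun p hp => ?_
        obtain ⟨k, l⟩ := p
        obtain rfl : k + l = n := Finset.HasAntidiagonal.mem_antidiagonal.1 hp
        have hk := h3.ne_zero (y - b + k) k (by simp)
        have e1 := h2.shift (d := y + a) (f := y + a + k) 0 k (by simp) rfl
        have e2 := h3.shift (d := y - b + k) (f := y - b + (k + l : ℕ)) k l (by simp)
          (by push_cast; ring)
        have e3 : G (y + a + k) / G (y - b + k) = rising σ (y + a) k *
            rising σ (y - b + k) l * (G (y + a) / G (y - b + (k + l : ℕ))) := by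
          rw [mul_div_assoc', div_eq_div_iff hk hn, e1, e2]
          ring
        simp only [e3]
        ring
    _ = _ := by
        rw [← Finset.sum_mul, hs]
        field_simp

/-! ### The elliptic braid identities. -/

/-- The coefficients of the elliptic operator `W(a)`, up to a gauge transformation. -/
def ellCoeff (σ G : ℂ → ℂ) (a : ℂ) (k : ℕ) (x : ℂ) : ℂ :=
  σ (x + a - 2 * k) * (G (x - k) / G (x + a - k + 1)) * (rising σ (-a) k / factorialOf σ k)

/-- The Frenkel-Turaev sum as a composition rule for the coefficients of `W(a)`. -/
theorem ellCoeff_sum (hodd : ∀ x, σ (-x) = -σ x)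
    (h3 : ∀ x y z w, σ (x + y) * σ (x - y) * (σ (z + w) * σ (z - w)) -
      σ (x + z) * σ (x - z) * (σ (y + w) * σ (y - w)) +
      σ (x + w) * σ (x - w) * (σ (y + z) * σ (y - z)) = 0)
    (hσ : ∀ k : ℕ, 0 < k → σ k ≠ 0) {x a b t r : ℂ} (htr : t - r = x)
    (hx : IsGammaAt σ G x) (hxb : IsGammaAt σ G (x + b)) (hxab : IsGammaAt σ G (x + a + b))
    (ht : ∀ i : ℤ, σ (t - a / 2 + i) ≠ 0) (hr : ∀ i : ℤ, σ (r - a / 2 - b + i) ≠ 0) (n : ℕ) :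
    ∑ p ∈ Finset.HasAntidiagonal.antidiagonal n,
      ellCoeff σ G b p.1 x * ellCoeff σ G a p.2 (x + b - 2 * p.1) *
        ((rising σ (1 - t + a / 2) p.1 * rising σ (1 - t - a / 2 - b + p.1) p.2) *
        (rising σ (r + a / 2) p.1 * rising σ (r - a / 2 - b + p.1) p.2)) =
      ellCoeff σ G (a + b) n x * (rising σ (1 - t - a / 2) n * rising σ (r - a / 2) n) := by
  have hneg : ∀ z, σ z ≠ 0 → σ (-z) ≠ 0 := fun z hz => by rw [hodd]; exact neg_ne_zero.2 hz
  -- `B` and `E` produce the coefficients of the two series, `C` and `D` the two gamma ratios of the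
  -- multiplication operator. The balancing condition is exactly `t - r = x`.
  have key := frenkelTuraev_sum hodd h3 hσ n (-(x + b)) (-b) (1 - t + a / 2) (r + a / 2)
    (-(x + b) - a + n) (by rw [← htr]; ring)
    (fun i => by
      have := hneg _ (hxb (-i)).2.2
      convert this using 2
      push_cast
      ring)
    (fun i => by
      have := hneg _ (ht (-1 - i))
      convert this using 2
      push_cast
      ring)
    (fun i => by
      convert hr (-1 + i) using 2
      rw [← htr]
      push_cast
      ring)
  rw [show -(x + b) + 1 - -b - (1 - t + a / 2) = r - a / 2 by rw [← htr]; ring,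
    show -(x + b) + 1 - -b - (r + a / 2) = 1 - t - a / 2 by rw [← htr]; ring,
    show -(x + b) + 1 - (1 - t + a / 2) - (r + a / 2) = -(a + b) by rw [← htr]; ring] at key
  have hsq : ∀ m : ℕ, ((-1 : ℂ) ^ m) * (-1) ^ m = 1 := fun m => by rw [← mul_pow]; simp
  have hG1 := hxb.ne_zero (x + b + 1) 1 (by simp)
  have hG2 := hxab.ne_zero (x + a + b - n + 1) (-n + 1) (by push_cast; ring)
  have hG3 := hxb.ne_zero (x + b - 2 * n) (-(2 * n : ℕ)) (by push_cast; ring)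
  have hA : rising σ (-(x + b)) (2 * n + 1) = -(G (x + b + 1) / G (x + b - 2 * n)) := by
    rw [hxb.shift (d := x + b - 2 * n) (f := x + b + 1) (-(2 * n : ℕ)) (2 * n + 1)
      (by push_cast; ring) (by push_cast; ring), mul_div_cancel_right₀ _ hG3,
      rising_reflect hodd (-(x + b)) (x + b - 2 * n) _ (by push_cast; ring), pow_succ, pow_mul]
    simp
  rw [hA] at key
  calc _ = ∑ p ∈ Finset.HasAntidiagonal.antidiagonal n,
        turaevTerm σ (-(x + b)) (-b) (1 - t + a / 2) (r + a / 2) (-(x + b) - a + n) p.1 p.2 *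
          (-σ (x + a + b - 2 * n) * (G (x - n) * G (x + b - 2 * n) /
            (G (x + b + 1) * G (x + a + b - n + 1)))) := by
        refine Finset.sum_congr rfl fun p hp => ?_
        obtain ⟨k, l⟩ := p
        obtain rfl : k + l = n := Finset.HasAntidiagonal.mem_antidiagonal.1 hp
        have n1 := hxb.ne_zero (x + b - k + 1) (-k + 1) (by push_cast; ring)
        have n2 := hxab.ne_zero (x + a + b - (k + l : ℕ) - k + 1) (-(k + l : ℕ) - k + 1)
          (by push_cast; ring)
        have g1 := hx.shift (d := x - (k + l : ℕ)) (f := x - k) (-(k + l : ℕ)) l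
          (by push_cast; ring) (by push_cast; ring)
        have g2 := hxb.shift (d := x + b - 2 * (k + l : ℕ)) (f := x + b - (k + l : ℕ) - k)
          (-(2 * (k + l) : ℕ)) l (by push_cast; ring) (by push_cast; ring)
        have g3 := hxb.shift (d := x + b - k + 1) (f := x + b + 1) (-k + 1) k
          (by push_cast; ring) (by ring)
        have g4 := hxab.shift (d := x + a + b - (k + l : ℕ) - k + 1)
          (f := x + a + b - (k + l : ℕ) + 1) (-(k + l : ℕ) - k + 1) k
          (by push_cast; ring) (by ring)
        rw [rising_reflect hodd _ (1 - x + k) l (by push_cast; ring)] at g1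
        rw [rising_reflect hodd _ (-(x + b) + 2 * k + l + 1) l (by push_cast; ring)] at g2
        rw [rising_reflect hodd _ (-(x + b)) k (by ring)] at g3
        rw [rising_reflect hodd _ (-(x + b) - a + (k + l : ℕ)) k (by push_cast; ring)] at g4
        have g5 := rising_reflect hodd (-a) (1 + a - l) l (by ring)
        have g6 : σ (x + b - 2 * k) = -σ (-(x + b) + 2 * k) := by
          rw [← hodd]; ring_nf
        -- All gamma values are moved to points depending only on `n`, at the price of four shifted
        -- factorials. The reflections contribute each of the signs `(-1) ^ k` and `(-1) ^ l` twice,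
        -- so they cancel.
        have gg : G (x - k) / G (x + b - k + 1) *
            (G (x + b - (k + l : ℕ) - k) / G (x + a + b - (k + l : ℕ) - k + 1)) =
            (rising σ (1 - x + k) l * rising σ (-(x + b) + 2 * k + l + 1) l *
              rising σ (-(x + b)) k * rising σ (-(x + b) - a + (k + l : ℕ)) k) *
            (G (x - (k + l : ℕ)) * G (x + b - 2 * (k + l : ℕ)) /
            (G (x + b + 1) * G (x + a + b - (k + l : ℕ) + 1))) := by
          rw [div_mul_div_comm, mul_div_assoc', div_eq_div_iff (mul_ne_zero n1 n2)
            (mul_ne_zero hG1 hG2), g1, g2, g3, g4]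
          have hkl : (-1 : ℂ) ^ l * (-1) ^ l * ((-1) ^ k * (-1) ^ k) = 1 := by
            rw [hsq, hsq, one_mul]
          linear_combination (rising σ (1 - x + k) l * G (x - (k + l : ℕ)) *
            (rising σ (-(x + b) + 2 * k + l + 1) l * G (x + b - 2 * (k + l : ℕ))) *
            (rising σ (-(x + b)) k * G (x + b - k + 1) *
              (rising σ (-(x + b) - a + (k + l : ℕ)) k *
                G (x + a + b - (k + l : ℕ) - k + 1)))) *
              hkl
        simp only [ellCoeff, turaevTerm]
        rw [show x + b - 2 * k + a - 2 * l = x + a + b - 2 * (k + l : ℕ) by push_cast; ring,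
          show x + b - 2 * k - l = x + b - (k + l : ℕ) - k by push_cast; ring,
          show x + b - 2 * k + a - l + 1 = x + a + b - (k + l : ℕ) - k + 1 by push_cast; ring,
          show -(x + b) + 1 - -b + k = 1 - x + k by ring,
          show -(x + b) + 1 - (1 - t + a / 2) + k = r - a / 2 - b + k by rw [← htr]; ring,
          show -(x + b) + 1 - (r + a / 2) + k = 1 - t - a / 2 - b + k by rw [← htr]; ring,
          show -(x + b) + 1 - (-(x + b) - a + (k + l : ℕ)) + k = 1 + a - l by push_cast; ring,
          g5, g6]
        calc _ = (G (x - k) / G (x + b - k + 1) *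
            (G (x + b - (k + l : ℕ) - k) / G (x + a + b - (k + l : ℕ) - k + 1))) *
            (-σ (-(x + b) + 2 * k) * σ (x + a + b - 2 * (k + l : ℕ)) *
              (rising σ (-b) k / factorialOf σ k) *
              ((-1) ^ l * rising σ (1 + a - l) l / factorialOf σ l) *
              (rising σ (1 - t + a / 2) k * rising σ (1 - t - a / 2 - b + k) l *
              (rising σ (r + a / 2) k * rising σ (r - a / 2 - b + k) l))) := by ring
          _ = _ := by
            rw [gg]
            ring
    _ = _ := by
        rw [← Finset.sum_mul, key, ellCoeff, show x + (a + b) = x + a + b by ring]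
        field_simp

/-- The last factor depends on `k + l` only and leaves the sum; the shifted factorials are those of
`ellCoeff_sum`. The three lemmas that follow do the same for the other side of the identity and for
arguments that move upwards. -/
theorem gammaRatio_down (hodd : ∀ x, σ (-x) = -σ x) {t a b : ℂ} (h1 : IsGammaAt σ G (t - a / 2))
    (h2 : IsGammaAt σ G (t + a / 2 + b)) (k l : ℕ) :
    G (t + a / 2 + b - k) / G (t - a / 2 - k) =
      rising σ (1 - t + a / 2) k * rising σ (1 - t - a / 2 - b + k) l *
        ((-1) ^ (k + l) * (G (t + a / 2 + b - (k + l : ℕ)) / G (t - a / 2))) := by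
  have e1 := h1.shift (d := t - a / 2 - k) (f := t - a / 2) (-k) k (by push_cast; ring) (by ring)
  have e2 := h2.shift (d := t + a / 2 + b - (k + l : ℕ)) (f := t + a / 2 + b - k)
    (-(k + l : ℕ)) l (by push_cast; ring) (by push_cast; ring)
  rw [rising_reflect hodd _ (1 - t + a / 2) k (by ring)] at e1
  rw [rising_reflect hodd _ (1 - t - a / 2 - b + k) l (by push_cast; ring)] at e2
  have hsq : ((-1 : ℂ) ^ k) * (-1) ^ k = 1 := by rw [← mul_pow]; simp
  rw [mul_div_assoc', mul_div_assoc', div_eq_div_iff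
    (h1.ne_zero (t - a / 2 - k) (-k) (by push_cast; ring)) (h1.ne_zero (t - a / 2) 0 (by simp)),
    e1, e2, pow_add]
  ring

theorem gammaRatio_down_end (hodd : ∀ x, σ (-x) = -σ x) {t a b : ℂ}
    (h1 : IsGammaAt σ G (t - a / 2)) (h2 : IsGammaAt σ G (t + a / 2)) (n : ℕ) :
    G (t + a / 2) / G (t - a / 2) * (G (t + a / 2 + b - n) / G (t + a / 2 - n)) =
      rising σ (1 - t - a / 2) n * ((-1) ^ n * (G (t + a / 2 + b - n) / G (t - a / 2))) := by
  have hn := h2.ne_zero (t + a / 2 - n) (-n) (by push_cast; ring)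
  have h0 := h1.ne_zero (t - a / 2) 0 (by simp)
  rw [h2.shift (d := t + a / 2 - n) (f := t + a / 2) (-n) n (by push_cast; ring) (by ring),
    rising_reflect hodd _ (1 - t - a / 2) n (by ring)]
  generalize G (t + a / 2 - n) = g at *
  field_simp

theorem gammaRatio_up {r a b : ℂ} (h1 : IsGammaAt σ G (r + a / 2))
    (h2 : IsGammaAt σ G (r - a / 2 - b)) (k l : ℕ) :
    G (r + a / 2 + k) / G (r - a / 2 - b + k) =
      rising σ (r + a / 2) k * rising σ (r - a / 2 - b + k) l *
        (G (r + a / 2) / G (r - a / 2 - b + (k + l : ℕ))) := by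
  have e1 := h1.shift (d := r + a / 2) (f := r + a / 2 + k) 0 k (by simp) rfl
  have e2 := h2.shift (d := r - a / 2 - b + k) (f := r - a / 2 - b + (k + l : ℕ)) k l
    (by simp) (by push_cast; ring)
  rw [mul_div_assoc', div_eq_div_iff (h2.ne_zero (r - a / 2 - b + k) k (by simp))
    (h2.ne_zero (r - a / 2 - b + (k + l : ℕ)) (k + l : ℕ) (by simp)), e1, e2]
  ring

theorem gammaRatio_up_end {r a b : ℂ} (h1 : IsGammaAt σ G (r - a / 2)) (n : ℕ) :
    G (r + a / 2) / G (r - a / 2) * (G (r - a / 2 + n) / G (r - a / 2 - b + n)) =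
      rising σ (r - a / 2) n * (G (r + a / 2) / G (r - a / 2 - b + n)) := by
  have h0 := h1.ne_zero (r - a / 2) 0 (by simp)
  rw [h1.shift (d := r - a / 2) (f := r - a / 2 + n) 0 n (by simp) rfl]
  generalize G (r - a / 2) = g at *
  field_simp

/-- The multiplication operator `V(a)` of the elliptic case, up to a gauge transformation. -/
def ellFactor (G : ℂ → ℂ) (a x y : ℂ) : ℂ :=
  (G ((x + y + 1) / 2 + a / 2) / G ((x + y + 1) / 2 - a / 2)) *
    (G ((x - y + 1) / 2 + a / 2) / G ((x - y + 1) / 2 - a / 2))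

/-- The series acts on the first variable, so both gamma ratios move downwards. The second one is
brought to the form required by `ellCoeff_sum` through the reflected choice `r := 1 - (x - y + 1) /
2`. -/
theorem ellCoeff_braid_left (hodd : ∀ x, σ (-x) = -σ x)
    (h3 : ∀ x y z w, σ (x + y) * σ (x - y) * (σ (z + w) * σ (z - w)) -
      σ (x + z) * σ (x - z) * (σ (y + w) * σ (y - w)) +
      σ (x + w) * σ (x - w) * (σ (y + z) * σ (y - z)) = 0)
    (hσ : ∀ k : ℕ, 0 < k → σ k ≠ 0) {x y a b : ℂ}
    (hx : IsGammaAt σ G x) (hxb : IsGammaAt σ G (x + b)) (hxab : IsGammaAt σ G (x + a + b))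
    (hp : IsGammaAt σ G ((x + y + 1) / 2 + a / 2)) (hm : IsGammaAt σ G ((x - y + 1) / 2 + a / 2))
    (hp' : IsGammaAt σ G ((x + y + 1) / 2 - a / 2))
    (hm' : IsGammaAt σ G ((x - y + 1) / 2 - a / 2))
    (hpb : IsGammaAt σ G ((x + y + 1) / 2 + a / 2 + b))
    (hmb : IsGammaAt σ G ((x - y + 1) / 2 + a / 2 + b)) (n : ℕ) :
    ∑ p ∈ Finset.HasAntidiagonal.antidiagonal n,
      ellCoeff σ G b p.1 x * ellFactor G (a + b) (x + b - 2 * p.1) y *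
        ellCoeff σ G a p.2 (x + b - 2 * p.1) =
      ellFactor G a x y * ellCoeff σ G (a + b) n x * ellFactor G b (x + a + b - 2 * n) y := by
  have hneg : ∀ z, σ z ≠ 0 → σ (-z) ≠ 0 := fun z hz => by rw [hodd]; exact neg_ne_zero.2 hz
  have key := ellCoeff_sum hodd h3 hσ (t := (x + y + 1) / 2) (r := 1 - (x - y + 1) / 2)
    (by ring) hx hxb hxab (fun i => (hp' i).2.2)
    (fun i => by
      have := hneg _ (hmb (-1 - i)).2.2
      convert this using 2
      push_cast
      ring) n
  set t := (x + y + 1) / 2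
  set r := (x - y + 1) / 2
  have e1 := gammaRatio_down_end (b := b) hodd hp' hp n
  have e2 := gammaRatio_down_end (b := b) hodd hm' hm n
  calc _ = ∑ p ∈ Finset.HasAntidiagonal.antidiagonal n,
        ellCoeff σ G b p.1 x * ellCoeff σ G a p.2 (x + b - 2 * p.1) *
        ((rising σ (1 - t + a / 2) p.1 * rising σ (1 - t - a / 2 - b + p.1) p.2) *
        (rising σ (1 - r + a / 2) p.1 * rising σ (1 - r - a / 2 - b + p.1) p.2)) *
        (((-1) ^ n * (G (t + a / 2 + b - n) / G (t - a / 2))) *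
          ((-1) ^ n * (G (r + a / 2 + b - n) / G (r - a / 2)))) := by
        refine Finset.sum_congr rfl fun p hp => ?_
        obtain ⟨k, l⟩ := p
        obtain rfl : k + l = n := Finset.HasAntidiagonal.mem_antidiagonal.1 hp
        have f1 := gammaRatio_down hodd hp' hpb k l
        have f2 := gammaRatio_down hodd hm' hmb k l
        simp only [ellFactor]
        rw [show (x + b - 2 * k + y + 1) / 2 + (a + b) / 2 = t + a / 2 + b - k by
            simp only [t]; ring,
          show (x + b - 2 * k + y + 1) / 2 - (a + b) / 2 = t - a / 2 - k by simp only [t]; ring,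
          show (x + b - 2 * k - y + 1) / 2 + (a + b) / 2 = r + a / 2 + b - k by
            simp only [r]; ring,
          show (x + b - 2 * k - y + 1) / 2 - (a + b) / 2 = r - a / 2 - k by simp only [r]; ring,
          f1, f2]
        ring
    _ = ellCoeff σ G (a + b) n x * (rising σ (1 - t - a / 2) n *
          ((-1) ^ n * (G (t + a / 2 + b - n) / G (t - a / 2)))) * (rising σ (1 - r - a / 2) n *
          ((-1) ^ n * (G (r + a / 2 + b - n) / G (r - a / 2)))) := by
        rw [← Finset.sum_mul, key]
        ring
    _ = _ := by
        rw [← e1, ← e2, ellFactor, ellFactor,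
          show (x + a + b - 2 * n + y + 1) / 2 + b / 2 = t + a / 2 + b - n by
            simp only [t]; ring,
          show (x + a + b - 2 * n + y + 1) / 2 - b / 2 = t + a / 2 - n by simp only [t]; ring,
          show (x + a + b - 2 * n - y + 1) / 2 + b / 2 = r + a / 2 + b - n by
            simp only [r]; ring,
          show (x + a + b - 2 * n - y + 1) / 2 - b / 2 = r + a / 2 - n by simp only [r]; ring]
        ring

/-- The series acts on the second variable: the ratio in `x + y` moves down and the one in `x - y`
moves up, so no reflection is needed. -/
theorem ellCoeff_braid_right (hodd : ∀ x, σ (-x) = -σ x)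
    (h3 : ∀ x y z w, σ (x + y) * σ (x - y) * (σ (z + w) * σ (z - w)) -
      σ (x + z) * σ (x - z) * (σ (y + w) * σ (y - w)) +
      σ (x + w) * σ (x - w) * (σ (y + z) * σ (y - z)) = 0)
    (hσ : ∀ k : ℕ, 0 < k → σ k ≠ 0) {x y a b : ℂ}
    (hy : IsGammaAt σ G y) (hyb : IsGammaAt σ G (y + b)) (hyab : IsGammaAt σ G (y + a + b))
    (hp : IsGammaAt σ G ((x + y + 1) / 2 + a / 2)) (hm : IsGammaAt σ G ((x - y + 1) / 2 + a / 2))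
    (hp' : IsGammaAt σ G ((x + y + 1) / 2 - a / 2))
    (hm' : IsGammaAt σ G ((x - y + 1) / 2 - a / 2))
    (hpb : IsGammaAt σ G ((x + y + 1) / 2 + a / 2 + b))
    (hmb : IsGammaAt σ G ((x - y + 1) / 2 - a / 2 - b)) (n : ℕ) :
    ∑ p ∈ Finset.HasAntidiagonal.antidiagonal n,
      ellCoeff σ G b p.1 y * ellFactor G (a + b) x (y + b - 2 * p.1) *
        ellCoeff σ G a p.2 (y + b - 2 * p.1) =
      ellFactor G a x y * ellCoeff σ G (a + b) n y * ellFactor G b x (y + a + b - 2 * n) := by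
  have key := ellCoeff_sum hodd h3 hσ (t := (x + y + 1) / 2) (r := (x - y + 1) / 2)
    (by ring) hy hyb hyab (fun i => (hp' i).2.2) (fun i => (hmb i).2.2) n
  set t := (x + y + 1) / 2
  set r := (x - y + 1) / 2
  have e1 := gammaRatio_down_end (b := b) hodd hp' hp n
  have e2 := gammaRatio_up_end (b := b) hm' n
  calc _ = ∑ p ∈ Finset.HasAntidiagonal.antidiagonal n,
        ellCoeff σ G b p.1 y * ellCoeff σ G a p.2 (y + b - 2 * p.1) *
        ((rising σ (1 - t + a / 2) p.1 * rising σ (1 - t - a / 2 - b + p.1) p.2) *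
        (rising σ (r + a / 2) p.1 * rising σ (r - a / 2 - b + p.1) p.2)) *
        (((-1) ^ n * (G (t + a / 2 + b - n) / G (t - a / 2))) *
          (G (r + a / 2) / G (r - a / 2 - b + n))) := by
        refine Finset.sum_congr rfl fun p hp => ?_
        obtain ⟨k, l⟩ := p
        obtain rfl : k + l = n := Finset.HasAntidiagonal.mem_antidiagonal.1 hp
        have f1 := gammaRatio_down hodd hp' hpb k l
        have f2 := gammaRatio_up hm hmb k l
        simp only [ellFactor]
        rw [show (x + (y + b - 2 * k) + 1) / 2 + (a + b) / 2 = t + a / 2 + b - k by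
            simp only [t]; ring,
          show (x + (y + b - 2 * k) + 1) / 2 - (a + b) / 2 = t - a / 2 - k by
            simp only [t]; ring,
          show (x - (y + b - 2 * k) + 1) / 2 + (a + b) / 2 = r + a / 2 + k by
            simp only [r]; ring,
          show (x - (y + b - 2 * k) + 1) / 2 - (a + b) / 2 = r - a / 2 - b + k by
            simp only [r]; ring,
          f1, f2]
        ring
    _ = ellCoeff σ G (a + b) n y * (rising σ (1 - t - a / 2) n *
          ((-1) ^ n * (G (t + a / 2 + b - n) / G (t - a / 2)))) * (rising σ (r - a / 2) n *
          (G (r + a / 2) / G (r - a / 2 - b + n))) := by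
        rw [← Finset.sum_mul, key]
        ring
    _ = _ := by
        rw [← e1, ← e2, ellFactor, ellFactor,
          show (x + (y + a + b - 2 * n) + 1) / 2 + b / 2 = t + a / 2 + b - n by
            simp only [t]; ring,
          show (x + (y + a + b - 2 * n) + 1) / 2 - b / 2 = t + a / 2 - n by
            simp only [t]; ring,
          show (x - (y + a + b - 2 * n) + 1) / 2 + b / 2 = r - a / 2 + n by
            simp only [r]; ring,
          show (x - (y + a + b - 2 * n) + 1) / 2 - b / 2 = r - a / 2 - b + n by
            simp only [r]; ring]
        ring

end GammaSums

/-! ### Chains of local operators -/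

namespace ShiftSeries

variable {σ : Type} {M : σ → X} [DecidableEq σ]

/-- The shifts that occur in `A` move only the variables in `K`, and the coefficients of `A` depend
only on the variables in `L`. -/
structure IsLocal (A : ShiftSeries M) (K L : Set (Fin 3)) : Prop where
  exponent_eq_zero : ∀ n, A.coeff n ≠ 0 → ∀ i ∉ K, A.exponent n i = 0
  shift_eq : ∀ n w, (∀ i ∈ L, w i = 0) → (A.coeff n).shift w = A.coeff n

theorem IsLocal.comm {A B : ShiftSeries M} {K L K' L' : Set (Fin 3)} (hA : A.IsLocal K L)
    (hB : B.IsLocal K' L') (h : Disjoint K L') (h' : Disjoint K' L) : A * B = B * A :=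
  commute_of_invariant
    (fun n m hn => hB.shift_eq m _ fun i hi =>
      hA.exponent_eq_zero n hn i fun hK => h.notMem_of_mem_left hK hi)
    (fun n m hn => hA.shift_eq m _ fun i hi =>
      hB.exponent_eq_zero n hn i fun hK => h'.notMem_of_mem_left hK hi)

omit [DecidableEq σ] in
theorem IsLocal.mono' {A : ShiftSeries M} {K L K' L' : Set (Fin 3)} (hA : A.IsLocal K L)
    (hK : K ⊆ K') (hL : L ⊆ L') : A.IsLocal K' L' :=
  ⟨fun n hn i hi => hA.exponent_eq_zero n hn i fun h => hi (hK h),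
    fun n w hw => hA.shift_eq n w fun i hi => hw i (hL hi)⟩

theorem isLocal_powerSeries {v : X} {j : σ} {c : ℕ → X → ℂ} {K L : Set (Fin 3)}
    (hv : ∀ i ∉ K, v i = 0) (hM : ∀ i ∉ K, M j i = 0)
    (hc : ∀ k w x, (∀ i ∈ L, w i = 0) → c k (x + w) = c k x) :
    (powerSeries v j fun k => (c k : Coef) : ShiftSeries M).IsLocal K L := by
  refine ⟨fun n hn i hi => ?_, fun n w hw => ?_⟩
  · by_cases h : n = Finsupp.single j (n j)
    · rw [h, exponent_single]
      simp [powerSeries, hv i hi, hM i hi]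
    · exact absurd (if_neg h) hn
  · by_cases h : n = Finsupp.single j (n j)
    · simp only [powerSeries, if_pos h, Coef.shift_coe]
      congr 1
      funext x
      exact hc _ w x hw
    · simp only [powerSeries, if_neg h, Coef.shift_zero]

theorem isLocal_mono {v : X} {f : X → ℂ} {K L : Set (Fin 3)} (hv : ∀ i ∉ K, v i = 0)
    (hf : ∀ w x, (∀ i ∈ L, w i = 0) → f (x + w) = f x) :
    (mono v (f : Coef) : ShiftSeries M).IsLocal K L := by
  refine ⟨fun n hn i hi => ?_, fun n w hw => ?_⟩
  · by_cases h : n = 0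
    · rw [h, exponent_zero]
      exact hv i hi
    · exact absurd (if_neg h) hn
  · by_cases h : n = 0
    · simp only [mono, if_pos h, Coef.shift_coe]
      congr 1
      funext x
      exact hf w x hw
    · simp only [mono, if_neg h, Coef.shift_zero]

/-- The relations of the factor operators for two families of local operators: `A j` acts on the
variable `j`, and `B i` on the variables `i` and `i + 1`. -/
theorem factorRelations_of_local {A : Fin 3 → ℂ → ShiftSeries M} {B : Fin 2 → ℂ → ShiftSeries M}
    (hA : ∀ j a, (A j a).IsLocal {j} {j})
    (hB : ∀ i a, (B i a).IsLocal {i.castSucc, i.succ} {i.castSucc, i.succ})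
    (hBB : ∀ a b, B 0 a * B 1 b = B 1 b * B 0 a) (hA0 : ∀ j, A j 0 = 1) (hB0 : ∀ i, B i 0 = 1)
    (hinv : (∀ j a, A j (-a) * A j a = 1) ∨ ∀ i a, B i (-a) * B i a = 1)
    (hl : ∀ i a b, B i b * A i.castSucc (a + b) * B i a =
      A i.castSucc a * B i (a + b) * A i.castSucc b)
    (hr : ∀ i a b, B i b * A i.succ (a + b) * B i a = A i.succ a * B i (a + b) * A i.succ b) :
    FactorRelations ![A 0, B 0, A 1, B 1, A 2] := by
  -- At `b = -a` the middle operators of the braid relation have parameter zero and disappear, which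
  -- ties the inversion relations of the two families together.
  have hl' : ∀ i a, B i (-a) * B i a = A i.castSucc a * A i.castSucc (-a) := fun i a => by
    have := hl i a (-a)
    rwa [add_neg_cancel, hA0, hB0, mul_one, mul_one] at this
  have hr' : ∀ i a, B i (-a) * B i a = A i.succ a * A i.succ (-a) := fun i a => by
    have := hr i a (-a)
    rwa [add_neg_cancel, hA0, hB0, mul_one, mul_one] at this
  have invB : ∀ i a, B i (-a) * B i a = 1 := by
    rcases hinv with h | h
    · intro i a
      have := h i.castSucc (-a)
      rw [neg_neg] at this
      rw [hl', this]
    · exact h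
  have invA : ∀ j a, A j (-a) * A j a = 1 := by
    -- The left neighbours cover variables 0 and 1; the last variable is reached only as a right
    -- neighbour.
    have h1 : ∀ i a, A (Fin.castSucc i) (-a) * A (Fin.castSucc i) a = 1 := fun i a => by
      have := hl' i (-a)
      rw [invB, neg_neg] at this
      exact this.symm
    have h2 : ∀ i a, A (Fin.succ i) (-a) * A (Fin.succ i) a = 1 := fun i a => by
      have := hr' i (-a)
      rw [invB, neg_neg] at this
      exact this.symm
    intro j a
    fin_cases j
    · exact h1 0 a
    · exact h1 1 a
    · exact h2 1 a
  have hAA : ∀ j k a b, j ≠ k → A j a * A k b = A k b * A j a := fun j k a b hjk =>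
    (hA j a).comm (hA k b) (by simpa using hjk) (by simpa using hjk.symm)
  have hAB : ∀ j i a b, j ≠ Fin.castSucc i → j ≠ Fin.succ i → A j a * B i b = B i b * A j a :=
    fun j i a b h1 h2 => (hA j a).comm (hB i b) (by simp [h1, h2]) (by simp [h1, h2])
  refine factorRelations_of_coxeter ?_ ?_ ?_
  · intro i a
    fin_cases i
    · exact invA 0 a
    · exact invB 0 a
    · exact invA 1 a
    · exact invB 1 a
    · exact invA 2 a
  · intro i j hij a b
    fin_cases i <;> fin_cases j <;> first
      | exact absurd hij (by decide)
      | exact hAA 0 1 a b (by decide)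
      | exact hAB 0 1 a b (by decide) (by decide)
      | exact hAA 0 2 a b (by decide)
      | exact hBB a b
      | exact (hAB 2 0 b a (by decide) (by decide)).symm
      | exact hAA 1 2 a b (by decide)
  · intro i a b
    fin_cases i
    · have := hl 0 b a
      rw [add_comm b a] at this
      exact this.symm
    · exact hr 0 a b
    · have := hl 1 b a
      rw [add_comm b a] at this
      exact this.symm
    · exact hr 1 a b

end ShiftSeries

/-! ### Generic points -/

/-- An affine function on `X` with non-zero linear part avoids a given countable set almost
everywhere. -/
theorem ae_notMem_of_countable {t : Set ℂ} (ht : t.Countable) (a : X) (ha : a ≠ 0) (c : ℂ) :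
    ∀ᵐ x : X, a 0 * x 0 + a 1 * x 1 + a 2 * x 2 + c ∉ t := by
  let L : X →ₗ[ℝ] ℂ :=
    { toFun := fun x => a 0 * x 0 + a 1 * x 1 + a 2 * x 2
      map_add' := fun x y => by simp only [Pi.add_apply]; ring
      map_smul' := fun r x => by
        simp only [Pi.smul_apply, Complex.real_smul, RingHom.id_apply]; ring }
  have hL : Function.Surjective L := by
    intro z
    obtain ⟨j, hj⟩ : ∃ j, a j ≠ 0 := by
      by_contra! h
      exact ha (funext h)
    refine ⟨Pi.single j (z / a j), ?_⟩
    change a 0 * _ + a 1 * _ + a 2 * _ = z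
    fin_cases j <;> simp_all [mul_div_cancel₀]
  have hs : ((fun z : ℂ => z + c) ⁻¹' t).Countable := ht.preimage (add_left_injective c)
  -- Under a surjective linear map the preimage of a null set is null, and countable subsets of the
  -- plane are null.
  have := (ae_comp_linearMap_mem_iff L (volume : Measure X) (volume : Measure ℂ) hL
    hs.measurableSet.compl).2 (hs.measure_zero volume |> compl_mem_ae_iff.2)
  exact this

theorem ae_notMem_of_countable₁ {t : Set ℂ} (ht : t.Countable) (j : Fin 3) {r : ℂ} (hr : r ≠ 0)
    (c : ℂ) : ∀ᵐ x : X, r * x j + c ∉ t := by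
  have := ae_notMem_of_countable ht (Pi.single j r) (by simpa using hr) c
  filter_upwards [this] with x hx
  fin_cases j <;> simpa using hx

theorem ae_notMem_of_countable₂ {t : Set ℂ} (ht : t.Countable) (i : Fin 2) {r : ℂ} (hr : r ≠ 0)
    (r' c : ℂ) : ∀ᵐ x : X, r * x i.castSucc + r' * x i.succ + c ∉ t := by
  have := ae_notMem_of_countable ht (Pi.single i.castSucc r + Pi.single i.succ r')
    (fun h => hr (by
      have := congrFun h i.castSucc
      simpa [Pi.single_apply, Fin.ext_iff] using this)) c
  filter_upwards [this] with x hx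
  fin_cases i <;> simpa [Pi.single_apply, Fin.ext_iff] using hx

/-! ### No deformation -/

namespace Undeformed

/-- Stated on a neighbourhood of 0, not just at the point, so that the induction can differentiate
once more. -/
theorem iteratedDeriv_one_sub_cpow (a : ℂ) (k : ℕ) : ∀ᶠ s in nhds (0 : ℂ),
    iteratedDeriv k (fun s : ℂ => (1 - s) ^ a) s =
      rising (fun x => x) (-a) k * (1 - s) ^ (a - k) := by
  induction k with
  | zero => simp
  | succ k ih =>
    have h1 : ∀ᶠ s in nhds (0 : ℂ), 1 - s ∈ Complex.slitPlane := by
      refine (continuous_const.sub continuous_id).continuousAt.eventually_mem ?_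
      exact Complex.isOpen_slitPlane.mem_nhds (by simp)
    filter_upwards [ih.eventually_nhds, h1] with s hs h1
    rw [iteratedDeriv_succ, Filter.EventuallyEq.deriv_eq hs]
    have hd : HasDerivAt (fun s : ℂ => 1 - s) (-1) s := by
      simpa using (hasDerivAt_id s).const_sub 1
    have := (hd.cpow_const (c := a - k) h1).const_mul (rising (fun x => x) (-a) k)
    rw [this.deriv, rising_succ]
    push_cast
    rw [sub_sub]
    ring

theorem taylorCoeff_one_sub_cpow (a : ℂ) (k : ℕ) :
    taylorCoeff (fun s : ℂ => (1 - s) ^ a) k =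
      rising (fun x => x) (-a) k / factorialOf (fun x => x) k := by
  have h : ((k.factorial : ℕ) : ℂ) = factorialOf (fun x => x) k := by
    rw [factorialOf, ← Finset.prod_range_add_one_eq_factorial]
    push_cast
    rfl
  rw [taylorCoeff, (iteratedDeriv_one_sub_cpow a k).self_of_nhds, h]
  simp

/-- Moving the coefficient to the left of `z⁻ᵃ` translates the Euler eigenvalue by `a`. -/
theorem W_eq (j : Fin 3) (a : ℂ) : W j a = ShiftSeries.mono (Pi.single j a)
    ((fun x => Complex.Gamma (x j + 1 + a) / Complex.Gamma (x j + 1) : X → ℂ) : Coef) := by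
  rw [W, monomial, ShiftSeries.translation_eq, ShiftSeries.ofFun_eq, ShiftSeries.mono_mul_mono]
  congr 1
  · rw [Pi.single_neg, neg_neg, add_zero]
  · rw [one_mul, Coef.shift_coe]
    congr 1
    funext x
    simp only [Pi.add_apply, Pi.single_neg, neg_neg, Pi.single_eq_same]
    rw [show x j + a + 1 - a = x j + 1 by ring, show x j + a + 1 = x j + 1 + a by ring]

theorem V_eq (i : Fin 2) (a : ℂ) : V i a = ShiftSeries.powerSeries (-(Pi.single i.succ a)) i
    fun k => ((fun _ => rising (fun x => x) (-a) k / factorialOf (fun x => x) k : X → ℂ) :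
      Coef) := by
  rw [V, ShiftSeries.power_eq]
  simp only [taylorCoeff_one_sub_cpow]

theorem isGammaAt_Gamma {c : ℂ} (hc : c ∉ Set.range ((↑) : ℤ → ℂ)) :
    IsGammaAt (fun x => x) Complex.Gamma c := by
  have h : ∀ i : ℤ, c + i ∉ Set.range ((↑) : ℤ → ℂ) := by
    rintro i ⟨m, hm⟩
    exact hc ⟨m - i, by push_cast; rw [hm]; ring⟩
  intro i
  have h0 : c + i ≠ 0 := fun h0 => h i ⟨0, by rw [h0]; simp⟩
  refine ⟨Complex.Gamma_add_one _ h0, Complex.Gamma_ne_zero fun m hm => h i ⟨-m, ?_⟩, h0⟩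
  rw [hm]
  simp

theorem ae_isGammaAt (j : Fin 3) (c : ℂ) :
    ∀ᵐ x : X, IsGammaAt (fun x => x) Complex.Gamma (x j + 1 + c) := by
  filter_upwards [ae_notMem_of_countable₁ (Set.countable_range ((↑) : ℤ → ℂ)) j one_ne_zero
    (1 + c)] with x hx
  rw [one_mul, ← add_assoc] at hx
  exact isGammaAt_Gamma hx

theorem W_mul_neg (j : Fin 3) (a : ℂ) : W j (-a) * W j a = 1 := by
  rw [W_eq, W_eq, ShiftSeries.mono_mul_mono, ShiftSeries.one_eq]
  congr 1
  · rw [← Pi.single_add, neg_add_cancel, Pi.single_zero]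
  · have h : ∀ᵐ x : X, Complex.Gamma (x j + 1 + -a) / Complex.Gamma (x j + 1) *
        (Complex.Gamma (x j + -a + 1 + a) / Complex.Gamma (x j + -a + 1)) = 1 := by
      filter_upwards [ae_isGammaAt j 0, ae_isGammaAt j (-a)] with x h0 h1
      have h0 := h0.ne_zero (x j + 1) 0 (by simp)
      have h1 := h1.ne_zero (x j + 1 + -a) 0 (by simp)
      rw [show x j + -a + 1 + a = x j + 1 by ring, show x j + -a + 1 = x j + 1 + -a by ring]
      field_simp
    rw [Coef.shift_coe]
    simp only [Pi.add_apply, Pi.single_eq_same]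
    exact Filter.Germ.coe_eq.2 h

theorem W_zero (j : Fin 3) : W j 0 = 1 := by
  rw [W_eq, ShiftSeries.one_eq, Pi.single_zero]
  congr 1
  refine Filter.Germ.coe_eq.2 ?_
  filter_upwards [ae_isGammaAt j 0] with x h0
  rw [add_zero] at h0 ⊢
  exact div_self (h0.ne_zero _ 0 (by simp))

theorem V_zero (i : Fin 2) : V i 0 = 1 := by
  rw [V_eq, ShiftSeries.one_eq, Pi.single_zero, neg_zero]
  ext1
  · rfl
  · ext1 n
    simp only [ShiftSeries.powerSeries, ShiftSeries.mono]
    by_cases h : n = 0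
    · subst h
      simp
      rfl
    · rw [if_neg h]
      by_cases h2 : n = Finsupp.single i (n i)
      · rw [if_pos h2]
        obtain ⟨m, hm⟩ : ∃ m, n i = m + 1 := Nat.exists_eq_succ_of_ne_zero fun h0 => h (by
          rw [h2, h0, Finsupp.single_zero])
        rw [hm]
        simp [rising_succ']
        rfl
      · rw [if_neg h2]

theorem natCast_ne_zero (k : ℕ) (hk : 0 < k) : (fun x : ℂ => x) k ≠ 0 :=
  Nat.cast_ne_zero.2 hk.ne'

/-- Each power of `z_i/z_{i+1}` lowers the eigenvalue of the left variable by one, so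
`gammaSum_down` applies with `e = 1` and `y` that eigenvalue plus one. -/
theorem braid_left (i : Fin 2) (a b : ℂ) :
    V i b * W i.castSucc (a + b) * V i a = W i.castSucc a * V i (a + b) * W i.castSucc b := by
  refine ShiftSeries.braid_of_ae (V_eq i) (W_eq i.castSucc) (fun a b => ?_) (fun a b => ?_) a b
    fun n => ?_
  · rw [Pi.single_add, neg_add]
  · rw [Pi.single_add]
  · filter_upwards [ae_isGammaAt i.castSucc 0, ae_isGammaAt i.castSucc (a + b),
      ae_isGammaAt i.castSucc a] with x h1 h2 h3
    have key := gammaSum_down (σ := fun x => x) (e := fun _ => 1) rfl (by simp) (by simp)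
      natCast_ne_zero (by simpa using h1) (by simpa [add_assoc] using h2) h3 n
    have hij : i.castSucc ≠ i.succ := by simp [Fin.ext_iff]
    simp only [Pi.add_apply, Pi.neg_apply, Pi.smul_apply, dir, Pi.single_eq_same, Pi.sub_apply,
      Pi.single_eq_of_ne hij, smul_eq_mul]
    calc _ = _ := Finset.sum_congr rfl fun p _ => ?_
      _ = _ := key
      _ = _ := ?_
    · ring_nf
    · ring_nf

/-- The eigenvalue of the right variable is raised by each power and lowered by `b` through the
leading monomial, hence `gammaSum_up`. -/
theorem braid_right (i : Fin 2) (a b : ℂ) :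
    V i b * W i.succ (a + b) * V i a = W i.succ a * V i (a + b) * W i.succ b := by
  refine ShiftSeries.braid_of_ae (V_eq i) (W_eq i.succ) (fun a b => ?_) (fun a b => ?_) a b
    fun n => ?_
  · rw [Pi.single_add, neg_add]
  · rw [Pi.single_add]
  · filter_upwards [ae_isGammaAt i.succ 0, ae_isGammaAt i.succ a,
      ae_isGammaAt i.succ (-b)] with x h1 h2 h3
    have key := gammaSum_up (σ := fun x => x) (e := fun _ => 1) rfl (by simp) (by simp)
      natCast_ne_zero (by simpa using h1) h2 (by simpa [sub_eq_add_neg] using h3) n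
    have hij : i.succ ≠ i.castSucc := by simp [Fin.ext_iff]
    simp only [Pi.add_apply, Pi.neg_apply, Pi.smul_apply, dir, Pi.single_eq_same, Pi.sub_apply,
      Pi.single_eq_of_ne hij, smul_eq_mul]
    calc _ = _ := Finset.sum_congr rfl fun p _ => ?_
      _ = _ := key
      _ = _ := ?_
    · ring_nf
    · ring_nf

theorem factorRelations : FactorRelations S := by
  -- The coefficients of `V` are constants. This makes `V 0` and `V 1` commute although both move
  -- the middle variable.
  have hV : ∀ i a, (V i a).IsLocal {i.castSucc, i.succ} ∅ := fun i a => by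
    rw [V_eq]
    refine ShiftSeries.isLocal_powerSeries (fun k hk => ?_) (fun k hk => ?_) fun _ _ _ _ => rfl
    · rw [Set.mem_insert_iff, Set.mem_singleton_iff, not_or] at hk
      simp [Pi.single_eq_of_ne hk.2]
    · rw [Set.mem_insert_iff, Set.mem_singleton_iff, not_or] at hk
      simp [dir, Pi.single_eq_of_ne hk.2, Pi.single_eq_of_ne hk.1]
  refine ShiftSeries.factorRelations_of_local (fun j a => ?_)
    (fun i a => (hV i a).mono' subset_rfl (Set.empty_subset _))
    (fun a b => (hV 0 a).comm (hV 1 b) (Set.disjoint_empty _) (Set.disjoint_empty _))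
    W_zero V_zero (Or.inl W_mul_neg) braid_left braid_right
  rw [W_eq]
  refine ShiftSeries.isLocal_mono (fun k hk => by simp [show k ≠ j from hk])
    fun w x hw => ?_
  rw [Pi.add_apply, hw j rfl, add_zero]

end Undeformed

/-! ### Taylor coefficients -/

theorem taylorCoeff_comp_mul (F : ℂ → ℂ) (c : ℂ) (k : ℕ) :
    taylorCoeff (fun s => F (c * s)) k = c ^ k * taylorCoeff F k := by
  have h : ∀ k : ℕ, iteratedDeriv k (fun s => F (c * s)) =
      fun s => c ^ k * iteratedDeriv k F (c * s) := by
    intro k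
    induction k with
    | zero => simp
    | succ k ih =>
      funext s
      rw [iteratedDeriv_succ, ih, iteratedDeriv_succ, deriv_const_mul_field,
        deriv_comp_mul_left c (iteratedDeriv k F) s, pow_succ, smul_eq_mul]
      ring
  rw [taylorCoeff, h, taylorCoeff]
  simp only [mul_zero]
  ring

/-- In Leibniz' formula only the derivatives of order 0 and 1 of the linear factor survive at 0. -/
theorem taylorCoeff_one_sub_mul {F : ℂ → ℂ} (hF : AnalyticAt ℂ F 0) (c : ℂ) (k : ℕ) :
    taylorCoeff (fun s => (1 - c * s) * F s) (k + 1) =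
      taylorCoeff F (k + 1) - c * taylorCoeff F k := by
  have h1 : ContDiffAt ℂ (k + 1 : ℕ) (fun s : ℂ => 1 - c * s) 0 := by fun_prop
  have h2 : ContDiffAt ℂ (k + 1 : ℕ) F 0 := hF.contDiffAt
  have h3 : ∀ j, iteratedDeriv (j + 2) (fun s : ℂ => 1 - c * s) 0 = 0 := by
    intro j
    have e1 : deriv (fun s : ℂ => 1 - c * s) = fun _ => -c := by
      funext s
      simp [deriv_const_sub]
    rw [iteratedDeriv_succ', e1, iteratedDeriv_succ', deriv_const']
    simp
  have h4 : iteratedDeriv 1 (fun s : ℂ => 1 - c * s) 0 = -c := by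
    rw [iteratedDeriv_one]
    simp [deriv_const_sub]
  have hk : ((k.factorial : ℕ) : ℂ) ≠ 0 := Nat.cast_ne_zero.2 k.factorial_ne_zero
  have hk1 : (k : ℂ) + 1 ≠ 0 := by exact_mod_cast k.succ_ne_zero
  rw [taylorCoeff, iteratedDeriv_fun_mul h1 h2, Finset.sum_range_succ', Finset.sum_range_succ',
    Finset.sum_eq_zero fun j _ => by rw [h3]; simp, taylorCoeff, taylorCoeff, h4,
    Nat.factorial_succ]
  simp
  field_simp
  ring

/-! ### Quantum deformation -/

namespace Quantum

theorem norm_qpow_two_lt_one {h : ℂ} (hh : h.re < 0) : ‖qpow h 2‖ < 1 := by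
  rw [qpow, Complex.norm_exp, Real.exp_lt_one_iff]
  simp
  linarith

theorem qpow_add (h a b : ℂ) : qpow h (a + b) = qpow h a * qpow h b := by
  rw [qpow, add_mul, Complex.exp_add]; rfl

theorem qpow_zero (h : ℂ) : qpow h 0 = 1 := by simp [qpow]

theorem qpow_two_mul (h : ℂ) (k : ℕ) : qpow h (2 * k) = qpow h 2 ^ k := by
  rw [qpow, qpow, ← Complex.exp_nat_mul]
  ring_nf

theorem summable_norm {h : ℂ} (hh : h.re < 0) (y : ℂ) :
    Summable fun k : ℕ => ‖-(y * qpow h (2 * k))‖ := by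
  simp only [norm_neg, norm_mul, qpow_two_mul, norm_pow]
  exact (summable_geometric_of_lt_one (norm_nonneg _) (norm_qpow_two_lt_one hh)).mul_left _

theorem poch_eq {h : ℂ} (hh : h.re < 0) (y : ℂ) :
    poch h y = (1 - y) * poch h (qpow h 2 * y) := by
  have hm : Multipliable fun k : ℕ => 1 - qpow h 2 * y * qpow h (2 * k) := by
    simpa only [sub_eq_add_neg] using multipliable_one_add_of_summable (summable_norm hh _)
  have hs : ∀ k : ℕ, 1 - qpow h 2 * y * qpow h (2 * k) = 1 - y * qpow h (2 * (k + 1 : ℕ)) := by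
    intro k
    rw [show (2 : ℂ) * (k + 1 : ℕ) = 2 + 2 * k by push_cast; ring, qpow_add]
    ring
  rw [poch, poch, tprod_eq_zero_mul' (by simpa only [hs] using hm)]
  simp only [hs]
  simp [qpow_zero]

theorem poch_ne_zero {h : ℂ} (hh : h.re < 0) {y : ℂ} (hy : ∀ k : ℕ, y * qpow h (2 * k) ≠ 1) :
    poch h y ≠ 0 := by
  have := tprod_one_add_ne_zero_of_summable (f := fun k : ℕ => -(y * qpow h (2 * k)))
    (fun k hk => hy k (by linear_combination -hk)) (summable_norm hh y)
  simpa only [poch, sub_eq_add_neg] using this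

theorem poch_zero (h : ℂ) : poch h 0 = 1 := by simp [poch]

/-- On a ball about 0 the factors are dominated by a geometric series, so the product converges
locally uniformly there. -/
theorem differentiable_poch {h : ℂ} (hh : h.re < 0) : Differentiable ℂ (poch h) := by
  intro z
  have hz : z ∈ Metric.ball (0 : ℂ) (‖z‖ + 1) := by simp
  have hu : Summable fun k : ℕ => (‖z‖ + 1) * ‖qpow h 2‖ ^ k :=
    (summable_geometric_of_lt_one (norm_nonneg _) (norm_qpow_two_lt_one hh)).mul_left _
  have key := Summable.hasProdLocallyUniformlyOn_nat_one_add
    (f := fun (k : ℕ) (y : ℂ) => -(y * qpow h (2 * k))) (Metric.isOpen_ball (x := (0 : ℂ))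
      (ε := ‖z‖ + 1)) hu (.of_forall fun k y hy => by
      rw [norm_neg, norm_mul, qpow_two_mul, norm_pow]
      gcongr
      simpa using (mem_ball_zero_iff.1 hy).le) (fun k => by fun_prop)
  have key2 : DifferentiableOn ℂ (fun y => ∏' k : ℕ, (1 + -(y * qpow h (2 * k))))
      (Metric.ball (0 : ℂ) (‖z‖ + 1)) :=
    key.differentiableOn (.of_forall fun _ ↦ by
      simpa [Finset.prod_fn] using DifferentiableOn.finsetProd (fun _ _ ↦ by fun_prop))
      Metric.isOpen_ball
  simp only [← sub_eq_add_neg] at key2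
  exact key2.differentiableAt (Metric.isOpen_ball.mem_nhds hz)

/-- The Taylor coefficients of the expansion of `W(a)`. -/
theorem taylorCoeff_poch_div {h : ℂ} (hh : h.re < 0) (a : ℂ) (k : ℕ) :
    taylorCoeff (fun s => poch h (qpow h (2 - 2 * a) * s) / poch h (qpow h 2 * s)) k =
      qpow h 2 ^ k * (rising (fun x => 1 - qpow h (2 * x)) (-a) k /
        factorialOf (fun x => 1 - qpow h (2 * x)) k) := by
  have hd := differentiable_poch hh
  have hc : ∀ᶠ s in nhds (0 : ℂ), poch h (qpow h 2 * s) ≠ 0 := by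
    have : ContinuousAt (fun s => poch h (qpow h 2 * s)) 0 :=
      (hd.continuous.comp (by fun_prop : Continuous fun s : ℂ => qpow h 2 * s)).continuousAt
    exact this.eventually_ne (by simp [poch_zero])
  have hF : AnalyticAt ℂ
      (fun s => poch h (qpow h (2 - 2 * a) * s) / poch h (qpow h 2 * s)) 0 := by
    refine AnalyticAt.div ?_ ?_ (by simp [poch_zero])
    · exact (hd.comp (by fun_prop : Differentiable ℂ fun s : ℂ => qpow h (2 - 2 * a) * s)).analyticAt
        0
    · exact (hd.comp (by fun_prop : Differentiable ℂ fun s : ℂ => qpow h 2 * s)).analyticAt 0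
  set F : ℂ → ℂ := fun s => poch h (qpow h (2 - 2 * a) * s) / poch h (qpow h 2 * s) with hFdef
  have hG : AnalyticAt ℂ (fun s => F (qpow h 2 * s)) 0 := by
    refine AnalyticAt.fun_comp ?_ (by fun_prop)
    simpa using hF
  -- The q-difference equation comes from removing the first factor of both infinite products. Its
  -- Taylor coefficients give a two-term recursion, as in the proof of the q-binomial theorem.
  have hfun : ∀ᶠ s in nhds (0 : ℂ), (1 - qpow h 2 * s) * F s =
      (1 - qpow h (2 - 2 * a) * s) * F (qpow h 2 * s) := by
    filter_upwards [hc] with s hs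
    have h1 := poch_eq hh (qpow h 2 * s)
    have h2 := poch_eq hh (qpow h (2 - 2 * a) * s)
    simp only [hFdef]
    rw [h1] at hs
    rw [h1, h2, show qpow h (2 - 2 * a) * (qpow h 2 * s) = qpow h 2 * (qpow h (2 - 2 * a) * s) by
      ring]
    have h3 := left_ne_zero_of_mul hs
    have h4 := right_ne_zero_of_mul hs
    field_simp
  have hrec : ∀ k, (1 - qpow h 2 ^ (k + 1)) * taylorCoeff F (k + 1) =
      (qpow h 2 - qpow h (2 - 2 * a) * qpow h 2 ^ k) * taylorCoeff F k := by
    intro k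
    have h1 := taylorCoeff_one_sub_mul hF (qpow h 2) k
    have h2 := taylorCoeff_one_sub_mul hG (qpow h (2 - 2 * a)) k
    rw [taylorCoeff_comp_mul, taylorCoeff_comp_mul] at h2
    have h3 : taylorCoeff (fun s => (1 - qpow h 2 * s) * F s) (k + 1) =
        taylorCoeff (fun s => (1 - qpow h (2 - 2 * a) * s) * F (qpow h 2 * s)) (k + 1) := by
      rw [taylorCoeff, taylorCoeff, Filter.EventuallyEq.iteratedDeriv_eq _ hfun]
    rw [h1, h2] at h3
    linear_combination h3
  have hk : ∀ k : ℕ, (1 : ℂ) - qpow h 2 ^ (k + 1) ≠ 0 := by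
    intro k hk
    have := pow_lt_one₀ (norm_nonneg _) (norm_qpow_two_lt_one hh) k.succ_ne_zero
    rw [← norm_pow, ← sub_eq_zero.1 hk, norm_one] at this
    exact lt_irrefl _ this
  induction k with
  | zero => simp [taylorCoeff, hFdef, poch_zero]
  | succ k ih =>
    have h1 := hrec k
    rw [ih] at h1
    refine mul_left_cancel₀ (hk k) (h1.trans ?_)
    have e1 : qpow h (2 * (k + 1)) = qpow h 2 ^ (k + 1) := by
      exact_mod_cast qpow_two_mul h (k + 1)
    have e2 : qpow h (2 - 2 * a) * qpow h 2 ^ k = qpow h 2 * qpow h (2 * (-a + k)) := by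
      rw [← qpow_two_mul, ← qpow_add, ← qpow_add]
      ring_nf
    rw [rising_succ, factorialOf_succ, e1, e2]
    have := hk k
    have h5 : factorialOf (fun x => 1 - qpow h (2 * x)) k ≠ 0 :=
      factorialOf_ne_zero _ (fun j hj => by
        obtain ⟨m, rfl⟩ := Nat.exists_eq_succ_of_ne_zero hj.ne'
        rw [qpow_two_mul]
        exact hk m) k
    field_simp
    ring

/-! ### The quantum operators in terms of a q-gamma function. -/

/-- The number `1 - q^(2x)`. -/
def qnum (h x : ℂ) : ℂ := 1 - qpow h (2 * x)

/-- The reciprocal of `(q^(2x); q²)`. -/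
def qgam (h x : ℂ) : ℂ := (poch h (qpow h (2 * x)))⁻¹

theorem qnum_natCast_ne_zero {h : ℂ} (hh : h.re < 0) (k : ℕ) (hk : 0 < k) : qnum h k ≠ 0 := by
  intro h0
  have := pow_lt_one₀ (norm_nonneg _) (norm_qpow_two_lt_one hh) hk.ne'
  rw [qnum, qpow_two_mul] at h0
  rw [← norm_pow, ← sub_eq_zero.1 h0, norm_one] at this
  exact lt_irrefl _ this

theorem qnum_add (h x y : ℂ) : qnum h (x + y) = qnum h x + qpow h (2 * x) * qnum h y := by
  rw [qnum, qnum, qnum, mul_add, qpow_add]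
  ring

/-- The points at which `1 - q^(2(x + k))` vanishes for some integer `k`. -/
def poles (h : ℂ) : Set ℂ :=
  Set.range fun p : ℤ × ℤ => p.1 * (2 * Real.pi * Complex.I) - 2 * h * p.2

theorem countable_poles (h : ℂ) : (poles h).Countable := Set.countable_range _

/-- Removing the first factor of the infinite product is the functional equation. Off `poles` no
factor vanishes, and a convergent product of this kind has no other zeros. -/
theorem isGammaAt_qgam {h : ℂ} (hh : h.re < 0) {c : ℂ} (hc : 2 * h * c ∉ poles h) :
    IsGammaAt (qnum h) (qgam h) c := by
  have h1 : ∀ i : ℤ, qpow h (2 * (c + i)) ≠ 1 := by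
    intro i hi
    rw [qpow, Complex.exp_eq_one_iff] at hi
    obtain ⟨m, hm⟩ := hi
    exact hc ⟨(m, i), by linear_combination -hm⟩
  have h2 : ∀ i : ℤ, poch h (qpow h (2 * (c + i))) ≠ 0 := fun i =>
    poch_ne_zero hh fun k hk => h1 (i + k) (by
      rw [← hk, ← qpow_add]
      push_cast
      ring_nf)
  intro i
  refine ⟨?_, inv_ne_zero (h2 i), fun h0 => h1 i (sub_eq_zero.1 h0).symm⟩
  have h3 := poch_eq hh (qpow h (2 * (c + i)))
  rw [← qpow_add, show 2 + 2 * (c + i) = 2 * (c + i + 1) by ring] at h3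
  have h4 := h2 i
  have h5 := h4
  rw [h3] at h5
  have h6 := left_ne_zero_of_mul h5
  rw [qgam, qgam, h3, qnum]
  field_simp

/-- The series of `W(a)`. -/
def coeffW (h : ℂ) (a : ℂ) (k : ℕ) (y : ℂ) : ℂ :=
  qpow h (a ^ 2 / 2) * Complex.exp (-a * y) *
    (qpow h 2 ^ k * (rising (qnum h) (-a) k / factorialOf (qnum h) k))

theorem W_eq {h : ℂ} (hh : h.re < 0) (j : Fin 3) (a : ℂ) :
    W h j a = ShiftSeries.powerSeries (Pi.single j (-a * h)) j
      fun k => ((fun x => coeffW h a k (x j) : X → ℂ) : Coef) := by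
  rw [W, ShiftSeries.power_eq]
  simp only [taylorCoeff_poch_div hh]
  rfl

/-- The function by which `V(a)` multiplies. -/
def factorV (h : ℂ) (a x y : ℂ) : ℂ :=
  Complex.exp (a * x) *
    (qgam h ((y - x) / (2 * h) + (1 + a) / 2) / qgam h ((y - x) / (2 * h) + (1 - a) / 2))

/-- Logarithms to base `q²` turn the products into gamma values at half-integrally shifted
arguments. The quotient is inverted because `qgam` is a reciprocal. -/
theorem V_eq {h : ℂ} (hh : h.re < 0) (i : Fin 2) (a : ℂ) :
    V h i a = ShiftSeries.mono 0
      ((fun x => factorV h a (x i.castSucc) (x i.succ) : X → ℂ) : Coef) := by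
  have h0 : h ≠ 0 := by
    rintro rfl
    simp at hh
  have key : ∀ z c : ℂ, Complex.exp z * qpow h (1 + c) = qpow h (2 * (z / (2 * h) + (1 + c) / 2)) :=
    fun z c => by
      rw [qpow, qpow, ← Complex.exp_add]
      congr 1
      field_simp
  rw [V, ShiftSeries.ofFun_eq]
  simp only [sub_eq_add_neg (1 : ℂ), key, factorV, qgam, inv_div_inv]

theorem ae_isGammaAt {h : ℂ} (hh : h.re < 0) (i : Fin 2) (c : ℂ) :
    ∀ᵐ x : X, IsGammaAt (qnum h) (qgam h) ((x i.succ - x i.castSucc) / (2 * h) + c) := by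
  have h0 : h ≠ 0 := by
    rintro rfl
    simp at hh
  filter_upwards [ae_notMem_of_countable₂ (countable_poles h) i (neg_ne_zero.2 one_ne_zero) 1
    (2 * h * c)] with x hx
  refine isGammaAt_qgam hh ?_
  rwa [show 2 * h * ((x i.succ - x i.castSucc) / (2 * h) + c) =
    -1 * x i.castSucc + 1 * x i.succ + 2 * h * c by field_simp; ring]

theorem V_mul_neg {h : ℂ} (hh : h.re < 0) (i : Fin 2) (a : ℂ) : V h i (-a) * V h i a = 1 := by
  rw [V_eq hh, V_eq hh, ShiftSeries.mono_mul_mono, ShiftSeries.one_eq, zero_add, Coef.zero_shift]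
  congr 1
  have : ∀ᵐ x : X, factorV h (-a) (x i.castSucc) (x i.succ) *
      factorV h a (x i.castSucc) (x i.succ) = 1 := by
    filter_upwards [ae_isGammaAt hh i ((1 + a) / 2), ae_isGammaAt hh i ((1 - a) / 2)] with x h1 h2
    have h1 := h1.ne_zero _ 0 (by simp; rfl)
    have h2 := h2.ne_zero _ 0 (by simp; rfl)
    rw [factorV, factorV, sub_neg_eq_add, ← sub_eq_add_neg, mul_mul_mul_comm, ← Complex.exp_add,
      div_mul_div_cancel₀ h1, div_self h2, neg_mul, neg_add_cancel, Complex.exp_zero, one_mul]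
  exact Filter.Germ.coe_eq.2 this

theorem V_zero {h : ℂ} (hh : h.re < 0) (i : Fin 2) : V h i 0 = 1 := by
  rw [V_eq hh, ShiftSeries.one_eq]
  congr 1
  have : ∀ᵐ x : X, factorV h 0 (x i.castSucc) (x i.succ) = 1 := by
    filter_upwards [ae_isGammaAt hh i (1 / 2)] with x h1
    have h1 := h1.ne_zero _ 0 (by rw [Int.cast_zero, add_zero])
    rw [factorV, add_zero, sub_zero, div_self h1]
    simp
  exact Filter.Germ.coe_eq.2 this

theorem W_zero {h : ℂ} (hh : h.re < 0) (j : Fin 3) : W h j 0 = 1 := by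
  rw [W_eq hh, ShiftSeries.one_eq, neg_zero, zero_mul, Pi.single_zero]
  ext1
  · rfl
  · ext1 n
    simp only [ShiftSeries.powerSeries, ShiftSeries.mono, coeffW]
    by_cases h : n = 0
    · subst h
      simp [qpow_zero]
      rfl
    · rw [if_neg h]
      by_cases h2 : n = Finsupp.single j (n j)
      · rw [if_pos h2]
        obtain ⟨m, hm⟩ : ∃ m, n j = m + 1 := Nat.exists_eq_succ_of_ne_zero fun h0 => h (by
          rw [h2, h0, Finsupp.single_zero])
        rw [hm]
        simp [rising_succ', qnum, qpow_zero]
        rfl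
      · rw [if_neg h2]

/-- The dilatation of the left variable lowers `t` by one per order, hence `gammaSum_down` at `t +
(1 - a) / 2`. -/
theorem braid_left {h : ℂ} (hh : h.re < 0) (i : Fin 2) (a b : ℂ) :
    W h i.castSucc b * V h i (a + b) * W h i.castSucc a =
      V h i a * W h i.castSucc (a + b) * V h i b := by
  have h0 : h ≠ 0 := by
    rintro rfl
    simp at hh
  refine ShiftSeries.braid_of_ae (w := fun _ => 0) (W_eq hh i.castSucc) (V_eq hh i)
    (fun a b => ?_) (fun a b => (add_zero _).symm) a b fun n => ?_
  · rw [← Pi.single_add]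
    congr 1
    ring
  · filter_upwards [ae_isGammaAt hh i ((1 - a) / 2), ae_isGammaAt hh i ((1 + a) / 2 + b),
      ae_isGammaAt hh i ((1 + a) / 2)] with x h1 h2 h3
    have hij : i.succ ≠ i.castSucc := by simp [Fin.ext_iff]
    simp only [Pi.add_apply, Pi.zero_apply, Pi.smul_apply, dir, Pi.single_eq_same,
      Pi.single_eq_of_ne hij, smul_eq_mul, mul_zero, add_zero, zero_add]
    set x₁ := x i.castSucc
    set x₂ := x i.succ
    set t := (x₂ - x₁) / (2 * h) with ht
    have key := gammaSum_down (e := fun x => qpow h (2 * x)) (by simp [qpow_zero])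
      (fun x y => by rw [mul_add, qpow_add]) (qnum_add h) (qnum_natCast_ne_zero hh) h1
      (a := a) (b := b) (by convert h2 using 1; ring) (by convert h3 using 1; ring) n
    -- The constant is what remains of all powers of `q` and `z`: the powers of `z` cancel, and the
    -- only dependence on the summation index is the weight `q^(2b)` to the power `p.1`.
    have hk := congrArg (fun z => qpow h ((a ^ 2 - b ^ 2) / 2 + 2 * n) * z) key
    simp only [Finset.mul_sum] at hk
    refine (Finset.sum_congr rfl fun p hp => ?_).trans (hk.trans ?_)
    · have hp : (p.1 : ℂ) + p.2 = n := by
        exact_mod_cast Finset.HasAntidiagonal.mem_antidiagonal.1 hp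
      have e1 : (x₂ - (x₁ + (-b * h + p.1 * (2 * h)))) / (2 * h) = t + b / 2 - p.1 := by
        rw [ht]; field_simp; ring
      have e2 : qpow h (b ^ 2 / 2) * Complex.exp (-b * x₁) * qpow h 2 ^ p.1 *
          Complex.exp ((a + b) * (x₁ + (-b * h + p.1 * (2 * h)))) *
          (qpow h (a ^ 2 / 2) * Complex.exp (-a * (x₁ + (-b * h + p.1 * (2 * h)))) *
            qpow h 2 ^ p.2) =
          qpow h ((a ^ 2 - b ^ 2) / 2 + 2 * n) * qpow h (2 * b) ^ p.1 := by
        simp only [qpow, ← Complex.exp_nat_mul, ← Complex.exp_add]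
        congr 1
        rw [← hp]
        ring
      simp only [coeffW, factorV, e1]
      rw [show t + b / 2 - p.1 + (1 + (a + b)) / 2 = t + (1 - a) / 2 - p.1 + a + b by ring,
        show t + b / 2 - p.1 + (1 - (a + b)) / 2 = t + (1 - a) / 2 - p.1 by ring]
      linear_combination (rising (qnum h) (-b) p.1 / factorialOf (qnum h) p.1 *
        (rising (qnum h) (-a) p.2 / factorialOf (qnum h) p.2) *
        (qgam h (t + (1 - a) / 2 - p.1 + a + b) / qgam h (t + (1 - a) / 2 - p.1))) * e2
    · have e1 : (x₂ - (x₁ + (-(a + b) * h + n * (2 * h)))) / (2 * h) = t + (a + b) / 2 - n := by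
        rw [ht]; field_simp; ring
      have e2 : Complex.exp (a * x₁) * (qpow h ((a + b) ^ 2 / 2) * Complex.exp (-(a + b) * x₁) *
          qpow h 2 ^ n) * Complex.exp (b * (x₁ + (-(a + b) * h + n * (2 * h)))) =
          qpow h ((a ^ 2 - b ^ 2) / 2 + 2 * n) * qpow h (2 * b) ^ n := by
        simp only [qpow, ← Complex.exp_nat_mul, ← Complex.exp_add]
        congr 1
        ring
      simp only [coeffW, factorV, e1]
      rw [show t + (a + b) / 2 - n + (1 + b) / 2 = t + (1 - a) / 2 + a + b - n by ring,
        show t + (a + b) / 2 - n + (1 - b) / 2 = t + (1 - a) / 2 + a - n by ring,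
        ← ht, show t + (1 + a) / 2 = t + (1 - a) / 2 + a by ring]
      linear_combination -(rising (qnum h) (-(a + b)) n / factorialOf (qnum h) n *
        (qgam h (t + (1 - a) / 2 + a) / qgam h (t + (1 - a) / 2)) *
        (qgam h (t + (1 - a) / 2 + a + b - n) / qgam h (t + (1 - a) / 2 + a - n))) * e2

theorem braid_right {h : ℂ} (hh : h.re < 0) (i : Fin 2) (a b : ℂ) :
    W h i.succ b * V h i (a + b) * W h i.succ a = V h i a * W h i.succ (a + b) * V h i b := by
  have h0 : h ≠ 0 := by
    rintro rfl
    simp at hh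
  refine ShiftSeries.braid_of_ae (w := fun _ => 0) (W_eq hh i.succ) (V_eq hh i)
    (fun a b => ?_) (fun a b => (add_zero _).symm) a b fun n => ?_
  · rw [← Pi.single_add]
    congr 1
    ring
  · filter_upwards [ae_isGammaAt hh i ((1 - a) / 2), ae_isGammaAt hh i ((1 - a) / 2 - b),
      ae_isGammaAt hh i ((1 + a) / 2)] with x h1 h2 h3
    have hij : i.castSucc ≠ i.succ := by simp [Fin.ext_iff]
    simp only [Pi.add_apply, Pi.zero_apply, Pi.smul_apply, dir, Pi.single_eq_same,
      Pi.single_eq_of_ne hij, smul_eq_mul, mul_zero, add_zero, zero_add]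
    set x₁ := x i.castSucc
    set x₂ := x i.succ
    set t := (x₂ - x₁) / (2 * h) with ht
    have key := gammaSum_up (e := fun x => qpow h (2 * x)) (by simp [qpow_zero])
      (fun x y => by rw [mul_add, qpow_add]) (qnum_add h) (qnum_natCast_ne_zero hh) h1
      (a := a) (b := b) (by convert h3 using 1; ring) (by convert h2 using 1; ring) n
    -- Here the series acts on the right variable and `V` carries a power of the left one, so the
    -- monomials combine into a power of `z_i/z_{i+1}` and do not cancel.
    have hk := congrArg (fun z => qpow h ((a + b) ^ 2 / 2 + 2 * n) *
      Complex.exp ((a + b) * (x₁ - x₂)) * z) key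
    simp only [Finset.mul_sum] at hk
    refine (Finset.sum_congr rfl fun p hp => ?_).trans (hk.trans ?_)
    · have hp : (p.1 : ℂ) + p.2 = n := by
        exact_mod_cast Finset.HasAntidiagonal.mem_antidiagonal.1 hp
      have e1 : (x₂ + (-b * h + p.1 * (2 * h)) - x₁) / (2 * h) = t - b / 2 + p.1 := by
        rw [ht]; field_simp; ring
      have e2 : qpow h (b ^ 2 / 2) * Complex.exp (-b * x₂) * qpow h 2 ^ p.1 *
          Complex.exp ((a + b) * x₁) *
          (qpow h (a ^ 2 / 2) * Complex.exp (-a * (x₂ + (-b * h + p.1 * (2 * h)))) *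
            qpow h 2 ^ p.2) =
          qpow h ((a + b) ^ 2 / 2 + 2 * n) * Complex.exp ((a + b) * (x₁ - x₂)) *
            qpow h (2 * -a) ^ p.1 := by
        simp only [qpow, ← Complex.exp_nat_mul, ← Complex.exp_add]
        congr 1
        rw [← hp]
        ring
      simp only [coeffW, factorV, e1]
      rw [show t - b / 2 + p.1 + (1 + (a + b)) / 2 = t + (1 - a) / 2 + a + p.1 by ring,
        show t - b / 2 + p.1 + (1 - (a + b)) / 2 = t + (1 - a) / 2 - b + p.1 by ring]
      linear_combination (rising (qnum h) (-b) p.1 / factorialOf (qnum h) p.1 *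
        (rising (qnum h) (-a) p.2 / factorialOf (qnum h) p.2) *
        (qgam h (t + (1 - a) / 2 + a + p.1) / qgam h (t + (1 - a) / 2 - b + p.1))) * e2
    · have e1 : (x₂ + (-(a + b) * h + n * (2 * h)) - x₁) / (2 * h) = t - (a + b) / 2 + n := by
        rw [ht]; field_simp; ring
      have e2 : Complex.exp (a * x₁) * (qpow h ((a + b) ^ 2 / 2) * Complex.exp (-(a + b) * x₂) *
          qpow h 2 ^ n) * Complex.exp (b * x₁) =
          qpow h ((a + b) ^ 2 / 2 + 2 * n) * Complex.exp ((a + b) * (x₁ - x₂)) := by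
        simp only [qpow, ← Complex.exp_nat_mul, ← Complex.exp_add]
        congr 1
        ring
      simp only [coeffW, factorV, e1]
      rw [show t - (a + b) / 2 + n + (1 + b) / 2 = t + (1 - a) / 2 + n by ring,
        show t - (a + b) / 2 + n + (1 - b) / 2 = t + (1 - a) / 2 - b + n by ring,
        ← ht, show t + (1 + a) / 2 = t + (1 - a) / 2 + a by ring]
      linear_combination -(rising (qnum h) (-(a + b)) n / factorialOf (qnum h) n *
        (qgam h (t + (1 - a) / 2 + a) / qgam h (t + (1 - a) / 2)) *
        (qgam h (t + (1 - a) / 2 + n) / qgam h (t + (1 - a) / 2 - b + n))) * e2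

theorem factorRelations {h : ℂ} (hh : h.re < 0) : FactorRelations (S h) := by
  have hV : ∀ i a, (V h i a).IsLocal ∅ {i.castSucc, i.succ} := fun i a => by
    rw [V_eq hh]
    refine ShiftSeries.isLocal_mono (fun k hk => rfl) fun w x hw => ?_
    rw [Pi.add_apply, Pi.add_apply, hw _ (Set.mem_insert _ _),
      hw _ (Set.mem_insert_of_mem _ rfl), add_zero, add_zero]
  refine ShiftSeries.factorRelations_of_local (fun j a => ?_)
    (fun i a => (hV i a).mono' (Set.empty_subset _) subset_rfl)
    (fun a b => (hV 0 a).comm (hV 1 b) (Set.empty_disjoint _) (Set.empty_disjoint _))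
    (W_zero hh) (V_zero hh) (Or.inr (V_mul_neg hh)) (fun i a b => ?_) (fun i a b => ?_)
  · rw [W_eq hh]
    refine ShiftSeries.isLocal_powerSeries (fun k hk => by simp [show k ≠ j from hk])
      (fun k hk => by simp [dir, show k ≠ j from hk]) fun k w x hw => ?_
    rw [Pi.add_apply, hw j rfl, add_zero]
  · have := braid_left hh i b a
    rw [add_comm b a] at this
    exact this.symm
  · have := braid_right hh i b a
    rw [add_comm b a] at this
    exact this.symm

end Quantum

/-! ### The theta function -/

namespace Elliptic

open Complex in
-- The index is shifted by one so that the argument `z + 1 / 2 - τ / 2` agrees with the one in the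
-- triple product.
theorem theta1_term_eq (z τ : ℂ) (n : ℤ) :
    exp (Real.pi * I * ((n : ℂ) + 1 / 2) ^ 2 * τ) *
        exp (2 * Real.pi * I * ((n : ℂ) + 1 / 2) * (z + 1 / 2)) =
      exp (Real.pi * I * (τ / 4 - z - 1 / 2)) * jacobiTheta₂_term (n + 1) (z + 1 / 2 - τ / 2) τ := by
  rw [jacobiTheta₂_term, ← exp_add, ← exp_add]
  congr 1
  push_cast
  ring

theorem theta1_eq_jacobiTheta₂ (z τ : ℂ) :
    theta1 z τ = Complex.exp (Real.pi * Complex.I * (τ / 4 - z - 1 / 2)) *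
      jacobiTheta₂ (z + 1 / 2 - τ / 2) τ := by
  rw [theta1, jacobiTheta₂, ← tsum_mul_left, ← (Equiv.addRight (1 : ℤ)).tsum_eq fun n =>
    _ * jacobiTheta₂_term n _ _]
  exact tsum_congr (theta1_term_eq z τ)

open Complex in
theorem hasSum_theta1 (z : ℂ) {τ : ℂ} (hτ : 0 < τ.im) :
    HasSum (fun n : ℤ => exp (Real.pi * I * ((n : ℂ) + 1 / 2) ^ 2 * τ) *
      exp (2 * Real.pi * I * ((n : ℂ) + 1 / 2) * (z + 1 / 2))) (theta1 z τ) := by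
  simp only [theta1_term_eq]
  rw [theta1_eq_jacobiTheta₂]
  exact HasSum.mul_left _ ((Equiv.addRight (1 : ℤ)).hasSum_iff.2 (hasSum_jacobiTheta₂_term _ hτ))

theorem theta1_neg (z τ : ℂ) : theta1 (-z) τ = -theta1 z τ := by
  -- The substitution `n ↦ -1 - n` changes the sign of `n + 1/2`; the half period in the exponent
  -- then accounts for the minus sign.
  rw [theta1, theta1, ← tsum_neg, ← (Equiv.subLeft (-1 : ℤ)).tsum_eq]
  refine tsum_congr fun n => ?_
  rw [← Complex.exp_add, ← Complex.exp_add, ← mul_neg_one (Complex.exp _),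
    ← Complex.exp_pi_mul_I, ← Complex.exp_add, Complex.exp_eq_exp_iff_exists_int]
  refine ⟨-n - 1, ?_⟩
  simp only [Equiv.subLeft_apply]
  push_cast
  ring

theorem isCompl_range_parity :
    IsCompl (Set.range fun p : ℤ × ℤ => (p.1 + p.2, p.1 - p.2 - 1))
      (Set.range fun p : ℤ × ℤ => (p.1 + p.2, p.1 - p.2)) := by
  refine ⟨Set.disjoint_left.2 ?_, codisjoint_iff_le_sup.2 ?_⟩
  · rintro _ ⟨⟨a, b⟩, rfl⟩ ⟨⟨c, d⟩, h⟩
    simp only [Prod.mk.injEq] at h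
    omega
  · rintro ⟨n, k⟩ -
    rcases Int.even_or_odd' (n + k) with ⟨m, h | h⟩
    · exact Or.inr ⟨(m, n - m), by simp only [Prod.mk.injEq]; omega⟩
    · exact Or.inl ⟨(m + 1, n - m - 1), by simp only [Prod.mk.injEq]; omega⟩

theorem hasSum_of_parity {f : ℤ × ℤ → ℂ} {s t : ℂ}
    (h1 : HasSum (fun p : ℤ × ℤ => f (p.1 + p.2, p.1 - p.2 - 1)) s)
    (h2 : HasSum (fun p : ℤ × ℤ => f (p.1 + p.2, p.1 - p.2)) t) : HasSum f (s + t) := by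
  have i1 : Function.Injective fun p : ℤ × ℤ => (p.1 + p.2, p.1 - p.2 - 1) := by
    rintro ⟨a, b⟩ ⟨c, d⟩ h
    simp only [Prod.mk.injEq] at h ⊢
    omega
  have i2 : Function.Injective fun p : ℤ × ℤ => (p.1 + p.2, p.1 - p.2) := by
    rintro ⟨a, b⟩ ⟨c, d⟩ h
    simp only [Prod.mk.injEq] at h ⊢
    omega
  exact HasSum.add_isCompl isCompl_range_parity (i1.hasSum_range_iff.2 h1)
    (i2.hasSum_range_iff.2 h2)

/-- The even part of the theta function of the doubled lattice. -/
def thetaEven (τ x : ℂ) : ℂ := jacobiTheta₂ (2 * x) (2 * τ)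

/-- The odd part of the theta function of the doubled lattice. -/
def thetaOdd (τ x : ℂ) : ℂ :=
  Complex.exp (Real.pi * Complex.I * (τ / 2 + 2 * x)) * jacobiTheta₂ (2 * x + τ) (2 * τ)

/-- In the double series over `(n, k)` the variable `x` has frequency `n + k + 1` and `y` has
frequency `n - k`. These have opposite parity, so splitting by the parity of `n + k` separates the
variables into two products. -/
theorem theta1_add_mul_theta1_sub (x y : ℂ) {τ : ℂ} (hτ : 0 < τ.im) :
    theta1 (x + y) τ * theta1 (x - y) τ =
      thetaEven τ x * thetaOdd τ y - thetaOdd τ x * thetaEven τ y := by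
  have hτ2 : 0 < (2 * τ).im := by simpa using hτ
  have hE : ∀ z, HasSum (fun n : ℤ => jacobiTheta₂_term n (2 * z) (2 * τ)) (thetaEven τ z) :=
    fun z => hasSum_jacobiTheta₂_term _ hτ2
  have hO : ∀ z, HasSum (fun n : ℤ => Complex.exp (Real.pi * Complex.I * (τ / 2 + 2 * z)) *
      jacobiTheta₂_term n (2 * z + τ) (2 * τ)) (thetaOdd τ z) :=
    fun z => (hasSum_jacobiTheta₂_term _ hτ2).mul_left _
  have hmul : ∀ {f g : ℤ → ℂ} {s t : ℂ}, HasSum f s → HasSum g t →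
      HasSum (fun p : ℤ × ℤ => f p.1 * g p.2) (s * t) := fun hf hg =>
    hf.mul hg (summable_mul_of_summable_norm hf.summable.norm hg.summable.norm)
  have h1 := hmul (hasSum_theta1 (x + y) hτ) (hasSum_theta1 (x - y) hτ)
  have h2 := hmul (hE x) (hO y)
  have h3 := (hmul (hO x) (hE y)).neg
  rw [sub_eq_add_neg (thetaEven τ x * _)]
  refine h1.unique (hasSum_of_parity ?_ ?_)
  · convert h2 using 1
    funext ⟨j, i⟩
    simp only [jacobiTheta₂_term, ← Complex.exp_add, Complex.exp_eq_exp_iff_exists_int]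
    refine ⟨j, ?_⟩
    push_cast
    ring
  · convert h3 using 1
    · rfl
    funext ⟨j, i⟩
    simp only [jacobiTheta₂_term]
    rw [← mul_neg_one (_ * _), ← Complex.exp_pi_mul_I]
    simp only [← Complex.exp_add, Complex.exp_eq_exp_iff_exists_int]
    refine ⟨j, ?_⟩
    push_cast
    ring

theorem num_neg (η τ x : ℂ) : num η τ (-x) = -num η τ x := by
  rw [num, num, mul_neg, theta1_neg]

/-- By `theta1_add_mul_theta1_sub` each product is a 2 × 2 minor formed from the vectors
(`thetaEven`, `thetaOdd`) at two points. The identity is the Plücker relation for four such vectors.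
-/
theorem num_three_term (η : ℂ) {τ : ℂ} (hτ : 0 < τ.im) (x y z w : ℂ) :
    num η τ (x + y) * num η τ (x - y) * (num η τ (z + w) * num η τ (z - w)) -
      num η τ (x + z) * num η τ (x - z) * (num η τ (y + w) * num η τ (y - w)) +
      num η τ (x + w) * num η τ (x - w) * (num η τ (y + z) * num η τ (y - z)) = 0 := by
  simp only [num, mul_add, mul_sub]
  simp only [theta1_add_mul_theta1_sub _ _ hτ]
  ring

end Elliptic

namespace Elliptic

/-! ### The triple product -/

/-- The exponential `e^(2πiz)`. -/
def ex (z : ℂ) : ℂ := Complex.exp (2 * Real.pi * Complex.I * z)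

theorem ex_add (z w : ℂ) : ex (z + w) = ex z * ex w := by
  rw [ex, mul_add, Complex.exp_add]; rfl

theorem ex_ne_zero (z : ℂ) : ex z ≠ 0 := Complex.exp_ne_zero _

theorem ex_nat_mul (k : ℕ) (z : ℂ) : ex (k * z) = ex z ^ k := by
  rw [ex, ex, ← Complex.exp_nat_mul]
  ring_nf

theorem norm_ex_lt_one {z : ℂ} (hz : 0 < z.im) : ‖ex z‖ < 1 := by
  rw [ex, Complex.norm_exp, Real.exp_lt_one_iff]
  simp only [Complex.mul_re, Complex.mul_im, Complex.re_ofNat, Complex.im_ofNat,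
    Complex.ofReal_re, Complex.ofReal_im, Complex.I_re, Complex.I_im]
  nlinarith [Real.pi_pos, mul_pos Real.pi_pos hz]

theorem ex_eq_one_iff {z : ℂ} : ex z = 1 ↔ ∃ m : ℤ, z = m := by
  rw [ex, Complex.exp_eq_one_iff]
  have h : (2 * Real.pi * Complex.I : ℂ) ≠ 0 := by simp [Real.pi_ne_zero]
  refine exists_congr fun m => ⟨fun hm => mul_left_cancel₀ h (hm.trans (mul_comm _ _)), fun hm => ?_⟩
  rw [hm, mul_comm]

/-- The finite product `(p; p)ₙ`, `p = e^(2πiτ)`. -/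
def eulerProd (τ : ℂ) (n : ℕ) : ℂ := ∏ i ∈ Finset.range n, (1 - ex ((i + 1) * τ))

theorem one_sub_ex_ne_zero {τ : ℂ} (hτ : 0 < τ.im) (n : ℕ) : 1 - ex ((n + 1) * τ) ≠ 0 := by
  intro h0
  have h := norm_ex_lt_one (z := (n + 1) * τ) (by
    have : ((n : ℂ) + 1) * τ = ((n + 1 : ℝ) : ℂ) * τ := by push_cast; ring
    rw [this, Complex.im_ofReal_mul]
    positivity)
  rw [← sub_eq_zero.1 h0, norm_one] at h
  exact lt_irrefl _ h

theorem eulerProd_ne_zero {τ : ℂ} (hτ : 0 < τ.im) (n : ℕ) : eulerProd τ n ≠ 0 :=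
  Finset.prod_ne_zero_iff.2 fun i _ => one_sub_ex_ne_zero hτ i

theorem eulerProd_succ (τ : ℂ) (n : ℕ) :
    eulerProd τ (n + 1) = eulerProd τ n * (1 - ex ((n + 1) * τ)) := Finset.prod_range_succ _ _

/-- The `q`-binomial theorem. -/
theorem eulerProd_binomial {τ : ℂ} (hτ : 0 < τ.im) (w : ℂ) (n : ℕ) :
    ∑ p ∈ Finset.HasAntidiagonal.antidiagonal n,
      ex (((p.1 : ℂ) ^ 2 - p.1) / 2 * τ + p.1 * w) / (eulerProd τ p.1 * eulerProd τ p.2) =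
      (∏ m ∈ Finset.range n, (1 + ex (m * τ + w))) / eulerProd τ n := by
  induction n with
  | zero => simp [eulerProd, ex]
  | succ n ih =>
    have hP := fun n => eulerProd_ne_zero hτ n
    have h1 := fun n => one_sub_ex_ne_zero hτ n
    set T : ℕ → ℕ → ℂ := fun k l =>
      ex (((k : ℂ) ^ 2 - k) / 2 * τ + k * w) / (eulerProd τ k * eulerProd τ l) with hT
    -- With `p = ex τ` and `k + l = n + 1`, the split is `1 - p^(n+1) = (1 - p^l) + p^l (1 - p^k)`.
    -- Each part vanishes at one end and cancels the last factor of one `eulerProd`.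
    set f : ℕ → ℕ → ℂ := fun k l => (1 - ex (l * τ)) * T k l with hf
    set g : ℕ → ℕ → ℂ := fun k l => ex (l * τ) * (1 - ex (k * τ)) * T k l with hg
    have hsum : ∑ p ∈ Finset.HasAntidiagonal.antidiagonal (n + 1), (1 - ex ((n + 1) * τ)) * T p.1 p.2 =
        ∑ p ∈ Finset.HasAntidiagonal.antidiagonal (n + 1), f p.1 p.2 +
          ∑ p ∈ Finset.HasAntidiagonal.antidiagonal (n + 1), g p.1 p.2 := by
      rw [← Finset.sum_add_distrib]
      refine Finset.sum_congr rfl fun p hp => ?_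
      have hp : (p.1 : ℂ) + p.2 = n + 1 := by
        exact_mod_cast Finset.HasAntidiagonal.mem_antidiagonal.1 hp
      rw [← hp, add_mul, ex_add]
      simp only [hf, hg]
      ring
    rw [← Finset.mul_sum, sum_antidiagonal_succ_of_right_zero (f := f) (by simp [f, ex]),
      sum_antidiagonal_succ_of_left_zero (f := g) (by simp [g, ex])] at hsum
    have e1 : ∀ p ∈ Finset.HasAntidiagonal.antidiagonal n, f p.1 (p.2 + 1) = T p.1 p.2 := by
      intro p _
      have := h1 p.2
      have := hP p.2
      have := hP p.1
      simp only [hf, hT, eulerProd_succ]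
      push_cast
      field_simp
    have e2 : ∀ p ∈ Finset.HasAntidiagonal.antidiagonal n,
        g (p.1 + 1) p.2 = ex (n * τ + w) * T p.1 p.2 := by
      intro p hp
      have hp : (n : ℂ) = p.1 + p.2 := by
        exact_mod_cast (Finset.HasAntidiagonal.mem_antidiagonal.1 hp).symm
      have h2 := h1 p.1
      have := hP p.2
      have := hP p.1
      have e3 : ex (n * τ + w) * ex (((p.1 : ℂ) ^ 2 - p.1) / 2 * τ + p.1 * w) =
          ex (p.2 * τ) * ex ((((p.1 : ℂ) + 1) ^ 2 - (p.1 + 1)) / 2 * τ + (p.1 + 1) * w) := by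
        rw [← ex_add, ← ex_add, hp]
        ring_nf
      simp only [hg, hT, eulerProd_succ]
      push_cast
      rw [← mul_div_assoc (ex (n * τ + w)), e3]
      generalize 1 - ex (((p.1 : ℂ) + 1) * τ) = c at h2 ⊢
      field_simp
    rw [Finset.sum_congr rfl e1, Finset.sum_congr rfl e2, ← Finset.mul_sum, ih] at hsum
    have := h1 n
    have := hP n
    refine mul_left_cancel₀ (h1 n) (hsum.trans ?_)
    rw [Finset.prod_range_succ, eulerProd_succ, ← mul_div_assoc (ex _), ← add_div,
      ← mul_div_assoc, mul_comm (eulerProd τ n), mul_div_mul_left _ _ (h1 n)]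
    ring

/-- A finite form of the triple product. -/
theorem finite_triple_product {τ : ℂ} (hτ : 0 < τ.im) (z : ℂ) (N : ℕ) :
    ∏ m ∈ Finset.range N, ((1 - ex (m * τ + z)) * (1 - ex (m * τ + (τ - z)))) =
      ∑' k : ℤ, if k.natAbs ≤ N then jacobiTheta₂_term k (z + 1 / 2 - τ / 2) τ *
        (eulerProd τ (2 * N) / (eulerProd τ (N + k).toNat * eulerProd τ (N - k).toNat)) else 0 := by
  -- The shift by `N * τ` centres the `2 * N` factors: the upper half gives the factors in `z`, the
  -- lower half, read backwards, those in `τ - z` up to an exponential. The half period supplies the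
  -- signs.
  have h := eulerProd_binomial hτ (z + 1 / 2 - N * τ) (2 * N)
  have hhalf : ∀ w, ex (w + 1 / 2) = -ex w := fun w => by
    rw [ex_add, ex, ex, show 2 * (Real.pi : ℂ) * Complex.I * (1 / 2) = Real.pi * Complex.I by ring,
      Complex.exp_pi_mul_I, mul_neg_one]
  have hprod : ∏ m ∈ Finset.range (2 * N), (1 + ex (m * τ + (z + 1 / 2 - N * τ))) =
      ex (N * (z + 1 / 2) - (N : ℂ) * (N + 1) / 2 * τ) *
      ∏ m ∈ Finset.range N, ((1 - ex (m * τ + z)) * (1 - ex (m * τ + (τ - z)))) := by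
    rw [two_mul, Finset.prod_range_add, Finset.prod_mul_distrib, mul_comm (∏ m ∈ _, (1 - _)),
      ← mul_assoc]
    congr 1
    · have : ∀ N : ℕ, ex (N * (z + 1 / 2) - (N : ℂ) * (N + 1) / 2 * τ) =
          ∏ m ∈ Finset.range N, ex (z + 1 / 2 - (m + 1) * τ) := by
        intro N
        induction N with
        | zero => simp [ex]
        | succ N ih =>
          rw [Finset.prod_range_succ, ← ih, ← ex_add]
          push_cast
          ring_nf
      rw [this, ← Finset.prod_mul_distrib, ← Finset.prod_range_reflect]
      refine Finset.prod_congr rfl fun m hm => ?_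
      have hm : m + 1 ≤ N := Finset.mem_range.1 hm
      have e0 : ((N - 1 - m : ℕ) : ℂ) = N - (m + 1) := by
        rw [Nat.sub_sub, Nat.cast_sub (by omega)]
        push_cast
        ring
      rw [e0, mul_sub, mul_one, ← ex_add,
        show (N - (m + 1) : ℂ) * τ + (z + 1 / 2 - N * τ) = z - (m + 1) * τ + 1 / 2 by ring,
        show z + 1 / 2 - (m + 1) * τ = z - (m + 1) * τ + 1 / 2 by ring,
        show z - (m + 1) * τ + 1 / 2 + (m * τ + (τ - z)) = 0 + 1 / 2 by ring, hhalf, hhalf]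
      simp [ex]
      ring
    · refine Finset.prod_congr rfl fun m _ => ?_
      rw [show ((N + m : ℕ) : ℂ) * τ + (z + 1 / 2 - N * τ) = m * τ + z + 1 / 2 by push_cast; ring,
        hhalf, sub_eq_add_neg]
  rw [hprod, eq_div_iff (eulerProd_ne_zero hτ _)] at h
  refine mul_left_cancel₀ (ex_ne_zero (N * (z + 1 / 2) - (N : ℂ) * (N + 1) / 2 * τ))
    (h.symm.trans ?_)
  rw [tsum_eq_sum (s := (Finset.HasAntidiagonal.antidiagonal (2 * N)).image
    fun p => (p.1 : ℤ) - N)]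
  · rw [Finset.sum_image, Finset.sum_mul, Finset.mul_sum]
    · refine Finset.sum_congr rfl fun p hp => ?_
      have hp := Finset.HasAntidiagonal.mem_antidiagonal.1 hp
      rw [if_pos (by omega), show ((N : ℤ) + (p.1 - N)).toNat = p.1 by omega,
        show ((N : ℤ) - (p.1 - N)).toNat = p.2 by omega, div_mul_eq_mul_div, mul_div_assoc,
        ← mul_assoc]
      congr 1
      rw [jacobiTheta₂_term, ex, ex, ← Complex.exp_add]
      congr 1
      push_cast
      ring
    · intro p hp q hq hpq
      have hp := Finset.HasAntidiagonal.mem_antidiagonal.1 hp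
      have hq := Finset.HasAntidiagonal.mem_antidiagonal.1 hq
      simp only at hpq
      ext <;> omega
  · intro k hk
    refine if_neg fun hN => hk (Finset.mem_image.2 ⟨((N + k).toNat, (N - k).toNat), ?_, ?_⟩)
    · rw [Finset.HasAntidiagonal.mem_antidiagonal]
      omega
    · simp only
      omega

/-- The infinite product `∏ (1 - e^(2πi(mτ + z)))`. -/
def pochE (τ z : ℂ) : ℂ := ∏' m : ℕ, (1 - ex (m * τ + z))

theorem summable_ex {τ : ℂ} (hτ : 0 < τ.im) (z : ℂ) :
    Summable fun m : ℕ => ‖-ex (m * τ + z)‖ := by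
  simp only [norm_neg, ex_add, ex_nat_mul, norm_mul, norm_pow]
  exact (summable_geometric_of_lt_one (norm_nonneg _) (norm_ex_lt_one hτ)).mul_right _

theorem multipliable_ex {τ : ℂ} (hτ : 0 < τ.im) (z : ℂ) :
    Multipliable fun m : ℕ => 1 - ex (m * τ + z) := by
  simpa only [sub_eq_add_neg] using multipliable_one_add_of_summable (summable_ex hτ z)

theorem pochE_ne_zero {τ : ℂ} (hτ : 0 < τ.im) {z : ℂ} (hz : ∀ m : ℕ, ex (m * τ + z) ≠ 1) :
    pochE τ z ≠ 0 := by
  have := tprod_one_add_ne_zero_of_summable (f := fun m : ℕ => -ex (m * τ + z))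
    (fun m hm => hz m (by linear_combination -hm)) (summable_ex hτ z)
  simpa only [pochE, sub_eq_add_neg] using this

theorem tendsto_eulerProd {τ : ℂ} (hτ : 0 < τ.im) :
    Filter.Tendsto (eulerProd τ) Filter.atTop (nhds (pochE τ τ)) := by
  have := (multipliable_ex hτ τ).hasProd.tendsto_prod_nat
  refine this.congr fun n => Finset.prod_congr rfl fun i _ => ?_
  rw [add_mul, one_mul]

theorem pochE_self_ne_zero {τ : ℂ} (hτ : 0 < τ.im) : pochE τ τ ≠ 0 :=
  pochE_ne_zero hτ fun m hm => one_sub_ex_ne_zero hτ m (by rw [add_mul, one_mul, hm, sub_self])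

/-- Jacobi's triple product. -/
theorem triple_product {τ : ℂ} (hτ : 0 < τ.im) (z : ℂ) :
    jacobiTheta₂ (z + 1 / 2 - τ / 2) τ = pochE τ τ * (pochE τ z * pochE τ (τ - z)) := by
  have hlim := tendsto_eulerProd hτ
  have hP := pochE_self_ne_zero hτ
  have h1 : Filter.Tendsto
      (fun N => ∏ m ∈ Finset.range N, ((1 - ex (m * τ + z)) * (1 - ex (m * τ + (τ - z)))))
      Filter.atTop (nhds (pochE τ z * pochE τ (τ - z))) :=
    ((multipliable_ex hτ z).hasProd.mul (multipliable_ex hτ (τ - z)).hasProd).tendsto_prod_nat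
  simp only [finite_triple_product hτ] at h1
  -- The finite Euler products converge to a nonzero limit, so they and their inverses are bounded.
  -- This dominates the truncated series by a multiple of the theta series, uniformly in `N`.
  obtain ⟨M, hM⟩ := (Metric.isBounded_range_of_tendsto _ hlim).exists_norm_le
  obtain ⟨K, hK⟩ := (Metric.isBounded_range_of_tendsto _ (hlim.inv₀ hP)).exists_norm_le
  have hM : ∀ n, ‖eulerProd τ n‖ ≤ M := fun n => hM _ ⟨n, rfl⟩
  have hK : ∀ n, ‖(eulerProd τ n)⁻¹‖ ≤ K := fun n => hK _ ⟨n, rfl⟩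
  have hM0 : 0 ≤ M := (norm_nonneg _).trans (hM 0)
  have hK0 : 0 ≤ K := (norm_nonneg _).trans (hK 0)
  have hs := hasSum_jacobiTheta₂_term (z + 1 / 2 - τ / 2) hτ
  have h2 := tendsto_tsum_of_dominated_convergence (𝓕 := Filter.atTop)
    (f := fun (N : ℕ) (k : ℤ) => if k.natAbs ≤ N then
      jacobiTheta₂_term k (z + 1 / 2 - τ / 2) τ *
        (eulerProd τ (2 * N) / (eulerProd τ (N + k).toNat * eulerProd τ (N - k).toNat)) else 0)
    (g := fun k => jacobiTheta₂_term k (z + 1 / 2 - τ / 2) τ * (pochE τ τ)⁻¹)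
    (hs.summable.norm.mul_right (M * (K * K))) (fun k => ?_) (.of_forall fun N k => ?_)
  · have := tendsto_nhds_unique h1 h2
    rw [this, tsum_mul_right, jacobiTheta₂]
    field_simp
  · have t1 : Filter.Tendsto (fun N : ℕ => 2 * N) Filter.atTop Filter.atTop :=
      Filter.tendsto_atTop_mono (fun N => Nat.le_mul_of_pos_left N two_pos) Filter.tendsto_id
    have t2 : Filter.Tendsto (fun N : ℕ => ((N : ℤ) + k).toNat) Filter.atTop Filter.atTop :=
      Filter.tendsto_atTop_mono (f := fun N => N - k.natAbs) (fun N => by omega)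
        (Filter.tendsto_sub_atTop_nat _)
    have t3 : Filter.Tendsto (fun N : ℕ => ((N : ℤ) - k).toNat) Filter.atTop Filter.atTop :=
      Filter.tendsto_atTop_mono (f := fun N => N - k.natAbs) (fun N => by omega)
        (Filter.tendsto_sub_atTop_nat _)
    have := ((hlim.comp t1).div ((hlim.comp t2).mul (hlim.comp t3)) (mul_ne_zero hP hP)).const_mul
      (jacobiTheta₂_term k (z + 1 / 2 - τ / 2) τ)
    rw [div_mul_cancel_left₀ hP] at this
    refine this.congr' ?_
    filter_upwards [Filter.eventually_ge_atTop k.natAbs] with N hN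
    rw [if_pos hN]
    rfl
  · split_ifs
    · rw [norm_mul, div_eq_mul_inv (eulerProd τ _), mul_inv, norm_mul, norm_mul]
      gcongr
      · exact hM _
      · exact hK _
      · exact hK _
    · rw [norm_zero]
      positivity

theorem theta1_eq_pochE (z : ℂ) {τ : ℂ} (hτ : 0 < τ.im) :
    theta1 z τ = Complex.exp (Real.pi * Complex.I * (τ / 4 - z - 1 / 2)) *
      (pochE τ τ * (pochE τ z * pochE τ (τ - z))) := by
  rw [theta1_eq_jacobiTheta₂, triple_product hτ]

/-- By the triple product a zero of theta is a zero of one of the factors, and these lie on the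
period lattice. -/
theorem theta1_ne_zero {z τ : ℂ} (hτ : 0 < τ.im) (hz : ∀ m n : ℤ, z ≠ m + n * τ) :
    theta1 z τ ≠ 0 := by
  rw [theta1_eq_pochE z hτ]
  refine mul_ne_zero (Complex.exp_ne_zero _) (mul_ne_zero (pochE_self_ne_zero hτ)
    (mul_ne_zero (pochE_ne_zero hτ fun k hk => ?_) (pochE_ne_zero hτ fun k hk => ?_)))
  · obtain ⟨m, hm⟩ := ex_eq_one_iff.1 hk
    refine hz m (-k) ?_
    push_cast
    linear_combination hm
  · obtain ⟨m, hm⟩ := ex_eq_one_iff.1 hk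
    refine hz (-m) (k + 1) ?_
    push_cast
    linear_combination -hm

end Elliptic

namespace Elliptic

/-! ### The elliptic gamma function -/

/-- The double product `∏ (1 - e^(2πi(mτ + nτ' + z)))`. -/
def dpochE (τ τ' z : ℂ) : ℂ := ∏' p : ℕ × ℕ, (1 - ex (p.1 * τ + (p.2 * τ' + z)))

theorem summable_ex₂ {τ τ' : ℂ} (hτ : 0 < τ.im) (hτ' : 0 < τ'.im) (z : ℂ) :
    Summable fun p : ℕ × ℕ => ‖-ex (p.1 * τ + (p.2 * τ' + z))‖ := by
  simp only [norm_neg, ex_add, ex_nat_mul, norm_mul, norm_pow, ← mul_assoc]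
  refine Summable.mul_right _ (Summable.mul_of_nonneg
    (f := fun m : ℕ => ‖ex τ‖ ^ m) (g := fun n : ℕ => ‖ex τ'‖ ^ n)
    (summable_geometric_of_lt_one (norm_nonneg _) (norm_ex_lt_one hτ))
    (summable_geometric_of_lt_one (norm_nonneg _) (norm_ex_lt_one hτ'))
    (fun _ => by positivity) fun _ => by positivity)

theorem multipliable_ex₂ {τ τ' : ℂ} (hτ : 0 < τ.im) (hτ' : 0 < τ'.im) (z : ℂ) :
    Multipliable fun p : ℕ × ℕ => 1 - ex (p.1 * τ + (p.2 * τ' + z)) := by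
  simpa only [sub_eq_add_neg] using multipliable_one_add_of_summable (summable_ex₂ hτ hτ' z)

theorem dpochE_ne_zero {τ τ' : ℂ} (hτ : 0 < τ.im) (hτ' : 0 < τ'.im) {z : ℂ}
    (hz : ∀ m n : ℕ, ex (m * τ + (n * τ' + z)) ≠ 1) : dpochE τ τ' z ≠ 0 := by
  have := tprod_one_add_ne_zero_of_summable
    (f := fun p : ℕ × ℕ => -ex (p.1 * τ + (p.2 * τ' + z)))
    (fun p hp => hz p.1 p.2 (by linear_combination -hp)) (summable_ex₂ hτ hτ' z)
  simpa only [dpochE, sub_eq_add_neg] using this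

theorem hasProd_pochE {τ τ' : ℂ} (hτ : 0 < τ.im) (hτ' : 0 < τ'.im) (z : ℂ) :
    HasProd (fun n : ℕ => pochE τ (n * τ' + z)) (dpochE τ τ' z) :=
  HasProd.prod_fiberwise
    (f := fun p : ℕ × ℕ => 1 - ex (p.2 * τ + (p.1 * τ' + z)))
    ((Equiv.prodComm ℕ ℕ).hasProd_iff.2 (multipliable_ex₂ hτ hτ' z).hasProd)
    fun n => (multipliable_ex hτ (n * τ' + z)).hasProd

theorem dpochE_eq {τ τ' : ℂ} (hτ : 0 < τ.im) (hτ' : 0 < τ'.im) (z : ℂ) :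
    dpochE τ τ' z = pochE τ z * dpochE τ τ' (z + τ') := by
  have h : ∀ n : ℕ, pochE τ (n * τ' + (z + τ')) = pochE τ ((n + 1 : ℕ) * τ' + z) := fun n => by
    congr 1
    push_cast
    ring
  have h1 := hasProd_pochE hτ hτ' (z + τ')
  simp only [h] at h1
  rw [← (hasProd_pochE hτ hτ' z).tprod_eq,
    tprod_eq_zero_mul' (f := fun n : ℕ => pochE τ (n * τ' + z)) h1.multipliable, h1.tprod_eq]
  simp

theorem ellGamma_eq {τ τ' : ℂ} (hτ : 0 < τ.im) (hτ' : 0 < τ'.im) {z : ℂ}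
    (hz : dpochE τ τ' z ≠ 0) :
    ellGamma z τ τ' = dpochE τ τ' (τ + τ' - z) / dpochE τ τ' z := by
  rw [dpochE, dpochE, ← (multipliable_ex₂ hτ hτ' (τ + τ' - z)).tprod_div₀
    (multipliable_ex₂ hτ hτ' z) hz]
  refine tprod_congr fun p => ?_
  rw [ex, ex]
  ring_nf

/-- Shifting by `τ'` removes one row from the denominator and adds one to the numerator. Their
product is theta up to an exponential and a constant. -/
theorem ellGamma_add {τ τ' : ℂ} (hτ : 0 < τ.im) (hτ' : 0 < τ'.im) {z : ℂ}
    (hz : dpochE τ τ' z ≠ 0) :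
    ellGamma (z + τ') τ τ' = pochE τ z * pochE τ (τ - z) * ellGamma z τ τ' := by
  have h1 := dpochE_eq hτ hτ' z
  have h2 := dpochE_eq hτ hτ' (τ - z)
  rw [h1] at hz
  have h3 := left_ne_zero_of_mul hz
  have h4 := right_ne_zero_of_mul hz
  rw [ellGamma_eq hτ hτ' h4, ellGamma_eq hτ hτ' (h1 ▸ hz), h1,
    show τ + τ' - (z + τ') = τ - z by ring, h2, show τ - z + τ' = τ + τ' - z by ring]
  field_simp

/-- The zeros and poles of the theta and gamma functions. -/
def lattice (η τ : ℂ) : Set ℂ :=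
  Set.range fun p : ℤ × ℤ × ℤ => (p.1 : ℂ) + p.2.1 * τ + p.2.2 * (2 * η)

theorem countable_lattice (η τ : ℂ) : (lattice η τ).Countable := Set.countable_range _

theorem dpochE_ne_zero_of_notMem {η τ : ℂ} (hη : 0 < η.im) (hτ : 0 < τ.im) {z : ℂ}
    (hz : z ∉ lattice η τ) :
    dpochE τ (2 * η) z ≠ 0 ∧ dpochE τ (2 * η) (τ + 2 * η - z) ≠ 0 := by
  have hη2 : 0 < (2 * η).im := by simpa using hη
  refine ⟨dpochE_ne_zero hτ hη2 fun k l h => ?_, dpochE_ne_zero hτ hη2 fun k l h => ?_⟩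
  · obtain ⟨m, hm⟩ := ex_eq_one_iff.1 h
    refine hz ⟨(m, -k, -l), ?_⟩
    push_cast
    linear_combination -hm
  · obtain ⟨m, hm⟩ := ex_eq_one_iff.1 h
    refine hz ⟨(-m, k + 1, l + 1), ?_⟩
    push_cast
    linear_combination hm

theorem notMem_lattice_add {η τ z : ℂ} (hz : z ∉ lattice η τ) (i : ℤ) :
    z + 2 * η * i ∉ lattice η τ := by
  rintro ⟨⟨a, b, c⟩, h⟩
  refine hz ⟨(a, b, c - i), ?_⟩
  push_cast at h ⊢
  linear_combination h

/-- The logarithm of the constant in the functional equation of the gamma function. -/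
def gaugeConst (η τ : ℂ) : ℂ :=
  -(Real.pi * Complex.I * (τ / 4 - 1 / 2)) - Complex.log (pochE τ τ) - Real.pi * Complex.I * η

/-- The exponential factor that normalizes the functional equation of the gamma function. -/
def gauge (η τ c : ℂ) : ℂ := Complex.exp (Real.pi * Complex.I * η * c ^ 2 + gaugeConst η τ * c)

theorem gauge_ne_zero (η τ c : ℂ) : gauge η τ c ≠ 0 := Complex.exp_ne_zero _

/-- The gamma function with the functional equation `G(c + 1) = [c] G(c)`. -/
def egam (η τ c : ℂ) : ℂ := gam η τ (2 * c) / gauge η τ c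

/-- The increment of the Gaussian exponent of `gauge` is affine in `c` and matches the exponential
prefactor of the triple product; `gaugeConst` absorbs the rest. -/
theorem isGammaAt_egam {η τ : ℂ} (hη : 0 < η.im) (hτ : 0 < τ.im) {c : ℂ}
    (hc : 2 * η * c ∉ lattice η τ) : IsGammaAt (num η τ) (egam η τ) c := by
  have hη2 : 0 < (2 * η).im := by simpa using hη
  intro i
  have hi : 2 * η * (c + i) ∉ lattice η τ := by
    rw [mul_add]
    exact notMem_lattice_add hc i
  generalize c + (i : ℂ) = d at hi
  obtain ⟨h1, h2⟩ := dpochE_ne_zero_of_notMem hη hτ hi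
  have e0 : η * (2 * d) = 2 * η * d := by ring
  have hgam : gam η τ (2 * d) ≠ 0 := by
    rw [gam, e0, ellGamma_eq hτ hη2 h1]
    exact div_ne_zero h2 h1
  refine ⟨?_, div_ne_zero hgam (gauge_ne_zero _ _ _), theta1_ne_zero hτ fun m n h => hi
    ⟨(m, n, 0), by rw [h]; simp⟩⟩
  have hP : Complex.exp (Complex.log (pochE τ τ)) = pochE τ τ :=
    Complex.exp_log (pochE_self_ne_zero hτ)
  have hg : gauge η τ (d + 1) * (Complex.exp (Real.pi * Complex.I * (τ / 4 - 2 * η * d - 1 / 2)) *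
      pochE τ τ) = gauge η τ d := by
    rw [← hP, gauge, gauge, gaugeConst, ← Complex.exp_add, ← Complex.exp_add]
    congr 1
    ring
  rw [egam, egam, div_eq_iff (gauge_ne_zero _ _ _), gam, gam, e0,
    show η * (2 * (d + 1)) = 2 * η * d + 2 * η by ring, ellGamma_add hτ hη2 h1, num,
    theta1_eq_pochE _ hτ, ← hg]
  have := gauge_ne_zero η τ (d + 1)
  have := pochE_self_ne_zero hτ
  have := Complex.exp_ne_zero (Real.pi * Complex.I * (τ / 4 - 2 * η * d - 1 / 2))
  generalize Complex.exp (Real.pi * Complex.I * (τ / 4 - 2 * η * d - 1 / 2)) = E at *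
  field_simp

theorem gam_two_mul (η τ c : ℂ) : gam η τ (2 * c) = gauge η τ c * egam η τ c := by
  rw [egam, mul_div_cancel₀ _ (gauge_ne_zero _ _ _)]

/-! ### The operators -/

theorem ae_isGammaAt₁ {η τ : ℂ} (hη : 0 < η.im) (hτ : 0 < τ.im) (j : Fin 3) (c : ℂ) :
    ∀ᵐ x : X, IsGammaAt (num η τ) (egam η τ) (x j + c) := by
  have h0 : 2 * η ≠ 0 := by
    rintro h
    simp [(mul_eq_zero.1 h).resolve_left two_ne_zero] at hη
  filter_upwards [ae_notMem_of_countable₁ (countable_lattice η τ) j h0 (2 * η * c)] with x hx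
  refine isGammaAt_egam hη hτ ?_
  rwa [mul_add]

theorem ae_isGammaAt_add {η τ : ℂ} (hη : 0 < η.im) (hτ : 0 < τ.im) (i : Fin 2) (c : ℂ) :
    ∀ᵐ x : X, IsGammaAt (num η τ) (egam η τ) ((x i.castSucc + x i.succ + 1) / 2 + c) := by
  have h0 : η ≠ 0 := by
    rintro rfl
    simp at hη
  filter_upwards [ae_notMem_of_countable₂ (countable_lattice η τ) i h0 η (η + 2 * η * c)]
    with x hx
  refine isGammaAt_egam hη hτ ?_
  rwa [show 2 * η * ((x i.castSucc + x i.succ + 1) / 2 + c) =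
    η * x i.castSucc + η * x i.succ + (η + 2 * η * c) by ring]

theorem ae_isGammaAt_sub {η τ : ℂ} (hη : 0 < η.im) (hτ : 0 < τ.im) (i : Fin 2) (c : ℂ) :
    ∀ᵐ x : X, IsGammaAt (num η τ) (egam η τ) ((x i.castSucc - x i.succ + 1) / 2 + c) := by
  have h0 : η ≠ 0 := by
    rintro rfl
    simp at hη
  filter_upwards [ae_notMem_of_countable₂ (countable_lattice η τ) i h0 (-η) (η + 2 * η * c)]
    with x hx
  refine isGammaAt_egam hη hτ ?_
  rwa [show 2 * η * ((x i.castSucc - x i.succ + 1) / 2 + c) =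
    η * x i.castSucc + -η * x i.succ + (η + 2 * η * c) by ring]

/-- The series of `W(a)`. -/
def coeffW (η τ a : ℂ) (k : ℕ) (y : ℂ) : ℂ :=
  Complex.exp (-gaugeConst η τ * a) * ellCoeff (num η τ) (egam η τ) a k y

/-- The prefactor of `W(a)` cancels the Gaussian part of the gauge, leaving a constant exponential
in `a`. The elliptic shifted factorials are then contracted into values of `egam`, with the
reflection signs cancelling. -/
theorem coeffW_eq {η τ : ℂ} {y a : ℂ} (h1 : IsGammaAt (num η τ) (egam η τ) y)
    (h2 : IsGammaAt (num η τ) (egam η τ) (y + a)) (k : ℕ) :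
    Complex.exp (2 * Real.pi * Complex.I * a * η * y + Real.pi * Complex.I * η * a ^ 2) *
      (gam η τ (2 * y) / gam η τ (2 * y + 2 * a)) *
      (num η τ (-y - a + 2 * k) * poch η τ (-y - a) k * poch η τ (-a) k /
        (num η τ (-y - a) * poch η τ (-y + 1) k * fact η τ k)) = coeffW η τ a k y := by
  have hg : Complex.exp (2 * Real.pi * Complex.I * a * η * y + Real.pi * Complex.I * η * a ^ 2) *
      gauge η τ y = Complex.exp (-gaugeConst η τ * a) * gauge η τ (y + a) := by
    rw [gauge, gauge, ← Complex.exp_add, ← Complex.exp_add]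
    congr 1
    ring
  have e1 : poch η τ (-y - a) k = (-1) ^ k * rising (num η τ) (y + a - k + 1) k :=
    rising_reflect (num_neg η τ) _ _ _ (by ring)
  have e2 : poch η τ (-y + 1) k = (-1) ^ k * rising (num η τ) (y - k) k :=
    rising_reflect (num_neg η τ) _ _ _ (by ring)
  have e3 : num η τ (-y - a + 2 * k) = -num η τ (y + a - 2 * k) := by
    rw [← num_neg]
    congr 1
    ring
  have e4 : num η τ (-y - a) = -num η τ (y + a) := by
    rw [← num_neg]
    congr 1
    ring
  have g1 : egam η τ y = rising (num η τ) (y - k) k * egam η τ (y - k) :=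
    h1.shift (-k) k (by push_cast; ring) (by ring)
  have g2 : egam η τ (y + a + 1) =
      rising (num η τ) (y + a - k + 1) k * egam η τ (y + a - k + 1) :=
    h2.shift (1 - k) k (by push_cast; ring) (by ring)
  have g3 : egam η τ (y + a + 1) = num η τ (y + a) * egam η τ (y + a) := by
    have := (h2 0).1
    rwa [Int.cast_zero, add_zero] at this
  have n1 := h1.ne_zero y 0 (by simp)
  have n2 := h2.ne_zero (y + a + 1) 1 (by simp)
  rw [g1] at n1
  have n3 := n2
  rw [g2] at n2
  rw [g3] at n3
  have m1 := left_ne_zero_of_mul n1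
  have m2 := right_ne_zero_of_mul n1
  have m3 := left_ne_zero_of_mul n2
  have m4 := right_ne_zero_of_mul n2
  have m5 := left_ne_zero_of_mul n3
  have m6 := right_ne_zero_of_mul n3
  have m7 := gauge_ne_zero η τ (y + a)
  rw [← mul_add, gam_two_mul, gam_two_mul, e1, e2, e3, e4, coeffW, ellCoeff, g1,
    show poch η τ (-a) k = rising (num η τ) (-a) k from rfl,
    show fact η τ k = factorialOf (num η τ) k from rfl]
  have g5 : egam η τ (y + a) = rising (num η τ) (y + a - k + 1) k * egam η τ (y + a - k + 1) /
      num η τ (y + a) := by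
    rw [eq_div_iff m5, ← g2, g3, mul_comm]
  rw [g5, mul_div_mul_comm _ (rising (num η τ) (-a) k)]
  have hk : ((-1 : ℂ) ^ k) ≠ 0 := pow_ne_zero _ (neg_ne_zero.2 one_ne_zero)
  have m8 := gauge_ne_zero η τ y
  rw [eq_div_of_mul_eq m8 hg]
  generalize rising (num η τ) (-a) k / factorialOf (num η τ) k = Q
  generalize (-1 : ℂ) ^ k = e at hk ⊢
  generalize Complex.exp (-gaugeConst η τ * a) = E
  field_simp

theorem W_eq {η τ : ℂ} (hη : 0 < η.im) (hτ : 0 < τ.im) (j : Fin 3) (a : ℂ) :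
    W η τ j a = ShiftSeries.powerSeries (Pi.single j a) j
      fun k => ((fun x => coeffW η τ a k (x j) : X → ℂ) : Coef) := by
  rw [W, ShiftSeries.power_eq]
  congr 1
  funext k
  refine Filter.Germ.coe_eq.2 ?_
  filter_upwards [ae_isGammaAt₁ hη hτ j 0, ae_isGammaAt₁ hη hτ j a] with x h1 h2
  rw [add_zero] at h1
  exact coeffW_eq h1 h2 k

/-- The function by which `V(a)` multiplies. -/
def factorV (η τ a x y : ℂ) : ℂ :=
  Complex.exp ((2 * Real.pi * Complex.I * η + 2 * gaugeConst η τ) * a) *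
    ellFactor (egam η τ) a x y

/-- The gauge contributes an exponential in the sum of the two arguments. That sum depends on `z_i`
only, and the prefactor of `V(a)` cancels this dependence exactly. -/
theorem V_eq (η τ : ℂ) (i : Fin 2) (a : ℂ) :
    V η τ i a = ShiftSeries.mono 0
      ((fun x => factorV η τ a (x i.castSucc) (x i.succ) : X → ℂ) : Coef) := by
  have key : ∀ s : ℂ, gam η τ (2 * s + a) / gam η τ (2 * s - a) =
      Complex.exp (2 * Real.pi * Complex.I * η * s * a + gaugeConst η τ * a) *
        (egam η τ (s + a / 2) / egam η τ (s - a / 2)) := by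
    intro s
    rw [show 2 * s + a = 2 * (s + a / 2) by ring, show 2 * s - a = 2 * (s - a / 2) by ring,
      gam_two_mul, gam_two_mul, mul_div_mul_comm, gauge, gauge, ← Complex.exp_sub]
    congr 2
    ring
  rw [V, ShiftSeries.ofFun_eq]
  congr 2
  funext x
  have h1 := key ((x i.castSucc + x i.succ + 1) / 2)
  have h2 := key ((x i.castSucc - x i.succ + 1) / 2)
  rw [mul_div_cancel₀ _ two_ne_zero] at h1 h2
  have e0 : Complex.exp (-(2 * Real.pi * Complex.I * a * η * x i.castSucc)) *
      Complex.exp (2 * Real.pi * Complex.I * η * ((x i.castSucc + x i.succ + 1) / 2) * a +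
        gaugeConst η τ * a) *
      Complex.exp (2 * Real.pi * Complex.I * η * ((x i.castSucc - x i.succ + 1) / 2) * a +
        gaugeConst η τ * a) =
      Complex.exp ((2 * Real.pi * Complex.I * η + 2 * gaugeConst η τ) * a) := by
    rw [← Complex.exp_add, ← Complex.exp_add]
    congr 1
    ring
  rw [h1, h2, factorV, ellFactor, ← e0]
  ring

theorem V_mul_neg {η τ : ℂ} (hη : 0 < η.im) (hτ : 0 < τ.im) (i : Fin 2) (a : ℂ) :
    V η τ i (-a) * V η τ i a = 1 := by
  rw [V_eq, V_eq, ShiftSeries.mono_mul_mono, ShiftSeries.one_eq, zero_add, Coef.zero_shift]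
  congr 1
  have : ∀ᵐ x : X, factorV η τ (-a) (x i.castSucc) (x i.succ) *
      factorV η τ a (x i.castSucc) (x i.succ) = 1 := by
    filter_upwards [ae_isGammaAt_add hη hτ i (a / 2), ae_isGammaAt_add hη hτ i (-(a / 2)),
      ae_isGammaAt_sub hη hτ i (a / 2), ae_isGammaAt_sub hη hτ i (-(a / 2))] with x h1 h2 h3 h4
    have h1 := h1.ne_zero _ 0 (by rw [Int.cast_zero, add_zero])
    have h2 := h2.ne_zero _ 0 (by rw [Int.cast_zero, add_zero])
    have h3 := h3.ne_zero _ 0 (by rw [Int.cast_zero, add_zero])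
    have h4 := h4.ne_zero _ 0 (by rw [Int.cast_zero, add_zero])
    rw [factorV, factorV, ellFactor, ellFactor, mul_mul_mul_comm, ← Complex.exp_add,
      mul_neg, neg_add_cancel, Complex.exp_zero, one_mul, neg_div, sub_neg_eq_add, sub_neg_eq_add,
      sub_eq_add_neg _ (a / 2), sub_eq_add_neg _ (a / 2), mul_mul_mul_comm,
      div_mul_div_cancel₀ h1, div_mul_div_cancel₀ h3, div_self h2, div_self h4, one_mul]
  exact Filter.Germ.coe_eq.2 this

theorem V_zero {η τ : ℂ} (hη : 0 < η.im) (hτ : 0 < τ.im) (i : Fin 2) : V η τ i 0 = 1 := by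
  rw [V_eq, ShiftSeries.one_eq]
  congr 1
  have : ∀ᵐ x : X, factorV η τ 0 (x i.castSucc) (x i.succ) = 1 := by
    filter_upwards [ae_isGammaAt_add hη hτ i 0, ae_isGammaAt_sub hη hτ i 0] with x h1 h2
    have h1 := h1.ne_zero _ 0 (by rw [Int.cast_zero, add_zero])
    have h2 := h2.ne_zero _ 0 (by rw [Int.cast_zero, add_zero])
    rw [add_zero] at h1 h2
    rw [factorV, ellFactor, zero_div, sub_zero, sub_zero, add_zero, add_zero, div_self h1, div_self h2]
    simp
  exact Filter.Germ.coe_eq.2 this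

theorem W_zero {η τ : ℂ} (hη : 0 < η.im) (hτ : 0 < τ.im) (j : Fin 3) : W η τ j 0 = 1 := by
  have h0 : num η τ 0 = 0 := by
    have := num_neg η τ 0
    rw [neg_zero] at this
    exact self_eq_neg.1 this
  rw [W_eq hη hτ, ShiftSeries.one_eq, Pi.single_zero]
  ext1
  · rfl
  · ext1 n
    simp only [ShiftSeries.powerSeries, ShiftSeries.mono]
    by_cases h : n = 0
    · subst h
      rw [if_pos (by simp), if_pos rfl]
      refine Filter.Germ.coe_eq.2 ?_
      filter_upwards [ae_isGammaAt₁ hη hτ j 0] with x h1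
      rw [add_zero] at h1
      have h2 := h1.ne_zero (x j + 1) 1 (by simp)
      have h3 := (h1 0).1
      rw [Int.cast_zero, add_zero] at h3
      simp only [coeffW, ellCoeff, Finsupp.coe_zero, Pi.zero_apply, Nat.cast_zero, mul_zero,
        Complex.exp_zero, one_mul, add_zero, sub_zero, rising_zero, factorialOf_zero, div_one,
        mul_one]
      rw [← mul_div_assoc, ← h3, div_self h2]
    · rw [if_neg h]
      by_cases h2 : n = Finsupp.single j (n j)
      · rw [if_pos h2]
        obtain ⟨m, hm⟩ : ∃ m, n j = m + 1 := Nat.exists_eq_succ_of_ne_zero fun h0 => h (by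
          rw [h2, h0, Finsupp.single_zero])
        rw [hm]
        simp [coeffW, ellCoeff, rising_succ', h0]
        rfl
      · rw [if_neg h2]

theorem braid_left {η τ : ℂ} (hη : 0 < η.im) (hτ : 0 < τ.im)
    (hk : ∀ k : ℕ, 0 < k → num η τ k ≠ 0) (i : Fin 2) (a b : ℂ) :
    W η τ i.castSucc b * V η τ i (a + b) * W η τ i.castSucc a =
      V η τ i a * W η τ i.castSucc (a + b) * V η τ i b := by
  refine ShiftSeries.braid_of_ae (w := fun _ => 0) (W_eq hη hτ i.castSucc) (V_eq η τ i)
    (fun a b => Pi.single_add _ _ _) (fun a b => (add_zero _).symm) a b fun n => ?_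
  filter_upwards [ae_isGammaAt₁ hη hτ i.castSucc 0, ae_isGammaAt₁ hη hτ i.castSucc b,
    ae_isGammaAt₁ hη hτ i.castSucc (a + b), ae_isGammaAt_add hη hτ i (a / 2),
    ae_isGammaAt_sub hη hτ i (a / 2), ae_isGammaAt_add hη hτ i (-(a / 2)),
    ae_isGammaAt_sub hη hτ i (-(a / 2)), ae_isGammaAt_add hη hτ i (a / 2 + b),
    ae_isGammaAt_sub hη hτ i (a / 2 + b)] with x h1 h2 h3 h4 h5 h6 h7 h8 h9
  have hij : i.succ ≠ i.castSucc := by simp [Fin.ext_iff]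
  rw [add_zero] at h1
  rw [← add_assoc] at h3 h8 h9
  rw [← sub_eq_add_neg] at h6 h7
  have key := ellCoeff_braid_left (num_neg η τ) (num_three_term η hτ) hk h1 h2 h3 h4 h5 h6 h7 h8 h9
    n
  -- The remaining gauge factors are exponentials linear in the parameter. They contribute the same
  -- constant to both sides, because the parameters of `W` add up to `a + b` on each side and so do
  -- those of `V`.
  have key := congrArg (fun z => Complex.exp (-gaugeConst η τ * b) *
    Complex.exp ((2 * Real.pi * Complex.I * η + 2 * gaugeConst η τ) * (a + b)) *
    Complex.exp (-gaugeConst η τ * a) * z) key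
  simp only [Finset.mul_sum] at key
  simp only [Pi.add_apply, Pi.zero_apply, Pi.smul_apply, dir, Pi.single_eq_same,
    Pi.single_eq_of_ne hij, smul_eq_mul, mul_zero, add_zero, zero_add, mul_neg]
  refine (Finset.sum_congr rfl fun p hp => ?_).trans (key.trans ?_)
  · rw [show x i.castSucc + (b + -((p.1 : ℂ) * 2)) = x i.castSucc + b - 2 * p.1 by ring]
    simp only [coeffW, factorV]
    ring
  · rw [show x i.castSucc + (a + b + -((n : ℂ) * 2)) = x i.castSucc + a + b - 2 * n by ring]
    simp only [coeffW, factorV, mul_add, Complex.exp_add]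
    ring

theorem braid_right {η τ : ℂ} (hη : 0 < η.im) (hτ : 0 < τ.im)
    (hk : ∀ k : ℕ, 0 < k → num η τ k ≠ 0) (i : Fin 2) (a b : ℂ) :
    W η τ i.succ b * V η τ i (a + b) * W η τ i.succ a =
      V η τ i a * W η τ i.succ (a + b) * V η τ i b := by
  refine ShiftSeries.braid_of_ae (w := fun _ => 0) (W_eq hη hτ i.succ) (V_eq η τ i)
    (fun a b => Pi.single_add _ _ _) (fun a b => (add_zero _).symm) a b fun n => ?_
  filter_upwards [ae_isGammaAt₁ hη hτ i.succ 0, ae_isGammaAt₁ hη hτ i.succ b,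
    ae_isGammaAt₁ hη hτ i.succ (a + b), ae_isGammaAt_add hη hτ i (a / 2),
    ae_isGammaAt_sub hη hτ i (a / 2), ae_isGammaAt_add hη hτ i (-(a / 2)),
    ae_isGammaAt_sub hη hτ i (-(a / 2)), ae_isGammaAt_add hη hτ i (a / 2 + b),
    ae_isGammaAt_sub hη hτ i (-(a / 2) + -b)] with x h1 h2 h3 h4 h5 h6 h7 h8 h9
  have hij : i.castSucc ≠ i.succ := by simp [Fin.ext_iff]
  rw [add_zero] at h1
  rw [← add_assoc] at h3 h8 h9
  rw [← sub_eq_add_neg] at h6 h7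
  rw [← sub_eq_add_neg, ← sub_eq_add_neg] at h9
  have key := ellCoeff_braid_right (num_neg η τ) (num_three_term η hτ) hk h1 h2 h3 h4 h5 h6 h7 h8
    h9 n
  have key := congrArg (fun z => Complex.exp (-gaugeConst η τ * b) *
    Complex.exp ((2 * Real.pi * Complex.I * η + 2 * gaugeConst η τ) * (a + b)) *
    Complex.exp (-gaugeConst η τ * a) * z) key
  simp only [Finset.mul_sum] at key
  simp only [Pi.add_apply, Pi.zero_apply, Pi.smul_apply, dir, Pi.single_eq_same,
    Pi.single_eq_of_ne hij, smul_eq_mul, mul_zero, add_zero, zero_add, mul_neg]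
  refine (Finset.sum_congr rfl fun p hp => ?_).trans (key.trans ?_)
  · rw [show x i.succ + (b + -((p.1 : ℂ) * 2)) = x i.succ + b - 2 * p.1 by ring]
    simp only [coeffW, factorV]
    ring
  · rw [show x i.succ + (a + b + -((n : ℂ) * 2)) = x i.succ + a + b - 2 * n by ring]
    simp only [coeffW, factorV, mul_add, Complex.exp_add]
    ring

theorem factorRelations {η τ : ℂ} (hη : 0 < η.im) (hτ : 0 < τ.im)
    (hk : ∀ k : ℕ, 0 < k → num η τ k ≠ 0) : FactorRelations (S η τ) := by
  have hV : ∀ i a, (V η τ i a).IsLocal ∅ {i.castSucc, i.succ} := fun i a => by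
    rw [V_eq]
    refine ShiftSeries.isLocal_mono (fun k hk => rfl) fun w x hw => ?_
    rw [Pi.add_apply, Pi.add_apply, hw _ (Set.mem_insert _ _),
      hw _ (Set.mem_insert_of_mem _ rfl), add_zero, add_zero]
  refine ShiftSeries.factorRelations_of_local (fun j a => ?_)
    (fun i a => (hV i a).mono' (Set.empty_subset _) subset_rfl)
    (fun a b => (hV 0 a).comm (hV 1 b) (Set.empty_disjoint _) (Set.empty_disjoint _))
    (W_zero hη hτ) (V_zero hη hτ) (Or.inr (V_mul_neg hη hτ)) (fun i a b => ?_) (fun i a b => ?_)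
  · rw [W_eq hη hτ]
    refine ShiftSeries.isLocal_powerSeries (fun k hk => by simp [show k ≠ j from hk])
      (fun k hk => by simp [dir, show k ≠ j from hk]) fun k w x hw => ?_
    rw [Pi.add_apply, hw j rfl, add_zero]
  · have := braid_left hη hτ hk i b a
    rw [add_comm b a] at this
    exact this.symm
  · have := braid_right hη hτ hk i b a
    rw [add_comm b a] at this
    exact this.symm

end Elliptic

end ParamPerm

end

/-! ### The three cases together. -/

theorem mainTheorem6 :
    ParamPerm.FactorRelations ParamPerm.Undeformed.S ∧
    (∀ h : ℂ, h.re < 0 → ParamPerm.FactorRelations (ParamPerm.Quantum.S h)) ∧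
    (∀ η τ : ℂ, 0 < η.im → 0 < τ.im →
      (∀ k : ℕ, 0 < k → ParamPerm.Elliptic.num η τ k ≠ 0) →
      ParamPerm.FactorRelations (ParamPerm.Elliptic.S η τ)) :=
  ⟨ParamPerm.Undeformed.factorRelations, fun _ hh => ParamPerm.Quantum.factorRelations hh,
    fun _ _ hη hτ hk => ParamPerm.Elliptic.factorRelations hη hτ hk⟩
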